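/- **Setting.** Consider a discounted MDP with measurable state space $\mathcal S$, finite non-empty action set $\mathcal A$, transition kernel $p$, initial state distribution $\mu_0$ (possibly a point mass), measurable reward $|r|\le 1$, discount $\gamma\in[0,1)$, and a measurable feature map $\phi:\mathcal S\times\mathcal A\to\mathbb R^d$ with $\|\phi\|_2\le1$; no linearity of the MDP is assumed. For a policy $\pi$ let $d^\pi$ be its normalized discounted state-action occupancy measure and $Q^\pi(\cdot\,;f)$ its action-value function for the reward $f$. For a positive definite matrix $\Sigma$ let $\|x\|_\Sigma=\sqrt{x^\top\Sigma x}$. Put $B=\frac{3}{1-\gamma}$, $G_{max}=\frac{2+B}{1-\gamma}$, $W=2G_{max}$. Let $N,K\ge1$ be integers, $\eta>0$, $\delta\in(0,1)$, $\lambda,\beta$ real, and $$\kappa=\frac{(1-\gamma)\ln2}{2\ln(8N^2K/\delta)\,\eta\,(B+W)} .$$ **Algorithm.** Let $\widehat\Sigma^1=\lambda I$, let $\pi^0$ be the uniform policy. For $n=1,\dots,N$: 1. The *solver is called* at $n$ if $n=1$ or $\det\widehat\Sigma^n>2\det\widehat\Sigma^{\underline n}$, where $\underline n<n$ is the last iteration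 in which it was called; then set $\underline n=n$. Otherwise $\underline n$ and $\pi^n=\pi^{\underline n}$ are kept, together with the known set, the bonus and the critic of iteration $\underline n$. 2. A solver call at $n$ uses the following objects. A pair $(s,a)$ is *known* if $\sqrt\beta\|\phi(s,a)\|_{(\widehat\Sigma^n)^{-1}}<1$, and $s$ is known if all $(s,a)$ are. Let $b^n_\phi(s,a)=\sqrt\beta\|\phi(s,a)\|_{(\widehat\Sigma^n)^{-1}}\mathbf 1\{s\text{ known}\}$ and $b^n=2b^n_\phi+\frac{3}{1-\gamma}\mathbf 1\{(s,a)\text{ not known}\}$. Let $\rho^n=\frac1n\sum_{i<n}d^{\pi^i}$ be the occupancy of the policy cover. On known states $\pi^n_0$ is uniform on $\mathcal A$ and $\pi^n_{k+1}(\cdot|s)\propto\pi^n_k(\cdot|s)\,e^{\eta\widehat Q^n_k(s,\cdot)}$; on unknown states every $\pi^n_k(\cdot|s)$ is uniform on the actions $a$ with $(s,a)$ not known. For $k=0,\dots,K-1$: if $k=0$ or $k-\underline k>\kappa$, set $\underline k=k$ and collect $n$ fresh rollouts, which are i.i.d. given the past: $(s_1,a_1)\sim\rho^n$, $\Pr(h=\tau)=\gamma^{\tau-1}(1-\gamma)$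 for $\tau\ge1$, and $(s_2,a_2),\dots,(s_h,a_h)$ obtained by following $\pi^n_k$. With the importance weight $\varrho=\prod_{\tau=2}^h\frac{\pi^n_k(a_\tau|s_\tau)}{\pi^n_{\underline k}(a_\tau|s_\tau)}$, the regression target of a rollout in the current dataset is $y=\varrho\,\frac{r(s_h,a_h)+b^n(s_h,a_h)}{1-\gamma}-b^n(s_1,a_1)$. In a variant, which the result also covers, the bonus at $(s_1,a_1)$ is left out instead: $y=\varrho\,\frac{r(s_h,a_h)+b^n(s_h,a_h)}{1-\gamma}$ if $h\ge2$ and $y=\frac{r(s_1,a_1)}{1-\gamma}$ if $h=1$. Then $\widehat w^n_k$ is any minimizer over $\|w\|_2\le W$ of the sum over the dataset of $(\phi(s_1,a_1)^\top w-y)^2$, and $\widehat Q^n_k(s,a)=\phi(s,a)^\top\widehat w^n_k+\frac12b^n(s,a)$ if $s$ is known, $\widehat Q^n_k=b^n$ otherwise. The policy $\pi^n$ follows one of $\pi^n_0,\dots,\pi^n_{K-1}$, chosen uniformly, for a whole episode, so $d^{\pi^n}=\frac1K\sum_kd^{\pi^n_k}$. 3. Draw $(s,a)\sim d^{\pi^n}$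 given the past and set $\widehat\Sigma^{n+1}=\widehat\Sigma^n+\phi(s,a)\phi(s,a)^\top$. **Comparison predictor.** For a solver call at $n$, let $w^{n,\star}_k$ be any minimizer over $\|w\|_2\le W$ of $\frac12\mathbb E_{(s,a)\sim\rho^n}\big[\phi(s,a)^\top w-(Q^{\pi^n_k}(s,a;r+b^n)-b^n(s,a))\big]^2$. Let $Q^{n,\star}_k(s,a)=\phi(s,a)^\top w^{n,\star}_k+2b^n_\phi(s,a)$ if $s$ is known, and $Q^{n,\star}_k=b^n$ otherwise. If the solver is not called at $n$, all of $\widehat\Sigma^n$ (in the definitions of the known set and $b_\phi^n$), $b^n_\phi$, $Q^{n,\star}_k$, $\widehat Q^n_k$ and the known set in the claim denote those of iteration $\underline n$. **Lemma (validity of confidence intervals; one-sided errors).** There is a universal constant $c>0$ such that whenever $$\lambda\ \ge\ c\,d\ln\frac{2N}{\delta},\qquad \beta\ \ge\ c\Big(d\,(W^2+G_{max}^2)\ln\frac{2NK}{(1-\gamma)\delta}+\lambda W^2\Big),$$ the following holds with probability at least $1-\frac\delta2$, simultaneously for all $n\in\{1,\dots,N\}$, all $k\in\{0,\dots,K-1\}$,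 all minimizers $w^{n,\star}_k$ and all known $(s,a)$ (in particular, for all known states $s$ and all $a$): $$\big|Q^{n,\star}_k(s,a)-\widehat Q^n_k(s,a)-b^n_\phi(s,a)\big|\le b^n_\phi(s,a),\qquad\text{equivalently}\qquad 0\le Q^{n,\star}_k(s,a)-\widehat Q^n_k(s,a)\le 2b^n_\phi(s,a).$$ -/

import Mathlib

open MeasureTheory ProbabilityTheory

namespace Copoe

/-! ### Markov decision processes with features -/

/-- A discounted MDP on the state space `S` with actions `A`, together with a feature map into
`ℝ^d`. No relation (such as linearity) between the features and the dynamics is assumed. -/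
structure FeatureMDP (S A : Type*) [MeasurableSpace S] [MeasurableSpace A] (d : ℕ) where
  /-- the transition kernel `p(· ∣ s, a)` -/
  p : Kernel (S × A) S
  isMarkov_p : IsMarkovKernel p
  /-- the distribution of the initial state (a Dirac mass for a fixed start state) -/
  init : Measure S
  isProb_init : IsProbabilityMeasure init
  /-- the reward -/
  r : S × A → ℝ
  measurable_r : Measurable r
  abs_r_le : ∀ x, |r x| ≤ 1
  /-- the discount factor -/
  γ : ℝ
  γ_nonneg : 0 ≤ γ
  γ_lt_one : γ < 1
  /-- the feature map -/
  φ : S × A → EuclideanSpace ℝ (Fin d)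
  measurable_φ : Measurable φ
  norm_φ_le : ∀ x, ‖φ x‖ ≤ 1

attribute [instance] FeatureMDP.isMarkov_p FeatureMDP.isProb_init

/-- A stationary stochastic policy with finitely many actions. -/
structure Policy (S A : Type*) [MeasurableSpace S] [Fintype A] where
  prob : S → A → ℝ
  measurable_prob : ∀ a, Measurable fun s => prob s a
  nonneg : ∀ s a, 0 ≤ prob s a
  sum_eq_one : ∀ s, ∑ a, prob s a = 1

section Chain

variable {S A : Type*} [MeasurableSpace S] [Fintype A] [MeasurableSpace A] {d : ℕ}

/-- A policy as a Markov kernel from states to actions. -/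
noncomputable def Policy.kernel (π : Policy S A) : Kernel S A where
  toFun s := ∑ a, ENNReal.ofReal (π.prob s a) • Measure.dirac a
  measurable' := by
    refine Measure.measurable_of_measurable_coe _ fun E _ => ?_
    simp only [Measure.coe_finsetSum, Finset.sum_apply, Measure.smul_apply, smul_eq_mul]
    exact Finset.measurable_sum _ fun a _ =>
      ((π.measurable_prob a).ennreal_ofReal).mul_const _

instance Policy.isMarkov_kernel (π : Policy S A) : IsMarkovKernel π.kernel where
  isProbabilityMeasure s := by
    constructor
    change (∑ a, ENNReal.ofReal (π.prob s a) • Measure.dirac a : Measure A) Set.univ = 1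
    simp only [Measure.coe_finsetSum, Finset.sum_apply, Measure.smul_apply, smul_eq_mul,
      measure_univ, mul_one]
    rw [← ENNReal.ofReal_sum_of_nonneg fun a _ => π.nonneg s a, π.sum_eq_one s,
      ENNReal.ofReal_one]

/-- The uniform policy. -/
noncomputable def Policy.uniform (S A : Type*) [MeasurableSpace S] [Fintype A] [Nonempty A] :
    Policy S A where
  prob _ _ := 1 / Fintype.card A
  measurable_prob _ := measurable_const
  nonneg _ _ := by positivity
  sum_eq_one _ := by simp

/-- One step of the state-action chain under `π`: `s' ∼ p(· ∣ s, a)`, then `a' ∼ π(· ∣ s')`. -/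
noncomputable def stepKernel (M : FeatureMDP S A d) (π : Policy S A) :
    Kernel (S × A) (S × A) :=
  M.p.compProd (Kernel.prodMkLeft (S × A) π.kernel)

instance (M : FeatureMDP S A d) (π : Policy S A) : IsMarkovKernel (stepKernel M π) := by
  unfold stepKernel; infer_instance

/-- The law of the infinite state-action trajectory `x 0, x 1, …` with `x 0 ∼ μ` and, after
that, actions drawn from `π`. -/
noncomputable def trajLaw (M : FeatureMDP S A d) (π : Policy S A) (μ : Measure (S × A)) :
    Measure (ℕ → S × A) :=
  Kernel.trajMeasure (X := fun _ => S × A) μ fun n =>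
    (stepKernel M π).comap (fun x => x ⟨n, Finset.mem_Iic.2 le_rfl⟩) (measurable_pi_apply _)

/-- The law of a number of steps `t ≥ 0` with `P(t) = γ ^ t (1 - γ)`
(that is, `τ - 1` for `τ ≥ 1` with `P(τ) = γ ^ (τ - 1) (1 - γ)`). -/
noncomputable def horizonLaw (M : FeatureMDP S A d) : Measure ℕ :=
  geometricMeasure ⟨1 - M.γ, by linarith [M.γ_lt_one], by linarith [M.γ_nonneg]⟩

/-- The law of the state-action reached by a random number of steps (drawn from `horizonLaw`) of
`π` from the initial state; this is the discounted occupancy measure `d^π`. -/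
noncomputable def occ (M : FeatureMDP S A d) (π : Policy S A) : Measure (S × A) :=
  ((horizonLaw M).prod (trajLaw M π (M.init.compProd π.kernel))).map fun z => z.2 z.1

/-- A rollout is a pair `(l, x)`: the trajectory has length `h = l + 1` and consists of
`(s_1, a_1) = x 0, …, (s_h, a_h) = x l`; later values of `x` are never used. -/
abbrev Rollout (S A : Type*) := ℕ × (ℕ → S × A)

/-- The law of a rollout with first state-action drawn from `ρ`, geometric length, and
continued with `π`. -/
noncomputable def rolloutLaw (M : FeatureMDP S A d) (ρ : Measure (S × A)) (π : Policy S A) :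
    Measure (Rollout S A) :=
  (horizonLaw M).prod (trajLaw M π ρ)

/-- `Q^π(s, a; f) = ∑ₜ γ^t E[f(s_t, a_t) ∣ (s_0, a_0) = (s, a)]`. -/
noncomputable def qValue (M : FeatureMDP S A d) (π : Policy S A) (f : S × A → ℝ) (x : S × A) : ℝ :=
  ∑' t : ℕ, M.γ ^ t * ∫ y, f (y t) ∂(trajLaw M π (Measure.dirac x))

end Chain

/-! ### Parameters -/

/-- The two forms of the regression target, for a rollout of length `h` with return weights `ρ`:
`offset` is `ρ (r(s_h,a_h) + b(s_h,a_h)) / (1-γ) - b(s_1,a_1)`;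
`censored` is `ρ (r(s_h,a_h) + b(s_h,a_h)) / (1-γ)` when `h ≥ 2` and `r(s_1,a_1) / (1-γ)` when
`h = 1`. -/
inductive TargetForm
  | offset
  | censored

/-- The free parameters of the algorithm: numbers of outer and inner iterations, learning rate,
failure probability, regularization, confidence width, and the form of the regression target. -/
structure Params where
  N : ℕ
  K : ℕ
  η : ℝ
  δ : ℝ
  lam : ℝ
  β : ℝ
  form : TargetForm

section Constants

variable {S A : Type*} [MeasurableSpace S] [MeasurableSpace A] {d : ℕ} (M : FeatureMDP S A d)

/-- `B = 3 / (1 - γ)`. -/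
noncomputable def FeatureMDP.B : ℝ := 3 / (1 - M.γ)

/-- `G_max = (2 + B) / (1 - γ)`. -/
noncomputable def FeatureMDP.Gmax : ℝ := (2 + M.B) / (1 - M.γ)

/-- The radius `W = 2 G_max` of the regression ball. -/
noncomputable def FeatureMDP.W : ℝ := 2 * M.Gmax

/-- The data reuse window `κ`. -/
noncomputable def kappa (P : Params) : ℝ :=
  (1 - M.γ) * Real.log 2 / (2 * Real.log (8 * P.N ^ 2 * P.K / P.δ) * P.η * (M.B + M.W))

/-- The last inner iteration `≤ k` at which data were collected. -/
noncomputable def lastCollect (P : Params) : ℕ → ℕ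
  | 0 => 0
  | k + 1 =>
    open Classical in
    if kappa M P < ((k + 1 : ℕ) : ℝ) - lastCollect P k then k + 1 else lastCollect P k

end Constants

/-! ### Known set, bonus, critic and inner policies

Here `Sg` is the empirical covariance matrix that the bonus refers to, and `w j` are the critic's
regression parameters in inner iteration `j`. -/

section Solver

variable {S A : Type*} [MeasurableSpace S] [Fintype A] [MeasurableSpace A] {d : ℕ}

/-- `‖x‖_Q = √(xᵀ Q x)`. -/
noncomputable def wnorm (Q : Matrix (Fin d) (Fin d) ℝ) (x : EuclideanSpace ℝ (Fin d)) : ℝ :=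
  √(x.ofLp ⬝ᵥ Q.mulVec x.ofLp)

/-- The state-action `x` is known. -/
def KnownPair (M : FeatureMDP S A d) (P : Params) (Sg : Matrix (Fin d) (Fin d) ℝ)
    (x : S × A) : Prop :=
  √P.β * wnorm Sg⁻¹ (M.φ x) < 1

/-- The state `s` is known: all its state-actions are. -/
def KnownState (M : FeatureMDP S A d) (P : Params) (Sg : Matrix (Fin d) (Fin d) ℝ)
    (s : S) : Prop :=
  ∀ a, KnownPair M P Sg (s, a)

open Classical in
/-- `b_φ(s, a) = √β ‖φ(s, a)‖_{Sg⁻¹} 1{s known}`. -/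
noncomputable def bonusPhi (M : FeatureMDP S A d) (P : Params) (Sg : Matrix (Fin d) (Fin d) ℝ)
    (x : S × A) : ℝ :=
  if KnownState M P Sg x.1 then √P.β * wnorm Sg⁻¹ (M.φ x) else 0

open Classical in
/-- `b_1(s, a) = 3 / (1 - γ) 1{(s, a) not known}`. -/
noncomputable def bonusInd (M : FeatureMDP S A d) (P : Params) (Sg : Matrix (Fin d) (Fin d) ℝ)
    (x : S × A) : ℝ :=
  if KnownPair M P Sg x then 0 else 3 / (1 - M.γ)

/-- The bonus `b = 2 b_φ + b_1`. -/
noncomputable def bonus (M : FeatureMDP S A d) (P : Params) (Sg : Matrix (Fin d) (Fin d) ℝ)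
    (x : S × A) : ℝ :=
  2 * bonusPhi M P Sg x + bonusInd M P Sg x

open Classical in
/-- The agent's critic `Q̂` with regression parameter `w`. -/
noncomputable def criticQ (M : FeatureMDP S A d) (P : Params) (Sg : Matrix (Fin d) (Fin d) ℝ)
    (w : EuclideanSpace ℝ (Fin d)) (x : S × A) : ℝ :=
  if KnownState M P Sg x.1 then inner ℝ (M.φ x) w + 1 / 2 * bonus M P Sg x
  else bonus M P Sg x

open Classical in
/-- The predictor `Q^⋆` with regression parameter `w`. -/
noncomputable def bestQ (M : FeatureMDP S A d) (P : Params) (Sg : Matrix (Fin d) (Fin d) ℝ)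
    (w : EuclideanSpace ℝ (Fin d)) (x : S × A) : ℝ :=
  if KnownState M P Sg x.1 then inner ℝ (M.φ x) w + 2 * bonusPhi M P Sg x
  else bonus M P Sg x

open Classical in
/-- The action probabilities of the inner policies `π_0, π_1, …`. On known states: uniform, then
`π_{k+1} ∝ π_k exp(η Q̂_k)`. On unknown states: uniform over the unknown actions. -/
noncomputable def innerProb (M : FeatureMDP S A d) (P : Params) (Sg : Matrix (Fin d) (Fin d) ℝ)
    (w : ℕ → EuclideanSpace ℝ (Fin d)) : ℕ → S → A → ℝ
  | 0, s, a =>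
    if KnownState M P Sg s then 1 / Fintype.card A
    else if KnownPair M P Sg (s, a) then 0
    else 1 / ∑ a', if KnownPair M P Sg (s, a') then 0 else 1
  | k + 1, s, a =>
    if KnownState M P Sg s then
      innerProb M P Sg w k s a * Real.exp (P.η * criticQ M P Sg (w k) (s, a)) /
        ∑ a', innerProb M P Sg w k s a' * Real.exp (P.η * criticQ M P Sg (w k) (s, a'))
    else innerProb M P Sg w k s a

/-! Measurability and normalization of the inner policies. -/

theorem measurable_wnorm (Q : Matrix (Fin d) (Fin d) ℝ) : Measurable (wnorm Q) := by
  have : Continuous (wnorm Q) := by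
    unfold wnorm
    refine Real.continuous_sqrt.comp ?_
    refine Continuous.dotProduct (PiLp.continuous_ofLp 2 _) ?_
    exact Continuous.matrix_mulVec continuous_const (PiLp.continuous_ofLp 2 _)
  exact this.measurable

variable (M : FeatureMDP S A d) (P : Params) (Sg : Matrix (Fin d) (Fin d) ℝ)

theorem measurableSet_knownPair (a : A) : MeasurableSet {s | KnownPair M P Sg (s, a)} := by
  unfold KnownPair
  have h : Measurable fun s => √P.β * wnorm Sg⁻¹ (M.φ (s, a)) :=
    ((measurable_wnorm _).comp (M.measurable_φ.comp measurable_prodMk_right)).const_mul _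
  exact measurableSet_lt h measurable_const

theorem measurableSet_knownState : MeasurableSet {s | KnownState M P Sg s} := by
  have : {s | KnownState M P Sg s} = ⋂ a, {s | KnownPair M P Sg (s, a)} := by
    ext s; simp [KnownState]
  rw [this]
  exact MeasurableSet.iInter fun a => measurableSet_knownPair M P Sg a

theorem measurable_criticQ (w : EuclideanSpace ℝ (Fin d)) (a : A) :
    Measurable fun s => criticQ M P Sg w (s, a) := by
  classical
  have hφ : Measurable fun s => M.φ (s, a) := M.measurable_φ.comp measurable_prodMk_right
  have hb : Measurable fun s => bonus M P Sg (s, a) := by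
    unfold bonus bonusPhi bonusInd
    refine Measurable.add (Measurable.const_mul ?_ _) ?_
    · exact Measurable.ite (measurableSet_knownState M P Sg)
        (((measurable_wnorm _).comp hφ).const_mul _) measurable_const
    · exact Measurable.ite (measurableSet_knownPair M P Sg a) measurable_const measurable_const
  unfold criticQ
  exact Measurable.ite (measurableSet_knownState M P Sg)
    ((hφ.inner measurable_const).add (hb.const_mul _)) hb

theorem measurable_innerProb (w : ℕ → EuclideanSpace ℝ (Fin d)) (k : ℕ) :
    ∀ a, Measurable fun s => innerProb M P Sg w k s a := by
  classical
  induction k with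
  | zero =>
    intro a
    simp only [innerProb]
    refine Measurable.ite (measurableSet_knownState M P Sg) measurable_const ?_
    refine Measurable.ite (measurableSet_knownPair M P Sg a) measurable_const ?_
    refine Measurable.const_div (Finset.measurable_sum _ fun a' _ => ?_) _
    exact Measurable.ite (measurableSet_knownPair M P Sg a') measurable_const measurable_const
  | succ k ih =>
    intro a
    simp only [innerProb]
    have h : ∀ a, Measurable fun s =>
        innerProb M P Sg w k s a * Real.exp (P.η * criticQ M P Sg (w k) (s, a)) := fun a =>
      (ih a).mul ((measurable_criticQ M P Sg (w k) a).const_mul _).exp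
    exact Measurable.ite (measurableSet_knownState M P Sg)
      ((h a).div (Finset.measurable_sum _ fun a' _ => h a')) (ih a)

theorem innerProb_nonneg (w : ℕ → EuclideanSpace ℝ (Fin d)) (k : ℕ) :
    ∀ s a, 0 ≤ innerProb M P Sg w k s a := by
  classical
  induction k with
  | zero =>
    intro s a
    have h : (0 : ℝ) ≤ ∑ a', if KnownPair M P Sg (s, a') then (0 : ℝ) else 1 :=
      Finset.sum_nonneg fun a' _ => by split_ifs <;> norm_num
    simp only [innerProb]
    split_ifs <;> positivity
  | succ k ih =>
    intro s a
    simp only [innerProb]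
    split_ifs
    · exact div_nonneg (mul_nonneg (ih s a) (Real.exp_pos _).le)
        (Finset.sum_nonneg fun a' _ => mul_nonneg (ih s a') (Real.exp_pos _).le)
    · exact ih s a

theorem innerProb_sum [Nonempty A] (w : ℕ → EuclideanSpace ℝ (Fin d)) (k : ℕ) :
    ∀ s, ∑ a, innerProb M P Sg w k s a = 1 := by
  classical
  induction k with
  | zero =>
    intro s
    simp only [innerProb]
    by_cases hs : KnownState M P Sg s
    · simp [hs]
    · simp only [hs, if_false]
      have hex : ∃ a, ¬ KnownPair M P Sg (s, a) := by
        by_contra hcon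
        exact hs fun a => by_contra fun ha => hcon ⟨a, ha⟩
      obtain ⟨a₀, ha₀⟩ := hex
      set c : ℝ := ∑ a', if KnownPair M P Sg (s, a') then (0 : ℝ) else 1 with hc
      have hpos : 0 < c := Finset.sum_pos' (fun a' _ => by split_ifs <;> norm_num)
        ⟨a₀, Finset.mem_univ _, by simp [ha₀]⟩
      have : ∀ a, (if KnownPair M P Sg (s, a) then (0 : ℝ) else 1 / c) =
          (if KnownPair M P Sg (s, a) then (0 : ℝ) else 1) / c := fun a => by
        split_ifs <;> simp
      simp only [this]
      rw [← Finset.sum_div, ← hc, div_self hpos.ne']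
  | succ k ih =>
    intro s
    simp only [innerProb]
    by_cases hs : KnownState M P Sg s
    · simp only [hs, if_true]
      rw [← Finset.sum_div]
      refine div_self (ne_of_gt ?_)
      have hex : ∃ a, 0 < innerProb M P Sg w k s a := by
        by_contra hcon
        have h0 : ∑ a, innerProb M P Sg w k s a ≤ 0 :=
          Finset.sum_nonpos fun a _ => not_lt.1 fun ha => hcon ⟨a, ha⟩
        linarith [ih s]
      obtain ⟨a₀, ha₀⟩ := hex
      exact Finset.sum_pos'
        (fun a _ => mul_nonneg (innerProb_nonneg M P Sg w k s a) (Real.exp_pos _).le)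
        ⟨a₀, Finset.mem_univ _, mul_pos ha₀ (Real.exp_pos _)⟩
    · simpa only [hs, if_false] using ih s

/-- The inner policy `π_k`. -/
noncomputable def innerPolicy [Nonempty A] (w : ℕ → EuclideanSpace ℝ (Fin d)) (k : ℕ) :
    Policy S A where
  prob := innerProb M P Sg w k
  measurable_prob := measurable_innerProb M P Sg w k
  nonneg := innerProb_nonneg M P Sg w k
  sum_eq_one := innerProb_sum M P Sg w k

/-! ### The critic's regression -/

/-- The importance weight of a rollout for behavioral policy `π₀` and target policy `π`; the
product starts at the second state-action. -/
noncomputable def isWeight (π₀ π : Policy S A) (z : Rollout S A) : ℝ :=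
  ∏ t ∈ Finset.Icc 1 z.1, π.prob (z.2 t).1 (z.2 t).2 / π₀.prob (z.2 t).1 (z.2 t).2

/-- The regression target of a rollout for the bonus function `b`. -/
noncomputable def target (b : S × A → ℝ) (π₀ π : Policy S A) (z : Rollout S A) : ℝ :=
  match P.form with
  | .offset => isWeight π₀ π z * (1 / (1 - M.γ) * (M.r (z.2 z.1) + b (z.2 z.1))) - b (z.2 0)
  | .censored =>
    isWeight π₀ π z * (1 / (1 - M.γ) * (M.r (z.2 z.1) + if z.1 = 0 then 0 else b (z.2 z.1)))

/-- The critic's empirical least squares loss on a dataset of `n` rollouts. -/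
noncomputable def empLoss {n : ℕ} (b : S × A → ℝ) (π₀ π : Policy S A) (D : Fin n → Rollout S A)
    (w : EuclideanSpace ℝ (Fin d)) : ℝ :=
  ∑ i, (inner ℝ (M.φ ((D i).2 0)) w - target M P b π₀ π (D i)) ^ 2

/-- The population loss `L(w, ρ, f) = ½ E_{(s,a) ∼ ρ} [(φ(s,a)ᵀ w - f(s,a))²]`. -/
noncomputable def popLoss (ρ : Measure (S × A)) (f : S × A → ℝ)
    (w : EuclideanSpace ℝ (Fin d)) : ℝ :=
  1 / 2 * ∫ x, (inner ℝ (M.φ x) w - f x) ^ 2 ∂ρ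

/-- `w` minimizes `L` over the closed ball of radius `R`. -/
def IsBallArgmin (L : EuclideanSpace ℝ (Fin d) → ℝ) (R : ℝ) (w : EuclideanSpace ℝ (Fin d)) :
    Prop :=
  ‖w‖ ≤ R ∧ ∀ v, ‖v‖ ≤ R → L w ≤ L v

end Solver

/-! ### The driver -/

/-- What the algorithm draws and computes in one execution: the state-actions whose features are
sampled in the outer iterations, the critic's regression parameters (outer iteration `n`, inner
iteration `k`), and the datasets of `n` rollouts (same indices). Entries at indices where
the algorithm draws or computes nothing are never used. -/
structure Transcript (S A : Type*) (d : ℕ) where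
  feat : ℕ → S × A
  what : ℕ → ℕ → EuclideanSpace ℝ (Fin d)
  data : ∀ n : ℕ, ℕ → Fin n → Rollout S A

section Driver

variable {S A : Type*} [MeasurableSpace S] [Fintype A] [MeasurableSpace A] {d : ℕ}
  (M : FeatureMDP S A d) (P : Params) (X : Transcript S A d)

/-- The empirical covariance `Σ̂^n = λ I + ∑_{m=1}^{n-1} φ^m (φ^m)ᵀ`. -/
noncomputable def covMat (n : ℕ) : Matrix (Fin d) (Fin d) ℝ :=
  P.lam • (1 : Matrix (Fin d) (Fin d) ℝ) +
    ∑ m ∈ Finset.Ico 1 n, Matrix.vecMulVec (M.φ (X.feat m)).ofLp (M.φ (X.feat m)).ofLp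

open Classical in
/-- The last outer iteration `≤ n` in which the bonus was updated and the solver was called:
iteration `1`, and every later one at which the determinant has more than doubled. -/
noncomputable def lastSwitch : ℕ → ℕ
  | 0 => 0
  | n + 1 =>
    if n = 0 ∨ 2 * (covMat M P X (lastSwitch n)).det < (covMat M P X (n + 1)).det then n + 1
    else lastSwitch n

/-- The inner policy `π^m_k` of the solver call in outer iteration `m`. -/
noncomputable def solverPolicy [Nonempty A] (m k : ℕ) : Policy S A :=
  innerPolicy M P (covMat M P X m) (X.what m) k

/-- The occupancy measure of the outer policy `π^n`: `π^0` is uniform and, for `n ≥ 1`, `π^n` is the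
uniform mixture of the `K` inner policies of the last solver call. -/
noncomputable def outerOcc [Nonempty A] (n : ℕ) : Measure (S × A) :=
  if n = 0 then occ M (Policy.uniform S A)
  else (P.K : ENNReal)⁻¹ • ∑ k ∈ Finset.range P.K,
    occ M (solverPolicy M P X (lastSwitch M P X n) k)

/-- The occupancy measure `ρ^n` of the policy cover `π^{0:n-1}`. -/
noncomputable def coverOcc [Nonempty A] (n : ℕ) : Measure (S × A) :=
  (n : ENNReal)⁻¹ • ∑ i ∈ Finset.range n, outerOcc M P X i

/-- `w` is a best regression parameter `w^{m,⋆}_k`: it minimizes `L(·, ρ^m, Q^m_k - b^m)` over the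
ball of radius `W`, where `Q^m_k = Q^{π^m_k}(·, ·; r + b^m)`. -/
def IsBestParam [Nonempty A] (m k : ℕ) (w : EuclideanSpace ℝ (Fin d)) : Prop :=
  IsBallArgmin
    (popLoss M (coverOcc M P X m) fun x =>
      qValue M (solverPolicy M P X m k) (fun y => M.r y + bonus M P (covMat M P X m) y) x -
        bonus M P (covMat M P X m) x) M.W w

/-- `w` is an admissible output of the critic's regression in inner iteration `k` of the solver
call in outer iteration `m`: it minimizes the empirical loss on the data most recently collected. -/
def IsCriticParam [Nonempty A] (m k : ℕ) (w : EuclideanSpace ℝ (Fin d)) : Prop :=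
  IsBallArgmin
    (empLoss M P (bonus M P (covMat M P X m)) (solverPolicy M P X m (lastCollect M P k))
      (solverPolicy M P X m k) (X.data m (lastCollect M P k))) M.W w

end Driver

/-! ### Random executions -/

section Run

/-- On the event `C`, the conditional law of `Y` given the `σ`-algebra `m` is `ν`. -/
def HasCondLawOn {Ω T : Type*} [MeasurableSpace Ω] [MeasurableSpace T] (μ : Measure Ω)
    (m : MeasurableSpace Ω) (C : Set Ω) (Y : Ω → T) (ν : Ω → Measure T) : Prop :=
  ∀ G : Set Ω, MeasurableSet[m] G → G ⊆ C → ∀ E : Set T, MeasurableSet E →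
    μ (G ∩ Y ⁻¹' E) = ∫⁻ ω in G, ν ω E ∂μ

variable {S A Ω : Type*} [MeasurableSpace S] [Fintype A] [Nonempty A] [MeasurableSpace A] {d : ℕ}

/-- The information in the features sampled before outer iteration `n` and in the data and the
regression parameters of the inner iterations `(m, j)` with `J m j`. -/
abbrev history (X : Ω → Transcript S A d) (n : ℕ) (J : ℕ → ℕ → Prop) : MeasurableSpace Ω :=
  (⨆ (m : ℕ) (_ : m < n), MeasurableSpace.comap (fun ω => (X ω).feat m) inferInstance) ⊔
  ⨆ (m : ℕ) (j : ℕ) (_ : J m j),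
    MeasurableSpace.comap (fun ω => (X ω).what m j) inferInstance ⊔
    MeasurableSpace.comap (fun ω => (X ω).data m j) inferInstance

variable [MeasurableSpace Ω]

/-- `X` is a random execution of the algorithm on the probability space `(Ω, μ)`.
* At the inner iterations `k` of a solver call in outer iteration `n` at which data are collected,
  `n` rollouts are drawn independently, given the past, with first state-action drawn from the
  policy cover and continued with the current inner policy.
* In every inner iteration of a solver call the critic solves its least squares problem (with an
  arbitrary choice among several solutions).
* At the end of outer iteration `n`, a state-action is drawn, given the past, from the occupancy
  measure of the current outer policy, and its feature updates the covariance. -/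
structure IsRun (M : FeatureMDP S A d) (P : Params) (μ : Measure Ω)
    (X : Ω → Transcript S A d) : Prop where
  measurable_feat : ∀ n, Measurable fun ω => (X ω).feat n
  measurable_what : ∀ n k, Measurable fun ω => (X ω).what n k
  measurable_data : ∀ n k, Measurable fun ω => (X ω).data n k
  data_law : ∀ n, 1 ≤ n → n ≤ P.N → ∀ k < P.K, lastCollect M P k = k →
    HasCondLawOn μ (history X n fun m j => m < n ∨ (m = n ∧ j < k))
      {ω | lastSwitch M P (X ω) n = n} (fun ω => (X ω).data n k)
      fun ω => Measure.pi fun _ : Fin n =>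
        rolloutLaw M (coverOcc M P (X ω) n) (solverPolicy M P (X ω) n k)
  critic : ∀ n, 1 ≤ n → n ≤ P.N → ∀ k < P.K, ∀ ω, lastSwitch M P (X ω) n = n →
    IsCriticParam M P (X ω) n k ((X ω).what n k)
  feat_law : ∀ n, 1 ≤ n → n ≤ P.N →
    HasCondLawOn μ (history X n fun m _ => m ≤ n) Set.univ (fun ω => (X ω).feat n)
      fun ω => outerOcc M P (X ω) n

end Run

end Copoe

/-!
On unknown states both predictors are equal to the bonus and `b_φ = 0`. On known states
`Q⋆ - Q̂ - b_φ` is the inner product of the feature with `w⋆ - ŵ`, so by the Cauchy-Schwarz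
inequality (`abs_inner_le_of_quadForm_le`) it is enough that `(w⋆ - ŵ)ᵀ Σ̂ (w⋆ - ŵ) ≤ β` for the
covariance `Σ̂` of the last solver call. This is `abs_inner_param_sub_le`, and it rests on two
concentration results, each of which fails with small probability.

The first one is about the covariance. In a fixed direction `v` of the unit ball, the exponential of
the sum over the past of `⟪φ, v⟫²` minus twice its conditional mean is a supermartingale
(`IsRun.lintegral_exp_momentExcess_le`). Markov's inequality and a net of the unit ball give a
bound in all directions (`sum_sq_inner_feat_le`): up to a multiple of the identity that `λ`
absorbs, `Σ̂` is at most a multiple of the second moment matrix of the policy cover. So a bound on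
the mean squared difference of the predictions of `w⋆` and `ŵ` under the policy cover is enough.

The second one is about least squares. Data are reused while the policy moves, hence the target
policy depends on the data. But the critics are affine in their parameters, so after `m` updates the
policy is an exponential tilt of the one that collected the data, and depends only on the average of
the `m` parameters, a point of a ball (`innerProb_splice_average`). This makes a union bound over
a net of triples (empirical minimizer, best parameter, tilt) possible. The length of the window of
reuse keeps the importance weights of rollouts of length at most `L / (1 - γ) + 1`, where
`L = log (8 N² K / δ)`, below `2` (`prod_tiltRatio_le`), and longer rollouts are unlikely
(`rolloutLaw_long`). For such bounded targets, Bernstein's inequality bounds the excess loss from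
below by its mean, minus half of the mean squared difference of the predictions and a logarithmic
term (`measure_deviationSet_le`); its mean is at least the mean squared difference by unbiasedness of the
targets (`integral_mul_truncTarget`) and first-order optimality of `w⋆` in the ball
(`IsBallArgmin.integral_nonneg`), without any assumption that the values are linear in the features.
As `ŵ` is an empirical minimizer, `integral_predGap_le` follows.

The data and the features are random with conditional laws that depend on the past. The bounds for a
fixed past carry over to the execution by `HasCondLawOn.measure_le`, which requires that policies,
trajectory laws and deviation events depend measurably on the past
(`MeasurablePolicy.measurable_trajLaw`, `measurableSet_badData`).
-/

namespace Copoe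

set_option linter.unusedSectionVars false

/-! ### Nets of Euclidean balls -/

section Net

open Metric Module

variable {E : Type*} [NormedAddCommGroup E] [NormedSpace ℝ E] [FiniteDimensional ℝ E]

/-- The balls of radius `ε / 2` around the points of an `ε`-separated set are disjoint; comparing
volumes bounds their number. -/
theorem card_le_of_separated_unitBall {ε : ℝ} (hε : 0 < ε) (s : Finset E)
    (hs : ∀ c ∈ s, ‖c‖ ≤ 1) (h : ∀ c ∈ s, ∀ c' ∈ s, c ≠ c' → ε ≤ ‖c - c'‖) :
    (s.card : ℝ) ≤ (1 + 2 / ε) ^ finrank ℝ E := by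
  borelize E
  let μ : Measure E := Measure.addHaar
  have hD : Set.Pairwise (s : Set E) (Function.onFun Disjoint fun c => ball (c : E) (ε / 2)) := by
    rintro c hc c' hc' hcc
    apply ball_disjoint_ball
    rw [dist_eq_norm]
    linarith [h c hc c' hc' hcc]
  have hsub : (⋃ c ∈ s, ball (c : E) (ε / 2)) ⊆ ball (0 : E) (1 + ε / 2) := by
    refine Set.iUnion₂_subset fun x hx => ball_subset_ball' ?_
    rw [dist_zero_right]
    linarith [hs x hx]
  have hr : (0 : ℝ) < ε / 2 := by positivity
  have hR : (0 : ℝ) < 1 + ε / 2 := by positivity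
  have I : (s.card : ENNReal) * ENNReal.ofReal ((ε / 2) ^ finrank ℝ E) * μ (ball 0 1) ≤
      ENNReal.ofReal ((1 + ε / 2) ^ finrank ℝ E) * μ (ball 0 1) := by
    calc
      _ = μ (⋃ c ∈ s, ball (c : E) (ε / 2)) := by
        rw [measure_biUnion_finset hD fun c _ => measurableSet_ball]
        simp only [μ.addHaar_ball_of_pos _ hr, Finset.sum_const, nsmul_eq_mul, mul_assoc]
      _ ≤ μ (ball (0 : E) (1 + ε / 2)) := measure_mono hsub
      _ = _ := by simp only [μ.addHaar_ball_of_pos _ hR]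
  have J : (s.card : ENNReal) * ENNReal.ofReal ((ε / 2) ^ finrank ℝ E) ≤
      ENNReal.ofReal ((1 + ε / 2) ^ finrank ℝ E) :=
    (ENNReal.mul_le_mul_iff_left (measure_ball_pos _ _ zero_lt_one).ne'
      measure_ball_lt_top.ne).1 I
  have K := ENNReal.toReal_le_of_le_ofReal (pow_nonneg hR.le _) J
  rw [ENNReal.toReal_mul, ENNReal.toReal_natCast, ENNReal.toReal_ofReal (by positivity)] at K
  have : (1 + 2 / ε) = (1 + ε / 2) / (ε / 2) := by field_simp; ring
  rw [this, div_pow, le_div_iff₀ (by positivity)]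
  exact K

/-- The unit ball has an `ε`-net, consisting of points of the ball, with at most
`(1 + 2 / ε) ^ dim E` elements: a maximal `ε`-separated set. -/
theorem exists_net_unitBall {ε : ℝ} (hε : 0 < ε) :
    ∃ s : Finset E, (∀ c ∈ s, ‖c‖ ≤ 1) ∧ (s.card : ℝ) ≤ (1 + 2 / ε) ^ finrank ℝ E ∧
      ∀ x : E, ‖x‖ ≤ 1 → ∃ c ∈ s, ‖x - c‖ ≤ ε := by
  classical
  let Q : Finset E → Prop := fun s => (∀ c ∈ s, ‖c‖ ≤ 1) ∧
    ∀ c ∈ s, ∀ c' ∈ s, c ≠ c' → ε ≤ ‖c - c'‖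
  obtain ⟨s, hs, hmax⟩ : ∃ s, Q s ∧ ∀ t, Q t → t.card ≤ s.card := by
    obtain ⟨s, hs, hn⟩ := Nat.findGreatest_spec (P := fun n => ∃ s, Q s ∧ s.card = n)
      (Nat.zero_le ⌊(1 + 2 / ε) ^ finrank ℝ E⌋₊) ⟨∅, by simp [Q], rfl⟩
    refine ⟨s, hs, fun t ht => ?_⟩
    rw [hn]
    exact Nat.le_findGreatest (P := fun n => ∃ s, Q s ∧ s.card = n)
      (Nat.le_floor (card_le_of_separated_unitBall hε t ht.1 ht.2)) ⟨t, ht, rfl⟩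
  refine ⟨s, hs.1, card_le_of_separated_unitBall hε s hs.1 hs.2, fun x hx => ?_⟩
  by_contra! hcon
  have hxs : x ∉ s := fun hxs => by simpa [hε.le.not_gt] using hcon x hxs
  have := hmax (insert x s) ⟨fun c hc => ?_, fun c hc c' hc' hcc => ?_⟩
  · rw [Finset.card_insert_of_notMem hxs] at this
    omega
  · rcases Finset.mem_insert.1 hc with rfl | hc
    exacts [hx, hs.1 c hc]
  · rcases Finset.mem_insert.1 hc with h1 | h1 <;> rcases Finset.mem_insert.1 hc' with h2 | h2
    · exact absurd (h1.trans h2.symm) hcc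
    · rw [h1]; exact (hcon c' h2).le
    · rw [h2, norm_sub_rev]; exact (hcon c h1).le
    · exact hs.2 c h1 c' h2 hcc

end Net

/-! ### Conditioning -/

section Conditioning

variable {Ω T : Type*} [MeasurableSpace T]

/-- Disintegration along a conditional law: an integral of a function of the past and of a variable
`Y` is an iterated integral. The function has to be measurable for the past in its first argument,
and so does the conditional law. -/
theorem HasCondLawOn.lintegral_eq {m mΩ : MeasurableSpace Ω} (hm : m ≤ mΩ)
    {μ : Measure[mΩ] Ω} [IsProbabilityMeasure μ] {C : Set Ω} (hC : MeasurableSet[m] C)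
    {Y : Ω → T} (hY : Measurable[mΩ] Y) {ν : Ω → Measure T} (hν : Measurable[m] ν)
    [hprob : ∀ ω, IsProbabilityMeasure (ν ω)]
    (h : @HasCondLawOn Ω T mΩ _ μ m C Y ν) {f : Ω → T → ENNReal}
    (hf : @Measurable _ _ (@Prod.instMeasurableSpace Ω T m _) _ (Function.uncurry f)) :
    ∫⁻ ω in C, f ω (Y ω) ∂μ = ∫⁻ ω in C, ∫⁻ y, f ω y ∂ν ω ∂μ := by
  -- two `σ`-algebras live on `Ω`: the kernel is one from `(Ω, m)`, while `μ` is a measure on `mΩ`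
  let κ : @Kernel Ω T m _ := @Kernel.mk Ω T m _ ν hν
  have hκ : @IsMarkovKernel Ω T m _ κ := @IsMarkovKernel.mk Ω T m _ κ hprob
  have hid : @Measurable Ω Ω mΩ m id := fun s hs => hm s hs
  let μ' : Measure[mΩ] Ω := μ.restrict C
  have hpair : @Measurable Ω (Ω × T) mΩ (@Prod.instMeasurableSpace Ω T m _)
      (fun ω => (ω, Y ω)) := Measurable.prodMk hid hY
  have key : @Measure.map Ω (Ω × T) mΩ (@Prod.instMeasurableSpace Ω T m _)
      (fun ω => (ω, Y ω)) μ' =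
      @Measure.compProd Ω T m _ (@Measure.map Ω Ω mΩ m id μ') κ := by
    refine @Measure.ext_prod Ω T m _ _ _ ?_ ?_
    · exact @IsFiniteMeasure.mk (Ω × T) (@Prod.instMeasurableSpace Ω T m _) _ (by
        rw [@Measure.map_apply _ _ mΩ (@Prod.instMeasurableSpace Ω T m _) _ _ hpair _
          (@MeasurableSet.univ _ (@Prod.instMeasurableSpace Ω T m _))]
        exact measure_lt_top _ _)
    · intro G E hG hE
      rw [@Measure.map_apply _ _ mΩ (@Prod.instMeasurableSpace Ω T m _) _ _ hpair _
        (@MeasurableSet.prod Ω T m _ _ _ hG hE),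
        Measure.compProd_apply_prod hG hE, Measure.restrict_apply
          (hpair (@MeasurableSet.prod Ω T m _ _ _ hG hE))]
      have h1 := h (G ∩ C) (@MeasurableSet.inter Ω m _ _ hG hC) Set.inter_subset_right E hE
      have hset : (fun ω => (ω, Y ω)) ⁻¹' G ×ˢ E ∩ C = G ∩ C ∩ Y ⁻¹' E := by
        ext ω; simp only [Set.mem_inter_iff, Set.mem_preimage, Set.mem_prod]; tauto
      rw [hset, h1]
      have hmeas : Measurable[m] fun ω => κ ω E := @Kernel.measurable_coe Ω T m _ κ E hE
      rw [@setLIntegral_map Ω Ω mΩ m μ' _ id G hG hmeas hid]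
      change _ = ∫⁻ x, κ x E ∂(μ.restrict C).restrict G
      rw [Measure.restrict_restrict (hm _ hG)]
      rfl
  have h2 := @lintegral_map Ω (Ω × T) mΩ (@Prod.instMeasurableSpace Ω T m _) μ' _ _ hf hpair
  rw [key, Measure.lintegral_compProd hf] at h2
  rw [@lintegral_map Ω Ω mΩ m μ' _ id (Measurable.lintegral_kernel_prod_right' hf) hid] at h2
  exact h2.symm

/-- A bound on the conditional probability of an event that involves the past and `Y`, valid for
every past, bounds its probability. -/
theorem HasCondLawOn.measure_le {m mΩ : MeasurableSpace Ω} (hm : m ≤ mΩ)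
    {μ : Measure[mΩ] Ω} [IsProbabilityMeasure μ] {C : Set Ω} (hC : MeasurableSet[m] C)
    {Y : Ω → T} (hY : Measurable[mΩ] Y) {ν : Ω → Measure T} (hν : Measurable[m] ν)
    [hprob : ∀ ω, IsProbabilityMeasure (ν ω)]
    (h : @HasCondLawOn Ω T mΩ _ μ m C Y ν) {E : Set (Ω × T)}
    (hE : @MeasurableSet _ (@Prod.instMeasurableSpace Ω T m _) E) {p : ENNReal}
    (hp : ∀ ω, ν ω {y | (ω, y) ∈ E} ≤ p) :
    μ (C ∩ {ω | (ω, Y ω) ∈ E}) ≤ p := by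
  have hid : @Measurable Ω Ω mΩ m id := fun s hs => hm s hs
  have hpair : @Measurable Ω (Ω × T) mΩ (@Prod.instMeasurableSpace Ω T m _)
      (fun ω => (ω, Y ω)) := Measurable.prodMk hid hY
  have key := h.lintegral_eq hm hC hY hν (f := fun ω y => E.indicator 1 (ω, y)) (by
    have : (Function.uncurry fun ω y => E.indicator (1 : Ω × T → ENNReal) (ω, y)) =
      E.indicator 1 := rfl
    rw [this]
    have hind : ∀ (α : Type _) [MeasurableSpace α] (s : Set α), MeasurableSet s →
        Measurable (s.indicator (1 : α → ENNReal)) := fun α _ s hs => measurable_one.indicator hs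
    exact @hind (Ω × T) (@Prod.instMeasurableSpace Ω T m _) E hE)
  have hE' : MeasurableSet[mΩ] {ω | (ω, Y ω) ∈ E} := hpair hE
  calc μ (C ∩ {ω | (ω, Y ω) ∈ E}) = ∫⁻ ω in C, {ω | (ω, Y ω) ∈ E}.indicator 1 ω ∂μ := by
        rw [lintegral_indicator_one hE', Measure.restrict_apply hE', Set.inter_comm]
    _ = ∫⁻ ω in C, ∫⁻ y, E.indicator 1 (ω, y) ∂ν ω ∂μ := key
    _ ≤ ∫⁻ _ in C, p ∂μ := by
        refine lintegral_mono fun ω => ?_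
        have : MeasurableSet {y | (ω, y) ∈ E} :=
          (@measurable_prodMk_left Ω T m _ ω) hE
        refine le_trans (le_of_eq ?_) (hp ω)
        rw [← lintegral_indicator_one this]
        rfl
    _ ≤ p := by
        rw [lintegral_const, Measure.restrict_apply_univ]
        exact mul_le_of_le_one_right' prob_le_one

end Conditioning

/-! ### Exponential tail bounds -/

section Tail

theorem exp_le_one_add_add_sq {x : ℝ} (hx : x ≤ 1) : Real.exp x ≤ 1 + x + x ^ 2 := by
  rcases le_or_gt (-1) x with h | h
  · have := Real.abs_exp_sub_one_sub_id_le (abs_le.2 ⟨h, hx⟩)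
    linarith [le_abs_self (Real.exp x - 1 - x)]
  · have : Real.exp x ≤ 1 := Real.exp_le_one_iff.2 (by linarith)
    nlinarith

variable {T : Type*} [MeasurableSpace T]

/-- A one-sided Bernstein inequality for sums of independent copies of `g`, whose
variance is controlled by `g` itself through `h`. -/
theorem measure_pi_bernstein_le {n : ℕ} (ν : Measure T) [IsProbabilityMeasure ν] {g h : T → ℝ}
    (hg : Measurable g) (hgb : ∀ y, g y ≤ 1) {b : ℝ} (hg' : ∀ y, |g y| ≤ b) (hh : Integrable h ν)
    (hgh : ∀ y, g y ^ 2 ≤ h y) {p : ℝ} (hp : 0 < p) :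
    Measure.pi (fun _ : Fin n => ν)
      {D | n * ∫ y, (g y + h y) ∂ν + Real.log (1 / p) ≤ ∑ i, g (D i)} ≤ ENNReal.ofReal p := by
  have hgi : Integrable g ν := Integrable.of_bound hg.aestronglyMeasurable b
    (Filter.Eventually.of_forall fun y => by simpa using hg' y)
  set c := ∫ y, (g y + h y) ∂ν
  have hexp : ∫ y, Real.exp (g y) ∂ν ≤ Real.exp c := by
    calc ∫ y, Real.exp (g y) ∂ν ≤ ∫ y, (1 + (g y + h y)) ∂ν := by
          refine integral_mono_of_nonneg (Filter.Eventually.of_forall fun y => (Real.exp_pos _).le)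
            ((integrable_const 1).add (hgi.add hh)) (Filter.Eventually.of_forall fun y => ?_)
          have := exp_le_one_add_add_sq (hgb y)
          have := hgh y
          dsimp only
          linarith
      _ = 1 + c := by rw [integral_add (integrable_const 1) (by exact hgi.add hh)]; simp [c]
      _ ≤ Real.exp c := by linarith [Real.add_one_le_exp c]
  have hexpi : Integrable (fun y => Real.exp (g y)) ν :=
    Integrable.of_bound hg.exp.aestronglyMeasurable (Real.exp b)
      (Filter.Eventually.of_forall fun y => by
        rw [Real.norm_eq_abs, abs_of_pos (Real.exp_pos _), Real.exp_le_exp]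
        exact (le_abs_self _).trans (hg' y))
  have hprod : ∫ D, ∏ i : Fin n, Real.exp (g (D i)) ∂Measure.pi (fun _ : Fin n => ν) ≤
      Real.exp (n * c) := by
    rw [integral_fintype_prod_eq_prod (fun _ : Fin n => fun y => Real.exp (g y))]
    simp only [Finset.prod_const, Finset.card_univ, Fintype.card_fin]
    rw [Real.exp_nat_mul]
    exact pow_le_pow_left₀ (integral_nonneg fun y => (Real.exp_pos _).le) hexp n
  have hmarkov := mul_meas_ge_le_integral_of_nonneg
    (μ := Measure.pi (fun _ : Fin n => ν))
    (f := fun D => ∏ i : Fin n, Real.exp (g (D i)))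
    (Filter.Eventually.of_forall fun D => Finset.prod_nonneg fun i _ => (Real.exp_pos _).le)
    (Integrable.fintype_prod fun _ => hexpi) (Real.exp (n * c + Real.log (1 / p)))
  have hset : {D : Fin n → T | n * c + Real.log (1 / p) ≤ ∑ i, g (D i)} =
      {D | Real.exp (n * c + Real.log (1 / p)) ≤ ∏ i : Fin n, Real.exp (g (D i))} := by
    ext D
    simp only [Set.mem_ofPred_eq, ← Real.exp_sum, Real.exp_le_exp]
  rw [hset]
  have h3 := hmarkov.trans hprod
  rw [Real.exp_add, Real.exp_log (by positivity), mul_assoc] at h3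
  have h4 : 1 / p * (Measure.pi (fun _ : Fin n => ν)).real
      {D | Real.exp (n * c + Real.log (1 / p)) ≤ ∏ i : Fin n, Real.exp (g (D i))} ≤ 1 := by
    have := Real.exp_pos (n * c)
    rw [Real.exp_add, Real.exp_log (by positivity)]
    by_contra! hcon
    nlinarith
  rw [div_mul_eq_mul_div, one_mul, div_le_one hp] at h4
  rw [← ofReal_measureReal (measure_ne_top _ _)]
  exact ENNReal.ofReal_le_ofReal h4

/-- The law of a fixed number of independent draws depends measurably on the law of one draw. -/
theorem measurable_pi_const {Z : Type*} [MeasurableSpace Z] {n : ℕ} {κ : Z → Measure T}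
    (hκ : Measurable κ) [∀ z, IsProbabilityMeasure (κ z)] :
    Measurable fun z => Measure.pi fun _ : Fin n => κ z := by
  refine Measurable.measure_of_isPiSystem_of_isProbabilityMeasure
    generateFrom_pi.symm isPiSystem_pi ?_
  rintro _ ⟨s, hs, rfl⟩
  simp only [Measure.pi_pi]
  exact Finset.measurable_prod _ fun i _ =>
    (Measure.measurable_coe (hs i (Set.mem_univ i))).comp hκ

end Tail

/-! ### Laws of trajectories -/

section Traj

variable {S A : Type*} [MeasurableSpace S] [Fintype A] [MeasurableSpace A] {d : ℕ}
  (M : FeatureMDP S A d)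

instance (π : Policy S A) (μ : Measure (S × A)) [IsProbabilityMeasure μ] :
    IsProbabilityMeasure (trajLaw M π μ) := by
  unfold trajLaw; infer_instance

instance : IsProbabilityMeasure (horizonLaw M) := by
  unfold horizonLaw; infer_instance

instance (π : Policy S A) : IsProbabilityMeasure (occ M π) :=
  Measure.isProbabilityMeasure_map (measurable_from_prod_countable_right
    fun n => measurable_pi_apply n).aemeasurable

instance (π : Policy S A) (ρ : Measure (S × A)) [IsProbabilityMeasure ρ] :
    IsProbabilityMeasure (rolloutLaw M ρ π) := by
  unfold rolloutLaw; infer_instance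

theorem horizonLaw_real_singleton (t : ℕ) :
    (horizonLaw M).real {t} = M.γ ^ t * (1 - M.γ) := by
  have h : (⟨1 - M.γ, by linarith [M.γ_lt_one], by linarith [M.γ_nonneg]⟩ : unitInterval) ≠ 0 := by
    intro h0
    have := congrArg Subtype.val h0
    simp only [Set.Icc.coe_zero] at this
    linarith [M.γ_lt_one]
  rw [horizonLaw, geometricMeasure_real_singleton h]
  simp

/-- The trajectory up to time `t`, continued in a constant way. -/
def extendConst {X : Type*} (t : ℕ) (p : (i : Finset.Iic t) → X) (i : ℕ) : X :=
  if h : i ≤ t then p ⟨i, Finset.mem_Iic.2 h⟩ else p ⟨t, Finset.mem_Iic.2 le_rfl⟩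

theorem measurable_extendConst {X : Type*} [MeasurableSpace X] (t : ℕ) :
    Measurable (extendConst (X := X) t) := by
  refine measurable_pi_lambda _ fun i => ?_
  unfold extendConst
  split_ifs <;> exact measurable_pi_apply _

theorem extendConst_frestrictLe {X : Type*} (t : ℕ) (x : ℕ → X) {i : ℕ} (hi : i ≤ t) :
    extendConst t (Preorder.frestrictLe (π := fun _ => X) t x) i = x i := by
  simp [extendConst, hi]

/-- The kernel of the next state-action given the trajectory up to time `t`. -/
noncomputable def nextKernel (π : Policy S A) (t : ℕ) :
    Kernel ((i : Finset.Iic t) → S × A) (S × A) :=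
  (stepKernel M π).comap (fun x => x ⟨t, Finset.mem_Iic.2 le_rfl⟩) (measurable_pi_apply _)

instance (π : Policy S A) (t : ℕ) : IsMarkovKernel (nextKernel M π t) := by
  unfold nextKernel; infer_instance

theorem trajLaw_map_succ (π : Policy S A) (μ : Measure (S × A)) [IsProbabilityMeasure μ] (t : ℕ) :
    (trajLaw M π μ).map (fun x => (Preorder.frestrictLe (π := fun _ => S × A) t x, x (t + 1))) =
      (trajLaw M π μ).map (Preorder.frestrictLe t) ⊗ₘ nextKernel M π t :=
  (Kernel.map_frestrictLe_trajMeasure_compProd_eq_map_trajMeasure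
    (X := fun _ => S × A) (μ₀ := μ) (κ := fun n => nextKernel M π n) (a := t)).symm

theorem trajLaw_map_frestrictLe_zero (π : Policy S A) (μ : Measure (S × A))
    [IsProbabilityMeasure μ] :
    (trajLaw M π μ).map (Preorder.frestrictLe (π := fun _ => S × A) 0) =
      μ.map (MeasurableEquiv.piUnique (fun _ : Finset.Iic 0 => S × A)).symm := by
  have : IsProbabilityMeasure (μ.map
      (MeasurableEquiv.piUnique (fun _ : Finset.Iic 0 => S × A)).symm) :=
    Measure.isProbabilityMeasure_map (MeasurableEquiv.measurable _).aemeasurable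
  unfold trajLaw Kernel.trajMeasure
  rw [Measure.map_comp _ _ (by fun_prop), Kernel.traj_map_frestrictLe,
    Kernel.partialTraj_self, Measure.id_comp]

theorem trajLaw_map_zero (π : Policy S A) (μ : Measure (S × A)) [IsProbabilityMeasure μ] :
    (trajLaw M π μ).map (fun x => x 0) = μ := by
  have h : (fun x : ℕ → S × A => x 0) =
      (MeasurableEquiv.piUnique (fun _ : Finset.Iic 0 => S × A)) ∘
        Preorder.frestrictLe (π := fun _ => S × A) 0 := by
    ext x <;> rfl
  rw [h, ← Measure.map_map (MeasurableEquiv.measurable _) (by fun_prop),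
    trajLaw_map_frestrictLe_zero, MeasurableEquiv.map_map_symm]

/-- The mean of `f` after one step of `π`: the Bellman operator without discount and reward. -/
noncomputable def stepOp (π : Policy S A) (f : S × A → ℝ) (x : S × A) : ℝ :=
  ∫ y, f y ∂stepKernel M π x

theorem measurable_stepOp (π : Policy S A) {f : S × A → ℝ} (hf : Measurable f) :
    Measurable (stepOp M π f) :=
  (hf.stronglyMeasurable.integral_kernel (κ := stepKernel M π)).measurable

theorem abs_stepOp_le (π : Policy S A) {f : S × A → ℝ} {b : ℝ} (hb : ∀ x, |f x| ≤ b) (x : S × A) :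
    |stepOp M π f x| ≤ b := by
  have := norm_integral_le_of_norm_le_const (μ := stepKernel M π x) (f := f) (C := b)
    (Filter.Eventually.of_forall fun y => hb y)
  simpa [stepOp] using this

theorem iterate_stepOp (π : Policy S A) {f : S × A → ℝ} (hf : Measurable f) {b : ℝ}
    (hb : ∀ x, |f x| ≤ b) (t : ℕ) :
    Measurable ((stepOp M π)^[t] f) ∧ ∀ x, |(stepOp M π)^[t] f x| ≤ b := by
  induction t with
  | zero => exact ⟨hf, hb⟩
  | succ t ih =>
    rw [Function.iterate_succ_apply']
    exact ⟨measurable_stepOp M π ih.1, abs_stepOp_le M π ih.2⟩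

theorem integrable_of_abs_le {X : Type*} [MeasurableSpace X] {μ : Measure X} [IsFiniteMeasure μ]
    {f : X → ℝ} (hf : Measurable f) {b : ℝ} (hb : ∀ x, |f x| ≤ b) : Integrable f μ :=
  Integrable.of_bound hf.aestronglyMeasurable b (Filter.Eventually.of_forall hb)

theorem integral_trajLaw_zero (π : Policy S A) (μ : Measure (S × A)) [IsProbabilityMeasure μ]
    {f : S × A → ℝ} (hf : Measurable f) : ∫ x, f (x 0) ∂trajLaw M π μ = ∫ x, f x ∂μ := by
  conv_rhs => rw [← trajLaw_map_zero M π μ]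
  rw [integral_map (measurable_pi_apply 0).aemeasurable hf.aestronglyMeasurable]

/-- The Markov property at time `t`. -/
theorem integral_trajLaw_succ (π : Policy S A) (μ : Measure (S × A)) [IsProbabilityMeasure μ]
    {t : ℕ} {G : (ℕ → S × A) → ℝ} (hG : Measurable G) {b : ℝ} (hGb : ∀ x, |G x| ≤ b)
    (hGt : DependsOn G (Set.Iic t)) {f : S × A → ℝ} (hf : Measurable f) {c : ℝ}
    (hfc : ∀ x, |f x| ≤ c) :
    ∫ x, G x * f (x (t + 1)) ∂trajLaw M π μ = ∫ x, G x * stepOp M π f (x t) ∂trajLaw M π μ := by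
  set τ := trajLaw M π μ
  have hext : ∀ x, G (extendConst t (Preorder.frestrictLe (π := fun _ => S × A) t x)) = G x :=
    fun x => hGt fun i hi => extendConst_frestrictLe t x hi
  have hG' : Measurable fun p => G (extendConst t p) := hG.comp (measurable_extendConst t)
  have hm : Measurable fun q : ((i : Finset.Iic t) → S × A) × (S × A) =>
      G (extendConst t q.1) * f q.2 := (hG'.comp measurable_fst).mul (hf.comp measurable_snd)
  have h1 : ∫ x, G x * f (x (t + 1)) ∂τ =
      ∫ q, G (extendConst t q.1) * f q.2 ∂(τ.map (fun x =>
        (Preorder.frestrictLe (π := fun _ => S × A) t x, x (t + 1)))) := by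
    rw [integral_map (by fun_prop) hm.aestronglyMeasurable]
    simp only [hext]
  have : IsProbabilityMeasure (τ.map (Preorder.frestrictLe (π := fun _ => S × A) t)) :=
    Measure.isProbabilityMeasure_map (by fun_prop)
  have h2 : Integrable (fun q : ((i : Finset.Iic t) → S × A) × (S × A) =>
      G (extendConst t q.1) * f q.2)
      (τ.map (Preorder.frestrictLe (π := fun _ => S × A) t) ⊗ₘ nextKernel M π t) :=
    integrable_of_abs_le hm (b := b * c) fun q => by
      rw [abs_mul]
      exact mul_le_mul (hGb _) (hfc _) (abs_nonneg _)
        ((abs_nonneg _).trans (hGb (extendConst t q.1)))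
  rw [h1, trajLaw_map_succ, Measure.integral_compProd h2, integral_map (by fun_prop)]
  · refine integral_congr_ae (Filter.Eventually.of_forall fun x => ?_)
    simp only [integral_const_mul, hext]
    rfl
  · exact (hm.stronglyMeasurable.integral_kernel_prod_right'
      (κ := nextKernel M π t)).aestronglyMeasurable

/-- Change of measure along a trajectory: if the weights `ρ` turn one step of `π₀` into one step of
`π`, then the product of the weights turns trajectories of `π₀` into trajectories of `π`. -/
theorem integral_trajLaw_weighted (π₀ π : Policy S A) {ρ : S × A → ℝ} (hρ : Measurable ρ) {R : ℝ}
    (hρR : ∀ x, |ρ x| ≤ R)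
    (hstep : ∀ f : S × A → ℝ, Measurable f → ∀ c, (∀ x, |f x| ≤ c) →
      stepOp M π₀ (fun x => ρ x * f x) = stepOp M π f)
    (μ : Measure (S × A)) [IsProbabilityMeasure μ] {g : S × A → ℝ} (hg : Measurable g) {b : ℝ}
    (hgb : ∀ x, |g x| ≤ b) (t : ℕ) {f : S × A → ℝ} (hf : Measurable f) {c : ℝ}
    (hfc : ∀ x, |f x| ≤ c) :
    ∫ x, g (x 0) * (∏ i ∈ Finset.Icc 1 t, ρ (x i)) * f (x t) ∂trajLaw M π₀ μ =
      ∫ x, g x * (stepOp M π)^[t] f x ∂μ := by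
  induction t generalizing f with
  | zero => simpa using integral_trajLaw_zero M π₀ μ (hg.mul hf)
  | succ t ih =>
    have hm : Measurable fun x : ℕ → S × A => g (x 0) * ∏ i ∈ Finset.Icc 1 t, ρ (x i) :=
      (hg.comp (measurable_pi_apply 0)).mul
        (Finset.measurable_prod _ fun i _ => hρ.comp (measurable_pi_apply i))
    have h1 := integral_trajLaw_succ M π₀ μ (t := t) hm (b := b * ∏ i ∈ Finset.Icc 1 t, R)
      (fun x => by
        rw [abs_mul, Finset.abs_prod]
        exact mul_le_mul (hgb _) (Finset.prod_le_prod (fun _ _ => abs_nonneg _) fun i _ => hρR _)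
          (Finset.prod_nonneg fun _ _ => abs_nonneg _) ((abs_nonneg _).trans (hgb (x 0))))
      (fun x y hxy => by
        dsimp only
        rw [hxy 0 (Set.mem_Iic.2 (Nat.zero_le _))]
        congr 1
        exact Finset.prod_congr rfl fun i hi => by
          rw [hxy i (Set.mem_Iic.2 (Finset.mem_Icc.1 hi).2)])
      (f := fun x => ρ x * f x) (hρ.mul hf) (c := R * c) (fun x => by
        rw [abs_mul]
        exact mul_le_mul (hρR _) (hfc _) (abs_nonneg _) ((abs_nonneg _).trans (hρR x)))
    rw [hstep f hf c hfc] at h1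
    rw [Function.iterate_succ_apply, ← ih (measurable_stepOp M π hf) (abs_stepOp_le M π hfc), ← h1]
    refine integral_congr_ae (Filter.Eventually.of_forall fun x => ?_)
    dsimp only
    rw [Finset.prod_Icc_succ_top (by omega)]
    ring

theorem qValue_eq_tsum (π : Policy S A) {f : S × A → ℝ} (hf : Measurable f) {c : ℝ}
    (hfc : ∀ x, |f x| ≤ c) (x : S × A) :
    qValue M π f x = ∑' t : ℕ, M.γ ^ t * (stepOp M π)^[t] f x := by
  unfold qValue
  congr 1
  ext t
  have h := integral_trajLaw_weighted M π π (ρ := fun _ => 1) measurable_const (R := 1) (by simp)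
    (by simp) (Measure.dirac x) (g := fun _ => 1) measurable_const (b := 1) (by simp) t hf hfc
  simp only [one_mul, Finset.prod_const_one] at h
  rw [h, integral_dirac' _ _ (iterate_stepOp M π hf hfc t).1.stronglyMeasurable]

/-- The action value of the reward `f`, collected during the first `H + 1` steps only. -/
noncomputable def truncQ (π : Policy S A) (f : S × A → ℝ) (H : ℕ) (x : S × A) : ℝ :=
  ∑ t ∈ Finset.range (H + 1), M.γ ^ t * (stepOp M π)^[t] f x

theorem summable_discounted (π : Policy S A) {f : S × A → ℝ} (hf : Measurable f) {c : ℝ}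
    (hfc : ∀ x, |f x| ≤ c) (x : S × A) :
    Summable fun t : ℕ => M.γ ^ t * (stepOp M π)^[t] f x :=
  Summable.of_norm_bounded ((summable_geometric_of_lt_one M.γ_nonneg M.γ_lt_one).mul_right c)
    fun t => by
      rw [norm_mul, norm_pow, Real.norm_of_nonneg M.γ_nonneg]
      exact mul_le_mul_of_nonneg_left ((iterate_stepOp M π hf hfc t).2 x)
        (pow_nonneg M.γ_nonneg t)

theorem abs_qValue_sub_truncQ_le (π : Policy S A) {f : S × A → ℝ} (hf : Measurable f) {c : ℝ}
    (hfc : ∀ x, |f x| ≤ c) (H : ℕ) (x : S × A) :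
    |qValue M π f x - truncQ M π f H x| ≤ M.γ ^ (H + 1) * (c / (1 - M.γ)) := by
  have hs := summable_discounted M π hf hfc x
  rw [qValue_eq_tsum M π hf hfc, truncQ, ← hs.sum_add_tsum_nat_add (H + 1), add_sub_cancel_left]
  have hgeo := (hasSum_geometric_of_lt_one M.γ_nonneg M.γ_lt_one).mul_left (M.γ ^ (H + 1))
    |>.mul_right c
  have := tsum_of_norm_bounded (f := fun t => M.γ ^ (t + (H + 1)) *
    (stepOp M π)^[t + (H + 1)] f x) hgeo fun t => by
      rw [norm_mul, norm_pow, Real.norm_of_nonneg M.γ_nonneg, pow_add, mul_comm (M.γ ^ t)]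
      exact mul_le_mul_of_nonneg_left ((iterate_stepOp M π hf hfc _).2 x)
        (mul_nonneg (pow_nonneg M.γ_nonneg _) (pow_nonneg M.γ_nonneg _))
  calc _ ≤ M.γ ^ (H + 1) * (1 - M.γ)⁻¹ * c := this
    _ = _ := by ring

theorem measurable_qValue (π : Policy S A) {f : S × A → ℝ} (hf : Measurable f) {c : ℝ}
    (hfc : ∀ x, |f x| ≤ c) : Measurable (qValue M π f) := by
  refine measurable_of_tendsto_metrizable (f := fun H => truncQ M π f H) (fun H => ?_) ?_
  · exact Finset.measurable_sum _ fun t _ => ((iterate_stepOp M π hf hfc t).1).const_mul _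
  · rw [tendsto_pi_nhds]
    intro x
    rw [qValue_eq_tsum M π hf hfc]
    exact ((summable_discounted M π hf hfc x).hasSum.tendsto_sum_nat).comp
      (Filter.tendsto_add_atTop_nat 1)

theorem abs_qValue_le (π : Policy S A) {f : S × A → ℝ} (hf : Measurable f) {c : ℝ}
    (hfc : ∀ x, |f x| ≤ c) (x : S × A) : |qValue M π f x| ≤ c / (1 - M.γ) := by
  rw [qValue_eq_tsum M π hf hfc]
  have hgeo := (hasSum_geometric_of_lt_one M.γ_nonneg M.γ_lt_one).mul_right c
  have := tsum_of_norm_bounded hgeo (f := fun t => M.γ ^ t * (stepOp M π)^[t] f x) fun t => by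
      rw [norm_mul, norm_pow, Real.norm_of_nonneg M.γ_nonneg]
      exact mul_le_mul_of_nonneg_left ((iterate_stepOp M π hf hfc _).2 x)
        (pow_nonneg M.γ_nonneg _)
  calc _ ≤ (1 - M.γ)⁻¹ * c := this
    _ = _ := by ring

/-- The integral over rollouts of a function that vanishes on rollouts of more than `H + 1`
state-actions. -/
theorem integral_rolloutLaw (ρ : Measure (S × A)) [IsProbabilityMeasure ρ] (π : Policy S A)
    {F : Rollout S A → ℝ} (hF : Measurable F) {b : ℝ} (hFb : ∀ z, |F z| ≤ b) {H : ℕ}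
    (hH : ∀ z : Rollout S A, H < z.1 → F z = 0) :
    ∫ z, F z ∂rolloutLaw M ρ π = ∑ t ∈ Finset.range (H + 1),
      M.γ ^ t * (1 - M.γ) * ∫ x, F (t, x) ∂trajLaw M π ρ := by
  have hi : Integrable F ((horizonLaw M).prod (trajLaw M π ρ)) := integrable_of_abs_le hF hFb
  rw [rolloutLaw, integral_prod _ hi, integral_countable hi.integral_prod_left,
    tsum_eq_sum (s := Finset.range (H + 1)) fun t ht => ?_]
  · simp only [horizonLaw_real_singleton, smul_eq_mul]
  · have : ∀ x, F (t, x) = 0 := fun x => hH (t, x) (by simpa using ht)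
    simp [this]

/-- A rollout has more than `H + 1` state-actions with probability `γ ^ (H + 1)`. -/
theorem rolloutLaw_long (ρ : Measure (S × A)) [IsProbabilityMeasure ρ] (π : Policy S A) (H : ℕ) :
    rolloutLaw M ρ π {z | H < z.1} = ENNReal.ofReal (M.γ ^ (H + 1)) := by
  have hset : {z : Rollout S A | H < z.1} = Set.Ioi H ×ˢ Set.univ := by ext z; simp
  rw [hset, rolloutLaw, Measure.prod_prod, measure_univ, mul_one]
  have h1 : (horizonLaw M).real (Finset.range (H + 1) : Set ℕ) = 1 - M.γ ^ (H + 1) := by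
    rw [← sum_measureReal_singleton]
    simp only [horizonLaw_real_singleton]
    rw [← Finset.sum_mul, geom_sum_mul_neg]
  have h2 : Set.Ioi H = (Finset.range (H + 1) : Set ℕ)ᶜ := by ext; simp
  rw [h2, ← ofReal_measureReal (measure_ne_top _ _), measureReal_compl (Finset.measurableSet _), h1]
  simp

/-! ### Measurable dependence of trajectory laws on the policy -/

section Param

variable {Z : Type*} [MeasurableSpace Z] [DiscreteMeasurableSpace A]

/-- The policies `π z` depend measurably on the parameter `z`. -/
def MeasurablePolicy (π : Z → Policy S A) : Prop :=
  ∀ a, Measurable fun q : Z × S => (π q.1).prob q.2 a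

variable {M}

theorem MeasurablePolicy.prob {π : Z → Policy S A} (hπ : MeasurablePolicy π) :
    Measurable fun q : Z × (S × A) => (π q.1).prob q.2.1 q.2.2 := by
  have : Measurable fun q : (Z × S) × A => (π q.1.1).prob q.1.2 q.2 :=
    measurable_from_prod_countable_left fun a => hπ a
  exact this.comp (f := fun q : Z × (S × A) => ((q.1, q.2.1), q.2.2)) (by fun_prop)

theorem Policy.kernel_apply (π : Policy S A) (s : S) {E : Set A} :
    π.kernel s E = ∑ a, ENNReal.ofReal (π.prob s a) * E.indicator 1 a := by
  change (∑ a, ENNReal.ofReal (π.prob s a) • Measure.dirac a : Measure A) E = _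
  simp [Measure.dirac_apply' _ (MeasurableSet.of_discrete (s := E))]

variable (M)

theorem MeasurablePolicy.measurable_kernel {π : Z → Policy S A} (hπ : MeasurablePolicy π) :
    Measurable fun q : Z × S => (π q.1).kernel q.2 := by
  refine Measure.measurable_of_measurable_coe _ fun E _ => ?_
  simp only [Policy.kernel_apply]
  exact Finset.measurable_sum _ fun a _ => (hπ a).ennreal_ofReal.mul_const _

theorem MeasurablePolicy.measurable_stepKernel {π : Z → Policy S A} (hπ : MeasurablePolicy π) :
    Measurable fun q : Z × (S × A) => stepKernel M (π q.1) q.2 := by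
  let κ₁ : Kernel (Z × (S × A)) S := M.p.comap Prod.snd measurable_snd
  let κ₂ : Kernel ((Z × (S × A)) × S) A := ⟨fun q => (π q.1.1).kernel q.2,
    hπ.measurable_kernel.comp (f := fun q : (Z × (S × A)) × S => (q.1.1, q.2)) (by fun_prop)⟩
  have : IsMarkovKernel κ₂ := ⟨fun q => Policy.isMarkov_kernel (π q.1.1) |>.1 q.2⟩
  have h : (fun q : Z × (S × A) => stepKernel M (π q.1) q.2) = fun q => (κ₁ ⊗ₖ κ₂) q := by
    ext q E hE
    rw [Kernel.compProd_apply hE, stepKernel]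
    exact Kernel.compProd_apply hE _ _ _
  rw [h]
  exact (κ₁ ⊗ₖ κ₂).measurable

/-- If a distribution and a Markov kernel depend measurably on a parameter, so does their
composition-product. -/
theorem measurable_compProd_param {X Y : Type*} [MeasurableSpace X] [MeasurableSpace Y]
    {μ : Z → Measure X} (hμ : Measurable μ) [∀ z, IsProbabilityMeasure (μ z)]
    {κ : Z → Kernel X Y} [∀ z, IsMarkovKernel (κ z)]
    (hκ : Measurable fun q : Z × X => κ q.1 q.2) : Measurable fun z => μ z ⊗ₘ κ z := by
  let κ₁ : Kernel Z X := ⟨μ, hμ⟩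
  let κ₂ : Kernel (Z × X) Y := ⟨fun q => κ q.1 q.2, hκ⟩
  have : IsMarkovKernel κ₁ := ⟨fun z => inferInstanceAs (IsProbabilityMeasure (μ z))⟩
  have : IsMarkovKernel κ₂ := ⟨fun q => inferInstanceAs (IsProbabilityMeasure (κ q.1 q.2))⟩
  have h : (fun z => μ z ⊗ₘ κ z) = fun z => (κ₁ ⊗ₖ κ₂) z := by
    ext z E hE
    rw [Kernel.compProd_apply hE, Measure.compProd_apply hE]
    rfl
  rw [h]
  exact (κ₁ ⊗ₖ κ₂).measurable

theorem MeasurablePolicy.measurable_trajLaw {π : Z → Policy S A} (hπ : MeasurablePolicy π)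
    {μ : Z → Measure (S × A)} (hμ : Measurable μ) [∀ z, IsProbabilityMeasure (μ z)] :
    Measurable fun z => trajLaw M (π z) (μ z) := by
  -- the laws of the prefixes depend measurably on `z` by recursion, and they determine the law of
  -- the trajectory on the `π`-system of cylinder sets
  have hprefix : ∀ t, Measurable fun z =>
      (trajLaw M (π z) (μ z)).map (Preorder.frestrictLe (π := fun _ => S × A) t) := by
    intro t
    induction t with
    | zero =>
      simp only [trajLaw_map_frestrictLe_zero]
      exact (Measure.measurable_map _ (MeasurableEquiv.measurable _)).comp hμ
    | succ t ih =>
      have : ∀ z, IsProbabilityMeasure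
          ((trajLaw M (π z) (μ z)).map (Preorder.frestrictLe (π := fun _ => S × A) t)) :=
        fun z => Measure.isProbabilityMeasure_map (by fun_prop)
      have hκ : Measurable fun q : Z × ((i : Finset.Iic t) → S × A) =>
          nextKernel M (π q.1) t q.2 :=
        (hπ.measurable_stepKernel M).comp
          (f := fun q : Z × ((i : Finset.Iic t) → S × A) =>
            (q.1, q.2 ⟨t, Finset.mem_Iic.2 le_rfl⟩)) (by fun_prop)
      have h1 := measurable_compProd_param ih (κ := fun z => nextKernel M (π z) t) hκ
      simp only [← trajLaw_map_succ] at h1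
      let e : ((i : Finset.Iic t) → S × A) × (S × A) → ((i : Finset.Iic (t + 1)) → S × A) :=
        fun q i => if (i : ℕ) ≤ t then extendConst t q.1 i else q.2
      have he : Measurable e := by
        refine measurable_pi_lambda _ fun i => ?_
        by_cases hi : (i : ℕ) ≤ t
        · simp only [e, hi, if_true]
          exact (measurable_pi_apply (i : ℕ)).comp
            (f := fun q : ((i : Finset.Iic t) → S × A) × (S × A) => extendConst t q.1)
            ((measurable_extendConst t).comp measurable_fst)
        · simp only [e, hi, if_false]
          exact measurable_snd
      have h2 := (Measure.measurable_map e he).comp h1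
      convert h2 using 1
      ext z : 1
      rw [Function.comp_apply, Measure.map_map he (by fun_prop)]
      congr 1
      ext x i : 2
      rcases i with ⟨i, hi⟩
      by_cases hit : i ≤ t
      · simp only [Function.comp_apply, e, hit, if_true, extendConst_frestrictLe,
          Preorder.frestrictLe_apply]
      · have : i = t + 1 := by
          have := Finset.mem_Iic.1 hi
          omega
        subst this
        simp [e]
  refine Measurable.measure_of_isPiSystem_of_isProbabilityMeasure
    (generateFrom_measurableCylinders (α := fun _ : ℕ => S × A)).symm
    isPiSystem_measurableCylinders ?_
  intro E hE
  obtain ⟨I, s, hs, rfl⟩ := (mem_measurableCylinders _).1 hE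
  obtain ⟨t, ht⟩ : ∃ t, I ⊆ Finset.Iic t :=
    ⟨I.sup id, fun i hi => Finset.mem_Iic.2 (Finset.le_sup (f := id) hi)⟩
  have hcyl : cylinder I s = Preorder.frestrictLe (π := fun _ => S × A) t ⁻¹'
      (Finset.restrict₂ (π := fun _ => S × A) ht ⁻¹' s) := rfl
  have hm : MeasurableSet (Finset.restrict₂ (π := fun _ => S × A) ht ⁻¹' s) :=
    (Finset.measurable_restrict₂ ht) hs
  convert (Measure.measurable_coe hm).comp (hprefix t) using 1
  ext z : 1
  rw [Function.comp_apply, Measure.map_apply (by fun_prop) hm, hcyl]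

theorem measurable_prod_left_param {X Y : Type*} [MeasurableSpace X] [MeasurableSpace Y]
    (ν : Measure X) [IsProbabilityMeasure ν] {τ : Z → Measure Y} (hτ : Measurable τ)
    [∀ z, IsProbabilityMeasure (τ z)] : Measurable fun z => ν.prod (τ z) := by
  let κ : Kernel Z Y := ⟨τ, hτ⟩
  have : IsMarkovKernel κ := ⟨fun z => inferInstanceAs (IsProbabilityMeasure (τ z))⟩
  have h : (fun z => ν.prod (τ z)) = fun z => (Kernel.const Z ν ×ₖ κ) z := by
    ext z : 1
    rw [Kernel.prod_apply]
    rfl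
  rw [h]
  exact Kernel.measurable _

theorem MeasurablePolicy.measurable_rolloutLaw {π : Z → Policy S A} (hπ : MeasurablePolicy π)
    {μ : Z → Measure (S × A)} (hμ : Measurable μ) [∀ z, IsProbabilityMeasure (μ z)] :
    Measurable fun z => rolloutLaw M (μ z) (π z) :=
  measurable_prod_left_param _ (hπ.measurable_trajLaw M hμ)

theorem MeasurablePolicy.measurable_occ {π : Z → Policy S A} (hπ : MeasurablePolicy π) :
    Measurable fun z => occ M (π z) := by
  have h1 : Measurable fun z => M.init ⊗ₘ (π z).kernel :=
    measurable_compProd_param measurable_const (κ := fun z => (π z).kernel)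
      hπ.measurable_kernel
  exact (Measure.measurable_map _ (measurable_from_prod_countable_right
    fun n => measurable_pi_apply n)).comp (hπ.measurable_rolloutLaw M h1)

end Param

theorem stepOp_apply [DiscreteMeasurableSpace A] (π : Policy S A) {f : S × A → ℝ}
    (hf : Measurable f) {c : ℝ} (hfc : ∀ x, |f x| ≤ c) (x : S × A) :
    stepOp M π f x = ∫ s, ∑ a, π.prob s a * f (s, a) ∂M.p x := by
  have hi : Integrable f (stepKernel M π x) := integrable_of_abs_le hf hfc
  rw [stepOp]
  unfold stepKernel at hi ⊢
  rw [integral_compProd hi]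
  refine integral_congr_ae (Filter.Eventually.of_forall fun s => ?_)
  change ∫ a, f (s, a) ∂(∑ a, ENNReal.ofReal (π.prob s a) • Measure.dirac a : Measure A) = _
  rw [integral_finsetSum_measure fun a _ => (integrable_dirac (by simp)).smul_measure
    ENNReal.ofReal_ne_top]
  simp [integral_smul_measure, ENNReal.toReal_ofReal (π.nonneg s _)]

/-- Reweighting the actions of `π₀` by probability ratios turns one step of `π₀` into one
step of `π`. -/
theorem stepOp_ratio [DiscreteMeasurableSpace A] (π₀ π : Policy S A)
    (hac : ∀ s a, π₀.prob s a = 0 → π.prob s a = 0) {ρ : S × A → ℝ} (hρ : Measurable ρ) {R : ℝ}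
    (hρR : ∀ x, |ρ x| ≤ R) (hρ' : ∀ s a, ρ (s, a) = π.prob s a / π₀.prob s a) {f : S × A → ℝ}
    (hf : Measurable f) {c : ℝ} (hfc : ∀ x, |f x| ≤ c) :
    stepOp M π₀ (fun x => ρ x * f x) = stepOp M π f := by
  ext x
  have hρf : ∀ x, |ρ x * f x| ≤ R * c := fun x => by
    rw [abs_mul]
    exact mul_le_mul (hρR _) (hfc _) (abs_nonneg _) ((abs_nonneg _).trans (hρR x))
  rw [stepOp_apply M π hf hfc, stepOp_apply M π₀ (f := fun x => ρ x * f x) (hρ.mul hf) hρf]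
  refine integral_congr_ae (Filter.Eventually.of_forall fun s => Finset.sum_congr rfl fun a _ => ?_)
  rw [hρ']
  rcases eq_or_ne (π₀.prob s a) 0 with h | h
  · simp [h, hac s a h]
  · field_simp

end Traj

section Param

variable {S A Y : Type*} [MeasurableSpace S] [Fintype A] [MeasurableSpace A]
  [DiscreteMeasurableSpace A] [MeasurableSpace Y] {d : ℕ}
  (M : FeatureMDP S A d) (P : Params)

/-! ### Measurable dependence of the inner policies on the history -/

theorem measurable_det_param {ι : Type*} [Fintype ι] [DecidableEq ι] {Q : Y → Matrix ι ι ℝ}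
    (hQ : ∀ i j, Measurable fun y => Q y i j) : Measurable fun y => (Q y).det := by
  simp only [Matrix.det_apply]
  exact Finset.measurable_sum _ fun σ _ =>
    (Finset.measurable_prod _ fun i _ => hQ _ _).const_smul _

theorem measurable_inv_param {ι : Type*} [Fintype ι] [DecidableEq ι] {Q : Y → Matrix ι ι ℝ}
    (hQ : ∀ i j, Measurable fun y => Q y i j) (i j : ι) : Measurable fun y => (Q y)⁻¹ i j := by
  simp only [Matrix.inv_def, Matrix.smul_apply, Ring.inverse_eq_inv', smul_eq_mul,
    Matrix.adjugate_apply]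
  refine (measurable_det_param hQ).inv.mul (measurable_det_param fun k l => ?_)
  simp only [Matrix.updateRow_apply]
  split_ifs
  exacts [measurable_const, hQ k l]

theorem measurable_wnorm_param {Q : Y → Matrix (Fin d) (Fin d) ℝ}
    (hQ : ∀ i j, Measurable fun y => Q y i j) {x : Y → EuclideanSpace ℝ (Fin d)}
    (hx : Measurable x) : Measurable fun y => wnorm (Q y) (x y) := by
  have hc : ∀ i, Measurable fun y => x y i := fun i => by fun_prop
  simp only [wnorm, dotProduct, Matrix.mulVec]
  exact (Finset.measurable_sum _ fun i _ => (hc i).mul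
    (Finset.measurable_sum _ fun j _ => (hQ i j).mul (hc j))).sqrt

variable {Sg : Y → Matrix (Fin d) (Fin d) ℝ} (hSg : ∀ i j, Measurable fun y => Sg y i j)

include hSg

theorem measurable_confidence_param {x : Y → S × A} (hx : Measurable x) :
    Measurable fun y => √P.β * wnorm (Sg y)⁻¹ (M.φ (x y)) :=
  (measurable_wnorm_param (measurable_inv_param hSg) (M.measurable_φ.comp hx)).const_mul _

theorem measurableSet_knownPair_param {x : Y → S × A} (hx : Measurable x) :
    MeasurableSet {y | KnownPair M P (Sg y) (x y)} :=
  measurableSet_lt (measurable_confidence_param M P hSg hx) measurable_const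

theorem measurableSet_knownState_param {s : Y → S} (hs : Measurable s) :
    MeasurableSet {y | KnownState M P (Sg y) (s y)} := by
  have : {y | KnownState M P (Sg y) (s y)} = ⋂ a : A, {y | KnownPair M P (Sg y) (s y, a)} := by
    ext y; simp [KnownState]
  rw [this]
  exact MeasurableSet.iInter fun a : A =>
    measurableSet_knownPair_param M P hSg (x := fun y => (s y, a)) (hs.prodMk measurable_const)

theorem measurable_bonus_param {x : Y → S × A} (hx : Measurable x) :
    Measurable fun y => bonus M P (Sg y) (x y) := by
  classical
  unfold bonus bonusPhi bonusInd
  exact ((Measurable.ite (measurableSet_knownState_param M P hSg hx.fst)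
    (measurable_confidence_param M P hSg hx) measurable_const).const_mul _).add
    (Measurable.ite (measurableSet_knownPair_param M P hSg hx) measurable_const measurable_const)

theorem measurable_criticQ_param {w : Y → EuclideanSpace ℝ (Fin d)} (hw : Measurable w)
    {x : Y → S × A} (hx : Measurable x) : Measurable fun y => criticQ M P (Sg y) (w y) (x y) := by
  classical
  unfold criticQ
  have hb := measurable_bonus_param M P hSg hx
  exact Measurable.ite (measurableSet_knownState_param M P hSg hx.fst)
    (((M.measurable_φ.comp hx).inner hw).add (hb.const_mul _)) hb

theorem measurable_innerProb_param {w : Y → ℕ → EuclideanSpace ℝ (Fin d)} (k : ℕ)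
    (hw : ∀ i < k, Measurable fun y => w y i) {s : Y → S} (hs : Measurable s) :
    ∀ a, Measurable fun y => innerProb M P (Sg y) (w y) k (s y) a := by
  classical
  have hx : ∀ a : A, Measurable fun y => (s y, a) := fun a => hs.prodMk measurable_const
  induction k with
  | zero =>
    intro a
    simp only [innerProb]
    refine Measurable.ite (measurableSet_knownState_param M P hSg hs) measurable_const ?_
    refine Measurable.ite (measurableSet_knownPair_param M P hSg (hx a)) measurable_const ?_
    refine Measurable.const_div (Finset.measurable_sum _ fun a' _ => ?_) _
    exact Measurable.ite (measurableSet_knownPair_param M P hSg (hx a')) measurable_const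
      measurable_const
  | succ k ih =>
    intro a
    have ih' := ih fun i hi => hw i (by omega)
    simp only [innerProb]
    have h : ∀ a, Measurable fun y =>
        innerProb M P (Sg y) (w y) k (s y) a *
          Real.exp (P.η * criticQ M P (Sg y) (w y k) (s y, a)) := fun a =>
      (ih' a).mul ((measurable_criticQ_param M P hSg (hw k (by omega)) (hx a)).const_mul _).exp
    exact Measurable.ite (measurableSet_knownState_param M P hSg hs)
      ((h a).div (Finset.measurable_sum _ fun a' _ => h a')) (ih' a)

theorem measurablePolicy_innerPolicy [Nonempty A] {w : Y → ℕ → EuclideanSpace ℝ (Fin d)} (k : ℕ)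
    (hw : ∀ i < k, Measurable fun y => w y i) :
    MeasurablePolicy fun y => innerPolicy M P (Sg y) (w y) k := fun a =>
  measurable_innerProb_param M P (Sg := fun q : Y × S => Sg q.1)
    (fun i j => (hSg i j).comp measurable_fst) (w := fun q => w q.1) k
    (fun i hi => (hw i hi).comp measurable_fst) measurable_snd a

end Param

section Tilt

variable {S A : Type*} [MeasurableSpace S] [Fintype A] [MeasurableSpace A] {d : ℕ}
  (M : FeatureMDP S A d) (P : Params) (Sg : Matrix (Fin d) (Fin d) ℝ)

/-! ### Bounds on bonus and critic -/

theorem wnorm_nonneg (Q : Matrix (Fin d) (Fin d) ℝ) (x : EuclideanSpace ℝ (Fin d)) :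
    0 ≤ wnorm Q x := Real.sqrt_nonneg _

theorem FeatureMDP.one_sub_γ_pos : 0 < 1 - M.γ := by linarith [M.γ_lt_one]

theorem FeatureMDP.three_le_B : 3 ≤ M.B := by
  rw [FeatureMDP.B, le_div_iff₀ M.one_sub_γ_pos]
  linarith [M.γ_nonneg]

theorem FeatureMDP.Gmax_pos : 0 < M.Gmax :=
  div_pos (by linarith [M.three_le_B]) M.one_sub_γ_pos

theorem bonusPhi_nonneg (x : S × A) : 0 ≤ bonusPhi M P Sg x := by
  unfold bonusPhi
  split_ifs
  exacts [mul_nonneg (Real.sqrt_nonneg _) (wnorm_nonneg _ _), le_rfl]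

theorem bonusPhi_le_one (x : S × A) : bonusPhi M P Sg x ≤ 1 := by
  unfold bonusPhi
  split_ifs with h
  exacts [(h x.2).le, zero_le_one]

theorem bonus_eq_of_knownState {x : S × A} (h : KnownState M P Sg x.1) :
    bonus M P Sg x = 2 * bonusPhi M P Sg x := by
  have : KnownPair M P Sg x := h x.2
  simp [bonus, bonusInd, this]

theorem bonus_nonneg (x : S × A) : 0 ≤ bonus M P Sg x := by
  have := bonusPhi_nonneg M P Sg x
  have h3 := M.three_le_B
  unfold bonus bonusInd
  rw [FeatureMDP.B] at h3
  split_ifs <;> linarith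

theorem bonus_le_B (x : S × A) : bonus M P Sg x ≤ M.B := by
  have h3 := M.three_le_B
  by_cases h : KnownState M P Sg x.1
  · rw [bonus_eq_of_knownState M P Sg h]
    linarith [bonusPhi_le_one M P Sg x]
  · simp only [bonus, bonusPhi, h, if_false]
    unfold bonusInd
    rw [FeatureMDP.B] at h3 ⊢
    split_ifs <;> linarith

theorem abs_inner_φ_le (x : S × A) (w : EuclideanSpace ℝ (Fin d)) : |inner ℝ (M.φ x) w| ≤ ‖w‖ :=
  (abs_real_inner_le_norm _ _).trans
    (mul_le_of_le_one_left (norm_nonneg _) (M.norm_φ_le x))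

theorem criticQ_sub_le {s : S} (h : KnownState M P Sg s) (w : EuclideanSpace ℝ (Fin d))
    (a a' : A) : criticQ M P Sg w (s, a) - criticQ M P Sg w (s, a') ≤ 2 * ‖w‖ + 1 := by
  simp only [criticQ, h, if_true]
  rw [bonus_eq_of_knownState M P Sg (x := (s, a)) h, bonus_eq_of_knownState M P Sg (x := (s, a')) h]
  have h1 := abs_le.1 (abs_inner_φ_le M (s, a) w)
  have h2 := abs_le.1 (abs_inner_φ_le M (s, a') w)
  linarith [bonusPhi_le_one M P Sg (s, a), bonusPhi_nonneg M P Sg (s, a')]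

theorem criticQ_sub_le' {s : S} (h : KnownState M P Sg s) (v v' : EuclideanSpace ℝ (Fin d))
    (a : A) : criticQ M P Sg v (s, a) - criticQ M P Sg v' (s, a) ≤ ‖v - v'‖ := by
  simp only [criticQ, h, if_true]
  have h1 := (abs_le.1 (abs_inner_φ_le M (s, a) (v - v'))).2
  rw [inner_sub_right] at h1
  linarith

/-! ### Inner policies as exponential tilts -/

variable {P Sg} in
theorem innerProb_congr {w w' : ℕ → EuclideanSpace ℝ (Fin d)} {k : ℕ}
    (h : ∀ i < k, w i = w' i) : innerProb M P Sg w k = innerProb M P Sg w' k := by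
  induction k with
  | zero => ext s a; simp only [innerProb]
  | succ k ih =>
    ext s a
    simp only [innerProb, ih fun i hi => h i (by omega), h k (by omega)]

theorem innerProb_of_not_knownState (w : ℕ → EuclideanSpace ℝ (Fin d)) {s : S}
    (h : ¬ KnownState M P Sg s) (j m : ℕ) (a : A) :
    innerProb M P Sg w (j + m) s a = innerProb M P Sg w j s a := by
  induction m with
  | zero => rfl
  | succ m ih => rw [← add_assoc, innerProb, if_neg h, ih]

theorem innerProb_pos [Nonempty A] (w : ℕ → EuclideanSpace ℝ (Fin d)) {s : S}
    (h : KnownState M P Sg s) (k : ℕ) (a : A) : 0 < innerProb M P Sg w k s a := by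
  induction k generalizing a with
  | zero => simp only [innerProb, h, if_true]; positivity
  | succ k ih =>
    simp only [innerProb, h, if_true]
    exact div_pos (mul_pos (ih a) (Real.exp_pos _))
      (Finset.sum_pos (fun a' _ => mul_pos (ih a') (Real.exp_pos _)) Finset.univ_nonempty)

/-- After `m` further updates, the inner policy is the old one, tilted by the exponential of the sum
of the `m` critics. -/
theorem innerProb_add [Nonempty A] (w : ℕ → EuclideanSpace ℝ (Fin d)) {s : S}
    (h : KnownState M P Sg s) (j m : ℕ) (a : A) :
    innerProb M P Sg w (j + m) s a = innerProb M P Sg w j s a *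
      Real.exp (P.η * ∑ i ∈ Finset.range m, criticQ M P Sg (w (j + i)) (s, a)) /
      ∑ a', innerProb M P Sg w j s a' *
        Real.exp (P.η * ∑ i ∈ Finset.range m, criticQ M P Sg (w (j + i)) (s, a')) := by
  induction m generalizing a with
  | zero =>
    have hs := innerProb_sum M P Sg w j s
    simp [hs]
  | succ m ih =>
    set Z := ∑ a', innerProb M P Sg w j s a' *
        Real.exp (P.η * ∑ i ∈ Finset.range m, criticQ M P Sg (w (j + i)) (s, a')) with hZ
    have hZ0 : 0 < Z := Finset.sum_pos
      (fun a' _ => mul_pos (innerProb_pos M P Sg w h j a') (Real.exp_pos _)) Finset.univ_nonempty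
    have key : ∀ a, innerProb M P Sg w (j + m) s a *
        Real.exp (P.η * criticQ M P Sg (w (j + m)) (s, a)) =
        (innerProb M P Sg w j s a *
          Real.exp (P.η * ∑ i ∈ Finset.range (m + 1), criticQ M P Sg (w (j + i)) (s, a))) / Z := by
      intro a
      rw [ih, Finset.sum_range_succ, mul_add, Real.exp_add]
      ring
    rw [← add_assoc, innerProb, if_pos h]
    simp only [key]
    rw [← Finset.sum_div, div_div_div_cancel_right₀ hZ0.ne']

/-- The critic's parameters, replaced by `v` from index `j` on. -/
def splice (w : ℕ → EuclideanSpace ℝ (Fin d)) (j : ℕ) (v : EuclideanSpace ℝ (Fin d)) (i : ℕ) :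
    EuclideanSpace ℝ (Fin d) :=
  if i < j then w i else v

/-- Since critics are affine in their parameter, `m` updates amount to `m` updates with the
average parameter. -/
theorem innerProb_splice_average [Nonempty A] (w : ℕ → EuclideanSpace ℝ (Fin d)) (j m : ℕ)
    {v : EuclideanSpace ℝ (Fin d)} (hv : ∑ i ∈ Finset.range m, w (j + i) = (m : ℝ) • v) :
    innerProb M P Sg (splice w j v) (j + m) = innerProb M P Sg w (j + m) := by
  have hj : innerProb M P Sg (splice w j v) j = innerProb M P Sg w j :=
    innerProb_congr M fun i hi => by simp [splice, hi]
  ext s a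
  by_cases h : KnownState M P Sg s
  · have hsum : ∀ a, ∑ i ∈ Finset.range m, criticQ M P Sg (splice w j v (j + i)) (s, a) =
        ∑ i ∈ Finset.range m, criticQ M P Sg (w (j + i)) (s, a) := by
      intro a
      simp only [criticQ, h, if_true, splice, not_lt.2 (Nat.le_add_right j _), if_false,
        Finset.sum_add_distrib, ← inner_sum, hv, inner_smul_right]
      simp [← Nat.cast_smul_eq_nsmul ℝ, inner_smul_right]
    rw [innerProb_add M P Sg _ h, innerProb_add M P Sg _ h, hj]
    simp only [hsum]
  · rw [innerProb_of_not_knownState M P Sg _ h, innerProb_of_not_knownState M P Sg _ h, hj]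

/-- The inner policy obtained from `π_j` by `m` updates with the critic's parameter `v`. -/
noncomputable def tiltPolicy [Nonempty A] (w : ℕ → EuclideanSpace ℝ (Fin d)) (j m : ℕ)
    (v : EuclideanSpace ℝ (Fin d)) : Policy S A :=
  innerPolicy M P Sg (splice w j v) (j + m)

/-- The probability ratio of `tiltPolicy` and the inner policy `π_j`. Where `π_j` has probability
zero, so does `tiltPolicy`, and the junk value `0 / 0 = 0` is harmless. -/
noncomputable def tiltRatio [Nonempty A] (w : ℕ → EuclideanSpace ℝ (Fin d)) (j m : ℕ)
    (v : EuclideanSpace ℝ (Fin d)) (x : S × A) : ℝ :=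
  (tiltPolicy M P Sg w j m v).prob x.1 x.2 / (innerPolicy M P Sg w j).prob x.1 x.2

variable [Nonempty A] (w : ℕ → EuclideanSpace ℝ (Fin d)) (j m : ℕ)

theorem tiltRatio_of_knownState (v : EuclideanSpace ℝ (Fin d)) {s : S} (h : KnownState M P Sg s)
    (a : A) :
    tiltRatio M P Sg w j m v (s, a) = Real.exp (P.η * m * criticQ M P Sg v (s, a)) /
      ∑ a', innerProb M P Sg w j s a' * Real.exp (P.η * m * criticQ M P Sg v (s, a')) := by
  have hj : innerProb M P Sg (splice w j v) j = innerProb M P Sg w j :=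
    innerProb_congr M fun i hi => by simp [splice, hi]
  have hs : ∀ i, splice w j v (j + i) = v := fun i => by simp [splice]
  have hp := innerProb_pos M P Sg w h j a
  simp only [tiltRatio, tiltPolicy, innerPolicy]
  rw [innerProb_add M P Sg _ h, hj]
  simp only [hs, Finset.sum_const, Finset.card_range, nsmul_eq_mul, ← mul_assoc]
  field_simp

theorem tiltRatio_of_not_knownState (v : EuclideanSpace ℝ (Fin d)) {s : S}
    (h : ¬ KnownState M P Sg s) (a : A) :
    tiltRatio M P Sg w j m v (s, a) =
      innerProb M P Sg w j s a / innerProb M P Sg w j s a := by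
  have hj : innerProb M P Sg (splice w j v) j = innerProb M P Sg w j :=
    innerProb_congr M fun i hi => by simp [splice, hi]
  simp only [tiltRatio, tiltPolicy, innerPolicy]
  rw [innerProb_of_not_knownState M P Sg _ h, hj]

theorem tiltPolicy_absolutelyContinuous (v : EuclideanSpace ℝ (Fin d)) (s : S) (a : A)
    (h0 : (innerPolicy M P Sg w j).prob s a = 0) : (tiltPolicy M P Sg w j m v).prob s a = 0 := by
  by_cases h : KnownState M P Sg s
  · exact absurd h0 (innerProb_pos M P Sg w h j a).ne'
  · have hj : innerProb M P Sg (splice w j v) j = innerProb M P Sg w j :=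
      innerProb_congr M fun i hi => by simp [splice, hi]
    simp only [tiltPolicy, innerPolicy] at h0 ⊢
    rw [innerProb_of_not_knownState M P Sg _ h, hj, h0]

theorem tiltRatio_nonneg (v : EuclideanSpace ℝ (Fin d)) (x : S × A) :
    0 ≤ tiltRatio M P Sg w j m v x :=
  div_nonneg (Policy.nonneg _ _ _) (Policy.nonneg _ _ _)

theorem tiltRatio_le (hη : 0 ≤ P.η) (v : EuclideanSpace ℝ (Fin d)) (x : S × A) :
    tiltRatio M P Sg w j m v x ≤ Real.exp (P.η * m * (2 * ‖v‖ + 1)) := by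
  obtain ⟨s, a⟩ := x
  have hη' : 0 ≤ P.η * m := by positivity
  by_cases h : KnownState M P Sg s
  · rw [tiltRatio_of_knownState M P Sg w j m v h]
    have hsum : Real.exp (P.η * m * (criticQ M P Sg v (s, a) - (2 * ‖v‖ + 1))) ≤
        ∑ a', innerProb M P Sg w j s a' * Real.exp (P.η * m * criticQ M P Sg v (s, a')) := by
      calc _ = ∑ a', innerProb M P Sg w j s a' *
            Real.exp (P.η * m * (criticQ M P Sg v (s, a) - (2 * ‖v‖ + 1))) := by
            rw [← Finset.sum_mul, innerProb_sum, one_mul]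
        _ ≤ _ := Finset.sum_le_sum fun a' _ =>
            mul_le_mul_of_nonneg_left (Real.exp_le_exp.2 (mul_le_mul_of_nonneg_left
              (by linarith [criticQ_sub_le M P Sg h v a a']) hη'))
              (innerProb_nonneg M P Sg w j s a')
    rw [div_le_iff₀ ((Real.exp_pos _).trans_le hsum)]
    refine le_trans (le_of_eq ?_) (mul_le_mul_of_nonneg_left hsum (Real.exp_pos _).le)
    rw [← Real.exp_add]
    congr 1
    ring
  · rw [tiltRatio_of_not_knownState M P Sg w j m v h]
    exact (div_self_le_one _).trans (Real.one_le_exp (by positivity))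

theorem tiltRatio_le_mul (hη : 0 ≤ P.η) (v v' : EuclideanSpace ℝ (Fin d)) (x : S × A) :
    tiltRatio M P Sg w j m v x ≤
      Real.exp (2 * (P.η * m * ‖v - v'‖)) * tiltRatio M P Sg w j m v' x := by
  obtain ⟨s, a⟩ := x
  have hη' : 0 ≤ P.η * m := by positivity
  by_cases h : KnownState M P Sg s
  · rw [tiltRatio_of_knownState M P Sg w j m v h, tiltRatio_of_knownState M P Sg w j m v' h]
    have hpos : ∀ v, 0 < ∑ a', innerProb M P Sg w j s a' *
        Real.exp (P.η * m * criticQ M P Sg v (s, a')) := fun v =>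
      Finset.sum_pos (fun a' _ => mul_pos (innerProb_pos M P Sg w h j a') (Real.exp_pos _))
        Finset.univ_nonempty
    have hnum : Real.exp (P.η * m * criticQ M P Sg v (s, a)) ≤
        Real.exp (P.η * m * ‖v - v'‖) * Real.exp (P.η * m * criticQ M P Sg v' (s, a)) := by
      rw [← Real.exp_add, Real.exp_le_exp, ← mul_add]
      exact mul_le_mul_of_nonneg_left (by linarith [criticQ_sub_le' M P Sg h v v' a]) hη'
    have hden : ∑ a', innerProb M P Sg w j s a' *
          Real.exp (P.η * m * criticQ M P Sg v' (s, a')) ≤ Real.exp (P.η * m * ‖v - v'‖) *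
        ∑ a', innerProb M P Sg w j s a' * Real.exp (P.η * m * criticQ M P Sg v (s, a')) := by
      rw [Finset.mul_sum]
      refine Finset.sum_le_sum fun a' _ => ?_
      rw [mul_left_comm]
      refine mul_le_mul_of_nonneg_left ?_ (innerProb_nonneg M P Sg w j s a')
      rw [← Real.exp_add, Real.exp_le_exp, ← mul_add]
      refine mul_le_mul_of_nonneg_left ?_ hη'
      rw [norm_sub_rev]
      linarith [criticQ_sub_le' M P Sg h v' v a']
    rw [← mul_div_assoc, div_le_div_iff₀ (hpos v) (hpos v')]
    calc _ ≤ (Real.exp (P.η * m * ‖v - v'‖) * Real.exp (P.η * m * criticQ M P Sg v' (s, a))) *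
          (Real.exp (P.η * m * ‖v - v'‖) *
            ∑ a', innerProb M P Sg w j s a' * Real.exp (P.η * m * criticQ M P Sg v (s, a'))) :=
          mul_le_mul hnum hden (hpos v').le (by positivity)
      _ = _ := by
          rw [two_mul, Real.exp_add]
          ring
  · rw [tiltRatio_of_not_knownState M P Sg w j m v h,
      tiltRatio_of_not_knownState M P Sg w j m v' h]
    exact le_mul_of_one_le_left (div_nonneg (innerProb_nonneg M P Sg w j s a)
      (innerProb_nonneg M P Sg w j s a)) (Real.one_le_exp (by positivity))

end Tilt

section Target

variable {S A : Type*} [MeasurableSpace S] [Fintype A] [Nonempty A] [MeasurableSpace A] {d : ℕ}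
  (M : FeatureMDP S A d) (P : Params) (Sg : Matrix (Fin d) (Fin d) ℝ)

/-! ### Regression targets of bounded rollouts -/

/-- The coefficient of the bonus at the first state-action that is subtracted from the importance
weighted return of a rollout of length `l + 1`. In either form its mean is `1`. -/
noncomputable def bonusCoeff (l : ℕ) : ℝ :=
  match P.form with
  | .offset => 1
  | .censored => if l = 0 then 1 / (1 - M.γ) else 0

/-- The reward plus the bonus. -/
noncomputable def bonusReward (x : S × A) : ℝ := M.r x + bonus M P Sg x

/-- The regression target for `tiltPolicy`, with the return put to zero on rollouts of more than
`H + 1` state-actions. -/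
noncomputable def truncTarget (H : ℕ) (w : ℕ → EuclideanSpace ℝ (Fin d)) (j m : ℕ)
    (v : EuclideanSpace ℝ (Fin d)) (z : Rollout S A) : ℝ :=
  (if z.1 ≤ H then (∏ t ∈ Finset.Icc 1 z.1, tiltRatio M P Sg w j m v (z.2 t)) *
    (1 / (1 - M.γ) * bonusReward M P Sg (z.2 z.1)) else 0) -
    bonus M P Sg (z.2 0) * bonusCoeff M P z.1

variable (w : ℕ → EuclideanSpace ℝ (Fin d)) (j m H : ℕ)

theorem target_eq_truncTarget (v : EuclideanSpace ℝ (Fin d)) {z : Rollout S A} (hz : z.1 ≤ H) :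
    target M P (bonus M P Sg) (innerPolicy M P Sg w j) (tiltPolicy M P Sg w j m v) z =
      truncTarget M P Sg H w j m v z := by
  have hw : isWeight (innerPolicy M P Sg w j) (tiltPolicy M P Sg w j m v) z =
      ∏ t ∈ Finset.Icc 1 z.1, tiltRatio M P Sg w j m v (z.2 t) := rfl
  unfold target truncTarget bonusCoeff bonusReward
  rw [hw, if_pos hz]
  cases P.form with
  | offset => simp
  | censored =>
    rcases eq_or_ne z.1 0 with h | h
    · simp only [h, if_true, Finset.Icc_eq_empty_of_lt zero_lt_one, Finset.prod_empty]
      ring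
    · simp [h]

theorem bonusCoeff_nonneg (l : ℕ) : 0 ≤ bonusCoeff M P l := by
  have := M.one_sub_γ_pos
  unfold bonusCoeff
  cases P.form with
  | offset => simp
  | censored => dsimp only; split_ifs <;> positivity

theorem bonusCoeff_le (l : ℕ) : bonusCoeff M P l ≤ 1 / (1 - M.γ) := by
  have h := M.one_sub_γ_pos
  have h1 : 1 ≤ 1 / (1 - M.γ) := by
    rw [le_div_iff₀ h]; linarith [M.γ_nonneg]
  unfold bonusCoeff
  cases P.form with
  | offset => exact h1
  | censored => dsimp only; split_ifs <;> linarith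

theorem abs_bonusReward_le (x : S × A) : |bonusReward M P Sg x| ≤ 1 + M.B := by
  have h1 := abs_le.1 (M.abs_r_le x)
  rw [abs_le, bonusReward]
  constructor <;> linarith [bonus_nonneg M P Sg x, bonus_le_B M P Sg x]

variable {M P Sg w j m H}

/-- The importance weight in the window of data reuse. -/
theorem prod_tiltRatio_le (hη : 0 ≤ P.η) (hwin : P.η * m * (2 * (M.B + M.W)) * H ≤ Real.log 2)
    {v : EuclideanSpace ℝ (Fin d)} (hv : ‖v‖ ≤ M.W) {l : ℕ} (hl : l ≤ H) (x : ℕ → S × A) :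
    ∏ t ∈ Finset.Icc 1 l, tiltRatio M P Sg w j m v (x t) ≤ 2 := by
  calc ∏ t ∈ Finset.Icc 1 l, tiltRatio M P Sg w j m v (x t)
      ≤ ∏ t ∈ Finset.Icc 1 l, Real.exp (P.η * m * (2 * ‖v‖ + 1)) :=
        Finset.prod_le_prod (fun t _ => tiltRatio_nonneg M P Sg w j m v _)
          fun t _ => tiltRatio_le M P Sg w j m hη v _
    _ = Real.exp (l * (P.η * m * (2 * ‖v‖ + 1))) := by simp [Real.exp_nat_mul]
    _ ≤ Real.exp (Real.log 2) := by
        refine Real.exp_le_exp.2 (le_trans ?_ hwin)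
        have h1 : (l : ℝ) ≤ H := by exact_mod_cast hl
        have h2 : 2 * ‖v‖ + 1 ≤ 2 * (M.B + M.W) := by linarith [M.three_le_B]
        calc (l : ℝ) * (P.η * m * (2 * ‖v‖ + 1)) ≤ H * (P.η * m * (2 * (M.B + M.W))) := by gcongr
          _ = _ := by ring
    _ = 2 := Real.exp_log two_pos

theorem prod_tiltRatio_sub_le (hη : 0 ≤ P.η) (hwin : P.η * m * (2 * (M.B + M.W)) * H ≤ Real.log 2)
    {ε : ℝ} (hε0 : 0 ≤ ε) (hε : ε ≤ 1) {v v' : EuclideanSpace ℝ (Fin d)} (hv' : ‖v'‖ ≤ M.W)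
    (hvv : ‖v - v'‖ ≤ M.W * ε) {l : ℕ} (hl : l ≤ H) (x : ℕ → S × A) :
    ∏ t ∈ Finset.Icc 1 l, tiltRatio M P Sg w j m v (x t) -
      ∏ t ∈ Finset.Icc 1 l, tiltRatio M P Sg w j m v' (x t) ≤ 4 * ε := by
  set p' := ∏ t ∈ Finset.Icc 1 l, tiltRatio M P Sg w j m v' (x t)
  have hp' : p' ≤ 2 := prod_tiltRatio_le hη hwin hv' hl x
  have hp0 : 0 ≤ p' := Finset.prod_nonneg fun t _ => tiltRatio_nonneg M P Sg w j m v' _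
  have hexp : (l : ℝ) * (2 * (P.η * m * ‖v - v'‖)) ≤ ε := by
    have h1 : (l : ℝ) ≤ H := by exact_mod_cast hl
    calc (l : ℝ) * (2 * (P.η * m * ‖v - v'‖)) ≤ H * (2 * (P.η * m * (M.W * ε))) := by gcongr
      _ = (P.η * m * (2 * M.W) * H) * ε := by ring
      _ ≤ (P.η * m * (2 * (M.B + M.W)) * H) * ε := by
          gcongr
          linarith [M.three_le_B]
      _ ≤ Real.log 2 * ε := by gcongr
      _ ≤ 1 * ε := by
          gcongr
          linarith [Real.log_two_lt_d9]
      _ = ε := one_mul _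
  have h1 : ∏ t ∈ Finset.Icc 1 l, tiltRatio M P Sg w j m v (x t) ≤ Real.exp ε * p' := by
    calc ∏ t ∈ Finset.Icc 1 l, tiltRatio M P Sg w j m v (x t)
        ≤ ∏ t ∈ Finset.Icc 1 l, (Real.exp (2 * (P.η * m * ‖v - v'‖)) *
            tiltRatio M P Sg w j m v' (x t)) :=
          Finset.prod_le_prod (fun t _ => tiltRatio_nonneg M P Sg w j m v _)
            fun t _ => tiltRatio_le_mul M P Sg w j m hη v v' _
      _ = Real.exp (l * (2 * (P.η * m * ‖v - v'‖))) * p' := by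
          rw [Finset.prod_mul_distrib]
          simp only [Finset.prod_const, Nat.card_Icc, add_tsub_cancel_right, Real.exp_nat_mul, p']
      _ ≤ Real.exp ε * p' := mul_le_mul_of_nonneg_right (Real.exp_le_exp.2 hexp) hp0
  have h2 := exp_le_one_add_add_sq hε
  nlinarith

theorem abs_prod_tiltRatio_sub_le (hη : 0 ≤ P.η)
    (hwin : P.η * m * (2 * (M.B + M.W)) * H ≤ Real.log 2)
    {ε : ℝ} (hε0 : 0 ≤ ε) (hε : ε ≤ 1) {v v' : EuclideanSpace ℝ (Fin d)} (hv : ‖v‖ ≤ M.W)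
    (hv' : ‖v'‖ ≤ M.W) (hvv : ‖v - v'‖ ≤ M.W * ε) {l : ℕ} (hl : l ≤ H) (x : ℕ → S × A) :
    |∏ t ∈ Finset.Icc 1 l, tiltRatio M P Sg w j m v (x t) -
      ∏ t ∈ Finset.Icc 1 l, tiltRatio M P Sg w j m v' (x t)| ≤ 4 * ε := by
  refine abs_sub_le_iff.2 ⟨prod_tiltRatio_sub_le hη hwin hε0 hε hv' hvv hl x, ?_⟩
  exact prod_tiltRatio_sub_le hη hwin hε0 hε hv (by rwa [norm_sub_rev]) hl x

theorem abs_return_le (x : S × A) : |1 / (1 - M.γ) * bonusReward M P Sg x| ≤ M.Gmax := by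
  have h := M.one_sub_γ_pos
  rw [abs_mul, abs_of_pos (by positivity : 0 < 1 / (1 - M.γ)), FeatureMDP.Gmax, div_mul_eq_mul_div,
    one_mul]
  gcongr
  linarith [abs_bonusReward_le M P Sg x]

theorem abs_truncTarget_le (hη : 0 ≤ P.η)
    (hwin : P.η * m * (2 * (M.B + M.W)) * H ≤ Real.log 2)
    {v : EuclideanSpace ℝ (Fin d)} (hv : ‖v‖ ≤ M.W) (z : Rollout S A) :
    |truncTarget M P Sg H w j m v z| ≤ 3 * M.Gmax := by
  have hγ := M.one_sub_γ_pos
  have hG := M.Gmax_pos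
  have h1 : |if z.1 ≤ H then (∏ t ∈ Finset.Icc 1 z.1, tiltRatio M P Sg w j m v (z.2 t)) *
      (1 / (1 - M.γ) * bonusReward M P Sg (z.2 z.1)) else 0| ≤ 2 * M.Gmax := by
    split_ifs with hl
    · rw [abs_mul, abs_of_nonneg
        (Finset.prod_nonneg fun t _ => tiltRatio_nonneg M P Sg w j m v _)]
      exact mul_le_mul (prod_tiltRatio_le hη hwin hv hl z.2) (abs_return_le _) (abs_nonneg _)
        zero_le_two
    · simp [hG.le]
  have h2 : |bonus M P Sg (z.2 0) * bonusCoeff M P z.1| ≤ M.Gmax := by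
    rw [abs_of_nonneg (mul_nonneg (bonus_nonneg M P Sg _) (bonusCoeff_nonneg M P _))]
    calc _ ≤ M.B * (1 / (1 - M.γ)) := mul_le_mul (bonus_le_B M P Sg _) (bonusCoeff_le M P _)
          (bonusCoeff_nonneg M P _) (by linarith [M.three_le_B])
      _ ≤ M.Gmax := by
          rw [FeatureMDP.Gmax, mul_one_div]
          gcongr
          linarith
  exact (abs_sub _ _).trans (by linarith)

theorem abs_truncTarget_sub_le (hη : 0 ≤ P.η)
    (hwin : P.η * m * (2 * (M.B + M.W)) * H ≤ Real.log 2)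
    {ε : ℝ} (hε0 : 0 ≤ ε) (hε : ε ≤ 1) {v v' : EuclideanSpace ℝ (Fin d)} (hv : ‖v‖ ≤ M.W)
    (hv' : ‖v'‖ ≤ M.W) (hvv : ‖v - v'‖ ≤ M.W * ε) (z : Rollout S A) :
    |truncTarget M P Sg H w j m v z - truncTarget M P Sg H w j m v' z| ≤ 4 * ε * M.Gmax := by
  unfold truncTarget
  rw [sub_sub_sub_cancel_right]
  have hG := M.Gmax_pos
  split_ifs with hl
  · rw [← sub_mul, abs_mul]
    exact mul_le_mul (abs_prod_tiltRatio_sub_le hη hwin hε0 hε hv hv' hvv hl z.2) (abs_return_le _)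
      (abs_nonneg _) (by positivity)
  · rw [sub_self, abs_zero]
    positivity

variable [DiscreteMeasurableSpace A]

theorem measurable_tiltRatio_param {Y : Type*} [MeasurableSpace Y]
    {Sg : Y → Matrix (Fin d) (Fin d) ℝ} (hSg : ∀ i j, Measurable fun y => Sg y i j)
    {w : Y → ℕ → EuclideanSpace ℝ (Fin d)} (hw : ∀ i < j, Measurable fun y => w y i)
    (v : EuclideanSpace ℝ (Fin d)) {x : Y → S × A} (hx : Measurable x) :
    Measurable fun y => tiltRatio M P (Sg y) (w y) j m v (x y) := by
  have h1 : MeasurablePolicy fun y => tiltPolicy M P (Sg y) (w y) j m v :=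
    measurablePolicy_innerPolicy M P hSg (w := fun y => splice (w y) j v) (j + m) fun i _ => by
      by_cases hi : i < j
      · simp only [splice, hi, if_true]
        exact hw i hi
      · simp only [splice, hi, if_false]
        exact measurable_const
  have h2 := measurablePolicy_innerPolicy M P hSg j hw
  exact (h1.prob.comp (measurable_id.prodMk hx)).div (h2.prob.comp (measurable_id.prodMk hx))

theorem measurable_truncTarget_param {Y : Type*} [MeasurableSpace Y]
    {Sg : Y → Matrix (Fin d) (Fin d) ℝ} (hSg : ∀ i j, Measurable fun y => Sg y i j)
    {w : Y → ℕ → EuclideanSpace ℝ (Fin d)} (hw : ∀ i < j, Measurable fun y => w y i)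
    (v : EuclideanSpace ℝ (Fin d)) {z : Y → Rollout S A} (hz : Measurable z) :
    Measurable fun y => truncTarget M P (Sg y) H (w y) j m v (z y) := by
  have hx : ∀ t, Measurable fun y => (z y).2 t := fun t => (measurable_pi_apply t).comp hz.snd
  have key : Measurable fun q : ℕ × Y =>
      (if q.1 ≤ H then (∏ t ∈ Finset.Icc 1 q.1,
        tiltRatio M P (Sg q.2) (w q.2) j m v ((z q.2).2 t)) *
        (1 / (1 - M.γ) * bonusReward M P (Sg q.2) ((z q.2).2 q.1)) else 0) -
        bonus M P (Sg q.2) ((z q.2).2 0) * bonusCoeff M P q.1 := by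
    refine measurable_from_prod_countable_right fun l => ?_
    dsimp only
    refine Measurable.sub ?_ ((measurable_bonus_param M P hSg (hx 0)).mul_const _)
    split_ifs
    · exact (Finset.measurable_prod _ fun t _ => measurable_tiltRatio_param hSg hw v (hx t)).mul
        (((M.measurable_r.comp (hx l)).add (measurable_bonus_param M P hSg (hx l))).const_mul _)
    · exact measurable_const
  exact key.comp (f := fun y => ((z y).1, y)) (hz.fst.prodMk measurable_id)

theorem measurable_truncTarget (v : EuclideanSpace ℝ (Fin d)) :
    Measurable (truncTarget M P Sg H w j m v) :=
  measurable_truncTarget_param (Y := Rollout S A) (Sg := fun _ => Sg)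
    (fun _ _ => measurable_const) (w := fun _ => w) (fun _ _ => measurable_const) v measurable_id

theorem measurable_bonus : Measurable (bonus M P Sg) :=
  measurable_bonus_param M P (Sg := fun _ : S × A => Sg) (fun _ _ => measurable_const) measurable_id

theorem measurable_bonusReward : Measurable (bonusReward M P Sg) :=
  M.measurable_r.add measurable_bonus

theorem measurable_tiltRatio (v : EuclideanSpace ℝ (Fin d)) :
    Measurable (tiltRatio M P Sg w j m v) :=
  measurable_tiltRatio_param (Y := S × A) (Sg := fun _ => Sg) (fun _ _ => measurable_const)
    (w := fun _ => w) (fun _ _ => measurable_const) v measurable_id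

theorem integral_bonusCoeff : ∫ l, bonusCoeff M P l ∂horizonLaw M = 1 := by
  have hγ := M.one_sub_γ_pos.ne'
  unfold bonusCoeff
  cases P.form with
  | offset => simp
  | censored =>
    have h : (fun l : ℕ => if l = 0 then 1 / (1 - M.γ) else 0) =
        Set.indicator {0} fun _ => 1 / (1 - M.γ) := by
      ext l; simp [Set.indicator_apply]
    dsimp only
    rw [h, integral_indicator (measurableSet_singleton 0), setIntegral_const,
      horizonLaw_real_singleton]
    simp [hγ]

/-- Unbiasedness: given the first state-action, the mean of the truncated target is
the truncated action value of the target policy minus the bonus. -/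
theorem integral_mul_truncTarget (hη : 0 ≤ P.η)
    (hwin : P.η * m * (2 * (M.B + M.W)) * H ≤ Real.log 2)
    (ρ : Measure (S × A)) [IsProbabilityMeasure ρ] {v : EuclideanSpace ℝ (Fin d)}
    (hv : ‖v‖ ≤ M.W) {g : S × A → ℝ} (hg : Measurable g) {c : ℝ} (hgc : ∀ x, |g x| ≤ c) :
    ∫ z, g (z.2 0) * truncTarget M P Sg H w j m v z ∂rolloutLaw M ρ (innerPolicy M P Sg w j) =
      ∫ x, g x * (truncQ M (tiltPolicy M P Sg w j m v) (bonusReward M P Sg) H x -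
        bonus M P Sg x) ∂ρ := by
  have hγ := M.one_sub_γ_pos
  have hG := M.Gmax_pos
  set π₀ := innerPolicy M P Sg w j
  set π := tiltPolicy M P Sg w j m v
  have hc0 : 0 ≤ c := (abs_nonneg _).trans (hgc (Classical.choice ρ.nonempty_of_neZero))
  have hbr := measurable_bonusReward (M := M) (P := P) (Sg := Sg)
  have hbc : Measurable (bonusCoeff M P) := measurable_from_nat
  have hb := measurable_bonus (M := M) (P := P) (Sg := Sg)
  have hB0 : 0 ≤ M.B := by linarith [M.three_le_B]
  let F₁ : Rollout S A → ℝ := fun z => g (z.2 0) *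
    (truncTarget M P Sg H w j m v z + bonus M P Sg (z.2 0) * bonusCoeff M P z.1)
  let F₂ : Rollout S A → ℝ := fun z => (g (z.2 0) * bonus M P Sg (z.2 0)) * bonusCoeff M P z.1
  have hz0 : Measurable fun z : Rollout S A => z.2 0 := (measurable_pi_apply 0).comp measurable_snd
  have hF₂ : Measurable F₂ :=
    ((hg.comp hz0).mul (hb.comp hz0)).mul (hbc.comp measurable_fst)
  have hF₁ : Measurable F₁ := (hg.comp hz0).mul ((measurable_truncTarget v).add
    ((hb.comp hz0).mul (hbc.comp measurable_fst)))
  have habsb : ∀ x, |bonus M P Sg x| ≤ M.B := fun x => by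
    rw [abs_of_nonneg (bonus_nonneg M P Sg _)]; exact bonus_le_B M P Sg _
  have hF₂b : ∀ z, |F₂ z| ≤ c * M.B * (1 / (1 - M.γ)) := fun z => by
    simp only [F₂, abs_mul]
    rw [abs_of_nonneg (bonusCoeff_nonneg M P z.1)]
    exact mul_le_mul (mul_le_mul (hgc _) (habsb _) (abs_nonneg _) hc0) (bonusCoeff_le M P _)
      (bonusCoeff_nonneg M P _) (by positivity)
  have hF₁b : ∀ z, |F₁ z| ≤ c * (3 * M.Gmax) + c * M.B * (1 / (1 - M.γ)) := fun z => by
    have h1 : F₁ z = g (z.2 0) * truncTarget M P Sg H w j m v z + F₂ z := by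
      simp only [F₁, F₂]; ring
    rw [h1]
    refine (abs_add_le _ _).trans (add_le_add ?_ (hF₂b z))
    rw [abs_mul]
    exact mul_le_mul (hgc _) (abs_truncTarget_le hη hwin hv z) (abs_nonneg _) hc0
  have hsub : ∀ z : Rollout S A, g (z.2 0) * truncTarget M P Sg H w j m v z = F₁ z - F₂ z :=
    fun z => by simp only [F₁, F₂]; ring
  simp only [hsub]
  rw [integral_sub (integrable_of_abs_le hF₁ hF₁b) (integrable_of_abs_le hF₂ hF₂b)]
  have h2 : ∫ z, F₂ z ∂rolloutLaw M ρ π₀ = ∫ x, g x * bonus M P Sg x ∂ρ := by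
    rw [rolloutLaw]
    have := integral_prod_mul (μ := horizonLaw M) (ν := trajLaw M π₀ ρ) (bonusCoeff M P)
      (fun x => g (x 0) * bonus M P Sg (x 0))
    rw [integral_bonusCoeff, one_mul,
      integral_trajLaw_zero M π₀ ρ (f := fun x => g x * bonus M P Sg x) (hg.mul hb)] at this
    rw [← this]
    refine integral_congr_ae (Filter.Eventually.of_forall fun z => ?_)
    simp only [F₂]
    ring
  have h1 : ∫ z, F₁ z ∂rolloutLaw M ρ π₀ = ∫ x, g x * truncQ M π (bonusReward M P Sg) H x ∂ρ := by
    have hF₁' : ∀ z : Rollout S A, F₁ z = if z.1 ≤ H then g (z.2 0) *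
        ((∏ t ∈ Finset.Icc 1 z.1, tiltRatio M P Sg w j m v (z.2 t)) *
          (1 / (1 - M.γ) * bonusReward M P Sg (z.2 z.1))) else 0 := fun z => by
      simp only [F₁, truncTarget, sub_add_cancel]
      split_ifs <;> simp
    rw [integral_rolloutLaw M ρ π₀ hF₁ hF₁b (H := H) fun z hz => by
      rw [hF₁', if_neg (not_le.2 hz)]]
    simp only [truncQ, Finset.mul_sum]
    have hit := fun t => iterate_stepOp M π hbr (abs_bonusReward_le M P Sg) t
    rw [integral_finsetSum]
    · refine Finset.sum_congr rfl fun t ht => ?_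
      have htH : t ≤ H := by have := Finset.mem_range.1 ht; omega
      have hw := integral_trajLaw_weighted M π₀ π (measurable_tiltRatio (M := M) (P := P) (Sg := Sg)
        (w := w) (j := j) (m := m) v) (R := Real.exp (P.η * m * (2 * ‖v‖ + 1)))
        (fun x => by
          rw [abs_of_nonneg (tiltRatio_nonneg M P Sg w j m v x)]
          exact tiltRatio_le M P Sg w j m hη v x)
        (fun f hf c hfc => stepOp_ratio M π₀ π
          (tiltPolicy_absolutelyContinuous M P Sg w j m v) (measurable_tiltRatio v)
          (R := Real.exp (P.η * m * (2 * ‖v‖ + 1))) (fun x => by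
            rw [abs_of_nonneg (tiltRatio_nonneg M P Sg w j m v x)]
            exact tiltRatio_le M P Sg w j m hη v x) (fun s a => rfl) hf hfc)
        ρ hg hgc t hbr (abs_bonusReward_le M P Sg)
      have hL : ∀ x : ℕ → S × A, F₁ (t, x) = 1 / (1 - M.γ) *
          (g (x 0) * (∏ i ∈ Finset.Icc 1 t, tiltRatio M P Sg w j m v (x i)) *
            bonusReward M P Sg (x t)) := fun x => by
        rw [hF₁', if_pos htH]
        ring
      have hR : ∀ x, g x * (M.γ ^ t * (stepOp M π)^[t] (bonusReward M P Sg) x) =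
          M.γ ^ t * (g x * (stepOp M π)^[t] (bonusReward M P Sg) x) := fun x => by ring
      simp only [hL, hR, integral_const_mul]
      rw [hw]
      field_simp
    · intro t _
      refine integrable_of_abs_le (hg.mul ((hit t).1.const_mul _))
        (b := c * (M.γ ^ t * (1 + M.B))) fun x => ?_
      rw [abs_mul, abs_mul, abs_of_nonneg (pow_nonneg M.γ_nonneg t)]
      exact mul_le_mul (hgc x) (mul_le_mul_of_nonneg_left ((hit t).2 x)
        (pow_nonneg M.γ_nonneg t)) (mul_nonneg (pow_nonneg M.γ_nonneg t) (abs_nonneg _)) hc0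
  rw [h1, h2]
  simp only [mul_sub]
  have hq : Measurable (truncQ M π (bonusReward M P Sg) H) :=
    Finset.measurable_sum _ fun t _ =>
      (iterate_stepOp M π hbr (abs_bonusReward_le M P Sg) t).1.const_mul _
  have hqb : ∀ x, |truncQ M π (bonusReward M P Sg) H x| ≤
      ∑ t ∈ Finset.range (H + 1), M.γ ^ t * (1 + M.B) := fun x => by
    refine (Finset.abs_sum_le_sum_abs _ _).trans (Finset.sum_le_sum fun t _ => ?_)
    rw [abs_mul, abs_of_nonneg (pow_nonneg M.γ_nonneg t)]
    exact mul_le_mul_of_nonneg_left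
      ((iterate_stepOp M π hbr (abs_bonusReward_le M P Sg) t).2 x) (pow_nonneg M.γ_nonneg t)
  rw [integral_sub]
  · exact integrable_of_abs_le (hg.mul hq) fun x => by
      rw [abs_mul]
      exact mul_le_mul (hgc x) (hqb x) (abs_nonneg _) hc0
  · exact integrable_of_abs_le (hg.mul hb) fun x => by
      rw [abs_mul]
      exact mul_le_mul (hgc x) (habsb x) (abs_nonneg _) hc0

end Target

section Regression

variable {S A : Type*} [MeasurableSpace S] [Fintype A] [Nonempty A] [MeasurableSpace A]
  {d : ℕ}
  (M : FeatureMDP S A d) (P : Params) (Sg : Matrix (Fin d) (Fin d) ℝ)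

/-! ### Fast rates for the critic's regression -/

/-- The squared loss of the parameter `a` on a rollout, in excess of that of `u`; the regression
targets are the truncated ones, for the policy that is tilted by `v`. -/
noncomputable def excessLoss (H : ℕ) (w : ℕ → EuclideanSpace ℝ (Fin d)) (j m : ℕ)
    (a u v : EuclideanSpace ℝ (Fin d)) (z : Rollout S A) : ℝ :=
  (inner ℝ (M.φ (z.2 0)) a - truncTarget M P Sg H w j m v z) ^ 2 -
    (inner ℝ (M.φ (z.2 0)) u - truncTarget M P Sg H w j m v z) ^ 2

/-- The squared difference of the predictions of `a` and `u`. -/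
noncomputable def predGap (a u : EuclideanSpace ℝ (Fin d)) (x : S × A) : ℝ :=
  inner ℝ (M.φ x) (a - u) ^ 2

/-- The datasets of `n` rollouts on which the total excess loss is at most `n` times its mean, minus
`n / 2` times the mean squared prediction gap and minus `200 G_max² log (1 / p)`. The excess losses
are scaled by `-1 / (200 G_max²)`, so that they are at most `1` and their squares are at most half
of the squared prediction gap on the same scale. -/
def deviationSet (ρ : Measure (S × A)) (n H : ℕ) (w : ℕ → EuclideanSpace ℝ (Fin d)) (j m : ℕ)
    (a u v : EuclideanSpace ℝ (Fin d)) (p : ℝ) : Set (Fin n → Rollout S A) :=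
  {D | n * ∫ z, (-(1 / (200 * M.Gmax ^ 2)) * excessLoss M P Sg H w j m a u v z +
        1 / (200 * M.Gmax ^ 2) / 2 * predGap M a u (z.2 0))
          ∂rolloutLaw M ρ (innerPolicy M P Sg w j) + Real.log (1 / p) ≤
      ∑ i, -(1 / (200 * M.Gmax ^ 2)) * excessLoss M P Sg H w j m a u v (D i)}

variable {M P Sg} {H : ℕ} {w : ℕ → EuclideanSpace ℝ (Fin d)} {j m : ℕ}

theorem FeatureMDP.W_eq (M : FeatureMDP S A d) : M.W = 2 * M.Gmax := rfl

theorem abs_inner_le_W {a : EuclideanSpace ℝ (Fin d)} (ha : ‖a‖ ≤ M.W) (x : S × A) :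
    |inner ℝ (M.φ x) a| ≤ 2 * M.Gmax :=
  (abs_inner_φ_le M x a).trans ha

theorem abs_inner_sub_le {a u : EuclideanSpace ℝ (Fin d)} (ha : ‖a‖ ≤ M.W) (hu : ‖u‖ ≤ M.W)
    (x : S × A) :
    |inner ℝ (M.φ x) (a - u)| ≤ 4 * M.Gmax := by
  rw [inner_sub_right]
  refine (abs_sub _ _).trans ?_
  linarith [abs_inner_le_W ha x, abs_inner_le_W hu x]

theorem excessLoss_eq (a u v : EuclideanSpace ℝ (Fin d)) (z : Rollout S A) :
    excessLoss M P Sg H w j m a u v z = inner ℝ (M.φ (z.2 0)) (a - u) *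
      (inner ℝ (M.φ (z.2 0)) a + inner ℝ (M.φ (z.2 0)) u -
        2 * truncTarget M P Sg H w j m v z) := by
  rw [excessLoss, inner_sub_right]
  ring

theorem predGap_le {a u : EuclideanSpace ℝ (Fin d)} (ha : ‖a‖ ≤ M.W) (hu : ‖u‖ ≤ M.W) (x : S × A) :
    |predGap M a u x| ≤ (4 * M.Gmax) ^ 2 := by
  rw [predGap, abs_pow]
  exact pow_le_pow_left₀ (abs_nonneg _) (abs_inner_sub_le ha hu x) 2

theorem measurable_predGap (a u : EuclideanSpace ℝ (Fin d)) : Measurable (predGap M a u) :=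
  (M.measurable_φ.inner measurable_const).pow_const 2

section Bounds

variable (hη : 0 ≤ P.η) (hwin : P.η * m * (2 * (M.B + M.W)) * H ≤ Real.log 2)

include hη hwin

theorem abs_excessLoss_le {a u v : EuclideanSpace ℝ (Fin d)} (ha : ‖a‖ ≤ M.W) (hu : ‖u‖ ≤ M.W)
    (hv : ‖v‖ ≤ M.W)
    (z : Rollout S A) :
    |excessLoss M P Sg H w j m a u v z| ≤
      |inner ℝ (M.φ (z.2 0)) (a - u)| * (10 * M.Gmax) := by
  rw [excessLoss_eq, abs_mul]
  refine mul_le_mul_of_nonneg_left ?_ (abs_nonneg _)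
  have h1 := abs_le.1 (abs_inner_le_W ha (z.2 0))
  have h2 := abs_le.1 (abs_inner_le_W hu (z.2 0))
  have h3 := abs_le.1 (abs_truncTarget_le (Sg := Sg) (w := w) (j := j) hη hwin hv z)
  rw [abs_le]
  constructor <;> linarith

theorem abs_excessLoss_le' {a u v : EuclideanSpace ℝ (Fin d)} (ha : ‖a‖ ≤ M.W) (hu : ‖u‖ ≤ M.W)
    (hv : ‖v‖ ≤ M.W)
    (z : Rollout S A) : |excessLoss M P Sg H w j m a u v z| ≤ 40 * M.Gmax ^ 2 := by
  refine (abs_excessLoss_le hη hwin ha hu hv z).trans ?_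
  calc _ ≤ 4 * M.Gmax * (10 * M.Gmax) := mul_le_mul_of_nonneg_right (abs_inner_sub_le ha hu _)
        (by linarith [M.Gmax_pos])
    _ = _ := by ring

omit hη hwin in
theorem measurable_excessLoss_param [DiscreteMeasurableSpace A] {Y : Type*} [MeasurableSpace Y]
    {Sg : Y → Matrix (Fin d) (Fin d) ℝ} (hSg : ∀ i j, Measurable fun y => Sg y i j)
    {w : Y → ℕ → EuclideanSpace ℝ (Fin d)} (hw : ∀ i < j, Measurable fun y => w y i)
    (a u v : EuclideanSpace ℝ (Fin d)) {z : Y → Rollout S A} (hz : Measurable z) :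
    Measurable fun y => excessLoss M P (Sg y) H (w y) j m a u v (z y) := by
  have hφ : Measurable fun y => M.φ ((z y).2 0) :=
    M.measurable_φ.comp ((measurable_pi_apply 0).comp hz.snd)
  have ht := measurable_truncTarget_param (M := M) (P := P) (H := H) (m := m) hSg hw v hz
  exact (((hφ.inner measurable_const).sub ht).pow_const 2).sub
    (((hφ.inner measurable_const).sub ht).pow_const 2)

omit hη hwin in
theorem measurable_excessLoss [DiscreteMeasurableSpace A] (a u v : EuclideanSpace ℝ (Fin d)) :
    Measurable (excessLoss M P Sg H w j m a u v) :=
  measurable_excessLoss_param (Y := Rollout S A) (Sg := fun _ => Sg)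
    (fun _ _ => measurable_const) (w := fun _ => w) (fun _ _ => measurable_const) a u v
    measurable_id

theorem abs_excessLoss_sub_le {ε : ℝ} (hε0 : 0 ≤ ε) (hε : ε ≤ 1)
    {a u v a' u' v' : EuclideanSpace ℝ (Fin d)}
    (ha : ‖a‖ ≤ M.W) (hu : ‖u‖ ≤ M.W) (hv : ‖v‖ ≤ M.W)
    (ha' : ‖a'‖ ≤ M.W) (hu' : ‖u'‖ ≤ M.W) (hv' : ‖v'‖ ≤ M.W)
    (haa : ‖a - a'‖ ≤ M.W * ε) (huu : ‖u - u'‖ ≤ M.W * ε) (hvv : ‖v - v'‖ ≤ M.W * ε)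
    (z : Rollout S A) :
    |excessLoss M P Sg H w j m a u v z - excessLoss M P Sg H w j m a' u' v' z| ≤
      88 * M.Gmax ^ 2 * ε := by
  have hG := M.Gmax_pos
  have hy := abs_truncTarget_sub_le (Sg := Sg) (w := w) (j := j) hη hwin hε0 hε hv hv' hvv z
  have hyb := abs_le.1 (abs_truncTarget_le (Sg := Sg) (w := w) (j := j) hη hwin hv z)
  have h1 := (abs_inner_φ_le M (z.2 0) (a - a')).trans haa
  have h2 := (abs_inner_φ_le M (z.2 0) (u - u')).trans huu
  have h3 := abs_le.1 (abs_inner_le_W ha (z.2 0))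
  have h4 := abs_le.1 (abs_inner_le_W hu (z.2 0))
  have h5 := abs_inner_sub_le ha' hu' (z.2 0)
  rw [excessLoss_eq, excessLoss_eq]
  rw [inner_sub_right] at h1 h2 h5 ⊢
  rw [inner_sub_right]
  rw [M.W_eq] at h1 h2
  set y := truncTarget M P Sg H w j m v z
  set y' := truncTarget M P Sg H w j m v' z
  set A₁ : ℝ := inner ℝ (M.φ (z.2 0)) a
  set A₂ : ℝ := inner ℝ (M.φ (z.2 0)) u
  set A₁' : ℝ := inner ℝ (M.φ (z.2 0)) a'
  set A₂' : ℝ := inner ℝ (M.φ (z.2 0)) u'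
  have e : (A₁ - A₂) * (A₁ + A₂ - 2 * y) - (A₁' - A₂') * (A₁' + A₂' - 2 * y') =
      ((A₁ - A₁') - (A₂ - A₂')) * (A₁ + A₂ - 2 * y) +
        (A₁' - A₂') * ((A₁ - A₁') + (A₂ - A₂') - 2 * (y - y')) := by ring
  have b1 : |(A₁ - A₁') - (A₂ - A₂')| ≤ 4 * M.Gmax * ε := by
    refine (abs_sub _ _).trans ?_
    linarith
  have b2 : |A₁ + A₂ - 2 * y| ≤ 10 * M.Gmax := by rw [abs_le]; constructor <;> linarith
  have b3 : |(A₁ - A₁') + (A₂ - A₂') - 2 * (y - y')| ≤ 12 * M.Gmax * ε := by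
    have := abs_le.1 h1
    have := abs_le.1 h2
    have := abs_le.1 hy
    rw [abs_le]; constructor <;> linarith
  rw [e]
  calc _ ≤ |(A₁ - A₁') - (A₂ - A₂')| * |A₁ + A₂ - 2 * y| +
        |A₁' - A₂'| * |(A₁ - A₁') + (A₂ - A₂') - 2 * (y - y')| := by
        rw [← abs_mul, ← abs_mul]; exact abs_add_le _ _
    _ ≤ 4 * M.Gmax * ε * (10 * M.Gmax) + 4 * M.Gmax * (12 * M.Gmax * ε) := by gcongr
    _ = _ := by ring

omit hη hwin in
theorem abs_predGap_sub_le {ε : ℝ} {a u a' u' : EuclideanSpace ℝ (Fin d)}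
    (ha : ‖a‖ ≤ M.W) (hu : ‖u‖ ≤ M.W) (ha' : ‖a'‖ ≤ M.W) (hu' : ‖u'‖ ≤ M.W)
    (haa : ‖a - a'‖ ≤ M.W * ε) (huu : ‖u - u'‖ ≤ M.W * ε) (x : S × A) :
    |predGap M a u x - predGap M a' u' x| ≤ 32 * M.Gmax ^ 2 * ε := by
  have hG := M.Gmax_pos
  have hε0 : 0 ≤ M.W * ε := (norm_nonneg _).trans haa
  have h1 := (abs_inner_φ_le M x (a - a')).trans haa
  have h2 := (abs_inner_φ_le M x (u - u')).trans huu
  have h4 := abs_inner_sub_le ha hu x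
  have h5 := abs_inner_sub_le ha' hu' x
  have e : predGap M a u x - predGap M a' u' x =
      (inner ℝ (M.φ x) (a - a') - inner ℝ (M.φ x) (u - u')) *
        (inner ℝ (M.φ x) (a - u) + inner ℝ (M.φ x) (a' - u')) := by
    simp only [predGap, inner_sub_right]
    ring
  rw [e, abs_mul]
  calc _ ≤ (M.W * ε + M.W * ε) * (4 * M.Gmax + 4 * M.Gmax) :=
        mul_le_mul ((abs_sub _ _).trans (add_le_add h1 h2))
          ((abs_add_le _ _).trans (add_le_add h4 h5)) (abs_nonneg _) (by linarith)
    _ = _ := by rw [M.W_eq]; ring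

variable [DiscreteMeasurableSpace A]

/-- Bernstein's inequality for the excess loss, whose variance is controlled by the
prediction gap. -/
theorem measure_deviationSet_le (ρ : Measure (S × A)) [IsProbabilityMeasure ρ] {n : ℕ}
    {a u v : EuclideanSpace ℝ (Fin d)} (ha : ‖a‖ ≤ M.W) (hu : ‖u‖ ≤ M.W) (hv : ‖v‖ ≤ M.W)
    {p : ℝ} (hp : 0 < p) :
    Measure.pi (fun _ : Fin n => rolloutLaw M ρ (innerPolicy M P Sg w j))
      (deviationSet M P Sg ρ n H w j m a u v p) ≤ ENNReal.ofReal p := by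
  have hG := M.Gmax_pos
  set s := 1 / (200 * M.Gmax ^ 2) with hs
  have hs0 : 0 < s := by positivity
  have hsG : s * (200 * M.Gmax ^ 2) = 1 := by rw [hs]; field_simp
  have hgb : ∀ z, |-s * excessLoss M P Sg H w j m a u v z| ≤ 1 := fun z => by
    rw [abs_mul, abs_neg, abs_of_pos hs0]
    have := abs_excessLoss_le' (Sg := Sg) (w := w) (j := j) hη hwin ha hu hv z
    calc _ ≤ s * (40 * M.Gmax ^ 2) := by gcongr
      _ ≤ s * (200 * M.Gmax ^ 2) := by gcongr; norm_num
      _ = 1 := hsG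
  have hz0 : Measurable fun z : Rollout S A => z.2 0 :=
    (measurable_pi_apply 0).comp measurable_snd
  refine measure_pi_bernstein_le (rolloutLaw M ρ (innerPolicy M P Sg w j))
    (g := fun z => -s * excessLoss M P Sg H w j m a u v z)
    (h := fun z => s / 2 * predGap M a u (z.2 0))
    ((measurable_excessLoss a u v).const_mul _) (fun z => (abs_le.1 (hgb z)).2) hgb
    ((integrable_of_abs_le ((measurable_predGap a u).comp hz0)
      fun z => predGap_le ha hu _).const_mul _) (fun z => ?_) hp
  have h1 := abs_excessLoss_le (Sg := Sg) (w := w) (j := j) hη hwin ha hu hv z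
  have h2 : excessLoss M P Sg H w j m a u v z ^ 2 ≤
      predGap M a u (z.2 0) * (100 * M.Gmax ^ 2) := by
    calc _ = |excessLoss M P Sg H w j m a u v z| ^ 2 := (sq_abs _).symm
      _ ≤ (|inner ℝ (M.φ (z.2 0)) (a - u)| * (10 * M.Gmax)) ^ 2 := by gcongr
      _ = _ := by rw [mul_pow, sq_abs, predGap]; ring
  calc (-s * excessLoss M P Sg H w j m a u v z) ^ 2
      = s ^ 2 * excessLoss M P Sg H w j m a u v z ^ 2 := by ring
    _ ≤ s ^ 2 * (predGap M a u (z.2 0) * (100 * M.Gmax ^ 2)) := by gcongr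
    _ = s / 2 * predGap M a u (z.2 0) * (s * (200 * M.Gmax ^ 2)) := by ring
    _ = _ := by rw [hsG, mul_one]

end Bounds

theorem integral_rolloutLaw_first (ρ : Measure (S × A)) [IsProbabilityMeasure ρ] (π : Policy S A)
    {f : S × A → ℝ} (hf : Measurable f) :
    ∫ z, f (z.2 0) ∂rolloutLaw M ρ π = ∫ x, f x ∂ρ := by
  rw [rolloutLaw, ← integral_trajLaw_zero M π ρ hf]
  have := integral_prod_mul (μ := horizonLaw M) (ν := trajLaw M π ρ) (fun _ => 1)
    (fun x => f (x 0))
  simpa using this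

/-- First-order optimality of a minimizer of the squared loss over a ball. -/
theorem IsBallArgmin.integral_nonneg {ρ : Measure (S × A)} [IsProbabilityMeasure ρ]
    {f : S × A → ℝ} (hf : Measurable f) {c : ℝ} (hfc : ∀ x, |f x| ≤ c) {R : ℝ}
    {u a : EuclideanSpace ℝ (Fin d)}
    (hu : IsBallArgmin (popLoss M ρ f) R u) (ha : ‖a‖ ≤ R) :
    0 ≤ ∫ x, inner ℝ (M.φ x) (a - u) * (inner ℝ (M.φ x) u - f x) ∂ρ := by
  have hmi : ∀ v : EuclideanSpace ℝ (Fin d), Measurable fun x => inner ℝ (M.φ x) v := fun v =>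
    M.measurable_φ.inner measurable_const
  have hc0 : 0 ≤ c := (abs_nonneg _).trans (hfc (Classical.choice ρ.nonempty_of_neZero))
  set I := ∫ x, inner ℝ (M.φ x) (a - u) * (inner ℝ (M.φ x) u - f x) ∂ρ with hI
  set J := ∫ x, inner ℝ (M.φ x) (a - u) ^ 2 ∂ρ with hJ
  have hres : ∀ x, |inner ℝ (M.φ x) u - f x| ≤ ‖u‖ + c := fun x =>
    (abs_sub _ _).trans (add_le_add (abs_inner_φ_le M x u) (hfc x))
  have i1 : Integrable (fun x => (inner ℝ (M.φ x) u - f x) ^ 2) ρ :=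
    integrable_of_abs_le (((hmi u).sub hf).pow_const 2) (b := (‖u‖ + c) ^ 2) fun x => by
      rw [abs_pow]; exact pow_le_pow_left₀ (abs_nonneg _) (hres x) 2
  have i2 : Integrable (fun x => inner ℝ (M.φ x) (a - u) * (inner ℝ (M.φ x) u - f x)) ρ :=
    integrable_of_abs_le ((hmi (a - u)).mul ((hmi u).sub hf)) (b := ‖a - u‖ * (‖u‖ + c)) fun x => by
      rw [abs_mul]
      exact mul_le_mul (abs_inner_φ_le M x _) (hres x) (abs_nonneg _) (norm_nonneg _)
  have i3 : Integrable (fun x => inner ℝ (M.φ x) (a - u) ^ 2) ρ :=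
    integrable_of_abs_le ((hmi (a - u)).pow_const 2) (b := ‖a - u‖ ^ 2) fun x => by
      rw [abs_pow]; exact pow_le_pow_left₀ (abs_nonneg _) (abs_inner_φ_le M x _) 2
  have key : ∀ t : ℝ, 0 ≤ t → t ≤ 1 → 0 ≤ t * I + t ^ 2 / 2 * J := by
    intro t ht0 ht1
    have hball : ‖u + t • (a - u)‖ ≤ R := by
      have h1 : u + t • (a - u) = (1 - t) • u + t • a := by
        rw [sub_smul, one_smul, smul_sub]; abel
      rw [h1]
      refine (norm_add_le _ _).trans ?_
      rw [norm_smul, norm_smul, Real.norm_of_nonneg ht0, Real.norm_of_nonneg (by linarith)]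
      nlinarith [hu.1]
    have h2 := hu.2 _ hball
    have h3 : ∀ x, (inner ℝ (M.φ x) (u + t • (a - u)) - f x) ^ 2 =
        (inner ℝ (M.φ x) u - f x) ^ 2 + (2 * t * (inner ℝ (M.φ x) (a - u) *
          (inner ℝ (M.φ x) u - f x)) + t ^ 2 * inner ℝ (M.φ x) (a - u) ^ 2) := fun x => by
      rw [inner_add_right, inner_smul_right]; ring
    simp only [popLoss, h3] at h2
    rw [integral_add i1 (by exact (i2.const_mul _).add (i3.const_mul _)),
      integral_add (i2.const_mul _) (i3.const_mul _), integral_const_mul, integral_const_mul,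
      ← hI, ← hJ] at h2
    linarith
  have hJ0 : 0 ≤ J := MeasureTheory.integral_nonneg fun x => sq_nonneg _
  by_contra! hneg
  -- a step length at which the quadratic term does not make up for the linear one
  set t := min 1 (-I / (J + 1)) with ht
  have ht0 : 0 < t := lt_min one_pos (div_pos (by linarith) (by linarith))
  have h1 := key t ht0.le (min_le_left _ _)
  have h2 : t * (J + 1) ≤ -I := by
    have := min_le_right 1 (-I / (J + 1))
    rwa [← ht, le_div_iff₀ (by linarith)] at this
  nlinarith

variable [DiscreteMeasurableSpace A]

/-- The mean excess loss of `a` over the best parameter is at least the mean squared prediction gap,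
up to the effect of the truncation. -/
theorem integral_excessLoss_ge (hη : 0 ≤ P.η)
    (hwin : P.η * m * (2 * (M.B + M.W)) * H ≤ Real.log 2) (ρ : Measure (S × A))
    [IsProbabilityMeasure ρ] {a u v : EuclideanSpace ℝ (Fin d)} (ha : ‖a‖ ≤ M.W) (hv : ‖v‖ ≤ M.W)
    (hu : IsBallArgmin (popLoss M ρ fun x => qValue M (tiltPolicy M P Sg w j m v)
      (bonusReward M P Sg) x - bonus M P Sg x) M.W u) :
    ∫ x, predGap M a u x ∂ρ - 8 * M.Gmax ^ 2 * M.γ ^ (H + 1) ≤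
      ∫ z, excessLoss M P Sg H w j m a u v z ∂rolloutLaw M ρ (innerPolicy M P Sg w j) := by
  have hG := M.Gmax_pos
  have hγ := M.one_sub_γ_pos
  set π₀ := innerPolicy M P Sg w j
  set π := tiltPolicy M P Sg w j m v
  set q := qValue M π (bonusReward M P Sg) with hq
  set q' := truncQ M π (bonusReward M P Sg) H with hq'
  have hbr := measurable_bonusReward (M := M) (P := P) (Sg := Sg)
  have hbrb := abs_bonusReward_le M P Sg
  have hb := measurable_bonus (M := M) (P := P) (Sg := Sg)
  have habsb : ∀ x, |bonus M P Sg x| ≤ M.B := fun x => by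
    rw [abs_of_nonneg (bonus_nonneg M P Sg _)]; exact bonus_le_B M P Sg _
  have hmq : Measurable q := measurable_qValue M π hbr hbrb
  have hqb : ∀ x, |q x| ≤ (1 + M.B) / (1 - M.γ) := abs_qValue_le M π hbr hbrb
  have hmq' : Measurable q' := Finset.measurable_sum _ fun t _ =>
      (iterate_stepOp M π hbr hbrb t).1.const_mul _
  have hqq : ∀ x, |q x - q' x| ≤ M.γ ^ (H + 1) * M.Gmax := fun x =>
    (abs_qValue_sub_truncQ_le M π hbr hbrb H x).trans (by
      refine mul_le_mul_of_nonneg_left ?_ (pow_nonneg M.γ_nonneg _)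
      rw [FeatureMDP.Gmax]
      gcongr
      linarith)
  have hmi : ∀ v : EuclideanSpace ℝ (Fin d), Measurable fun x => inner ℝ (M.φ x) v := fun v =>
    M.measurable_φ.inner measurable_const
  have hfirst : Measurable fun z : Rollout S A => z.2 0 :=
    (measurable_pi_apply 0).comp measurable_snd
  have hopt : 0 ≤ ∫ x, inner ℝ (M.φ x) (a - u) *
      (inner ℝ (M.φ x) u - (q x - bonus M P Sg x)) ∂ρ :=
    hu.integral_nonneg (hmq.sub hb) (c := (1 + M.B) / (1 - M.γ) + M.B)
      (fun x => (abs_sub _ _).trans (add_le_add (hqb x) (habsb x))) ha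
  have hsplit : ∀ z, excessLoss M P Sg H w j m a u v z =
      (inner ℝ (M.φ (z.2 0)) (a - u) * (inner ℝ (M.φ (z.2 0)) a + inner ℝ (M.φ (z.2 0)) u)) -
        2 * (inner ℝ (M.φ (z.2 0)) (a - u) * truncTarget M P Sg H w j m v z) := fun z => by
    rw [excessLoss_eq]; ring
  have j1 : Measurable fun x =>
      inner ℝ (M.φ x) (a - u) * (inner ℝ (M.φ x) a + inner ℝ (M.φ x) u) :=
    (hmi _).mul ((hmi _).add (hmi _))
  have j1b : ∀ x, |inner ℝ (M.φ x) (a - u) * (inner ℝ (M.φ x) a + inner ℝ (M.φ x) u)| ≤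
      4 * M.Gmax * (4 * M.Gmax) := fun x => by
    rw [abs_mul]
    refine mul_le_mul (abs_inner_sub_le ha hu.1 x) ((abs_add_le _ _).trans ?_) (abs_nonneg _)
      (by linarith)
    linarith [abs_inner_le_W ha x, abs_inner_le_W hu.1 x]
  have j2 : Measurable fun z =>
      inner ℝ (M.φ (z.2 0)) (a - u) * truncTarget M P Sg H w j m v z :=
    ((hmi _).comp hfirst).mul (measurable_truncTarget v)
  have j2b : ∀ z, |inner ℝ (M.φ (z.2 0)) (a - u) * truncTarget M P Sg H w j m v z| ≤
      4 * M.Gmax * (3 * M.Gmax) := fun z => by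
    rw [abs_mul]
    exact mul_le_mul (abs_inner_sub_le ha hu.1 _) (abs_truncTarget_le hη hwin hv z) (abs_nonneg _)
      (by linarith)
  have k0 : ∀ x, |q x - bonus M P Sg x| ≤ (1 + M.B) / (1 - M.γ) + M.B := fun x =>
    (abs_sub _ _).trans (add_le_add (hqb x) (habsb x))
  have hE : ∫ z, excessLoss M P Sg H w j m a u v z ∂rolloutLaw M ρ π₀ =
      ∫ x, inner ℝ (M.φ x) (a - u) * (inner ℝ (M.φ x) a + inner ℝ (M.φ x) u) ∂ρ -
        2 * ∫ x, inner ℝ (M.φ x) (a - u) * (q' x - bonus M P Sg x) ∂ρ := by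
    have s1 : Integrable (fun z : Rollout S A => inner ℝ (M.φ (z.2 0)) (a - u) *
        (inner ℝ (M.φ (z.2 0)) a + inner ℝ (M.φ (z.2 0)) u)) (rolloutLaw M ρ π₀) :=
      integrable_of_abs_le (j1.comp hfirst) fun z => j1b _
    simp only [hsplit]
    rw [integral_sub s1 ((integrable_of_abs_le j2 j2b).const_mul _), integral_const_mul,
      integral_mul_truncTarget hη hwin ρ hv (hmi (a - u))
        (fun x => abs_inner_sub_le ha hu.1 x), integral_rolloutLaw_first ρ π₀ j1]
  have l1 : Integrable (predGap M a u) ρ :=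
    integrable_of_abs_le (measurable_predGap a u) (predGap_le ha hu.1)
  have l2m : Measurable fun x => inner ℝ (M.φ x) (a - u) *
      (inner ℝ (M.φ x) u - (q x - bonus M P Sg x)) := (hmi _).mul ((hmi _).sub (hmq.sub hb))
  have l2 : Integrable (fun x => inner ℝ (M.φ x) (a - u) *
      (inner ℝ (M.φ x) u - (q x - bonus M P Sg x))) ρ :=
    integrable_of_abs_le l2m (b := 4 * M.Gmax * (2 * M.Gmax + ((1 + M.B) / (1 - M.γ) + M.B)))
      fun x => by
        rw [abs_mul]
        exact mul_le_mul (abs_inner_sub_le ha hu.1 x) ((abs_sub _ _).trans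
          (add_le_add (abs_inner_le_W hu.1 x) (k0 x))) (abs_nonneg _) (by linarith)
  have l3b : ∀ x, |inner ℝ (M.φ x) (a - u) * (q x - q' x)| ≤
      4 * M.Gmax * (M.γ ^ (H + 1) * M.Gmax) := fun x => by
    rw [abs_mul]
    exact mul_le_mul (abs_inner_sub_le ha hu.1 x) (hqq x) (abs_nonneg _) (by linarith)
  have l3 : Integrable (fun x => inner ℝ (M.φ x) (a - u) * (q x - q' x)) ρ :=
    integrable_of_abs_le ((hmi _).mul (hmq.sub hmq')) l3b
  have l4 : Integrable (fun x => inner ℝ (M.φ x) (a - u) * (q' x - bonus M P Sg x)) ρ := by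
    have := ((integrable_of_abs_le ((hmi (a - u)).mul (hmq.sub hb))
      (b := 4 * M.Gmax * ((1 + M.B) / (1 - M.γ) + M.B)) fun x => by
        rw [abs_mul]
        exact mul_le_mul (abs_inner_sub_le ha hu.1 x) (k0 x) (abs_nonneg _)
          (by linarith) : Integrable
            (fun x => inner ℝ (M.φ x) (a - u) * (q x - bonus M P Sg x)) ρ)).sub l3
    refine this.congr (Filter.Eventually.of_forall fun x => ?_)
    simp only [Pi.sub_apply]
    ring
  have l5 : Integrable (fun x => inner ℝ (M.φ x) (a - u) *
      (inner ℝ (M.φ x) a + inner ℝ (M.φ x) u)) ρ := integrable_of_abs_le j1 j1b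
  have hident : ∫ z, excessLoss M P Sg H w j m a u v z ∂rolloutLaw M ρ π₀ =
      ∫ x, predGap M a u x ∂ρ + 2 * ∫ x, inner ℝ (M.φ x) (a - u) *
        (inner ℝ (M.φ x) u - (q x - bonus M P Sg x)) ∂ρ +
        2 * ∫ x, inner ℝ (M.φ x) (a - u) * (q x - q' x) ∂ρ := by
    rw [hE, ← integral_const_mul, ← integral_const_mul, ← integral_const_mul,
      ← integral_sub l5 (l4.const_mul _), ← integral_add l1 (l2.const_mul _),
      ← integral_add (by exact l1.add (l2.const_mul _)) (l3.const_mul _)]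
    refine integral_congr_ae (Filter.Eventually.of_forall fun x => ?_)
    simp only [predGap, inner_sub_right]
    ring
  have htail : |∫ x, inner ℝ (M.φ x) (a - u) * (q x - q' x) ∂ρ| ≤
      4 * M.Gmax * (M.γ ^ (H + 1) * M.Gmax) := by
    have := norm_integral_le_of_norm_le_const (μ := ρ)
      (Filter.Eventually.of_forall fun x => (Real.norm_eq_abs _).trans_le (l3b x))
    simpa using this
  rw [hident]
  linarith [(abs_le.1 htail).1]

theorem exists_net_ball_W {ε : ℝ} {Net : Finset (EuclideanSpace ℝ (Fin d))}
    (hball : ∀ c ∈ Net, ‖c‖ ≤ 1)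
    (hnet : ∀ x : EuclideanSpace ℝ (Fin d), ‖x‖ ≤ 1 → ∃ c ∈ Net, ‖x - c‖ ≤ ε)
    {x : EuclideanSpace ℝ (Fin d)} (hx : ‖x‖ ≤ M.W) :
    ∃ c ∈ Net, ‖M.W • c‖ ≤ M.W ∧ ‖x - M.W • c‖ ≤ M.W * ε := by
  have hW : 0 < M.W := by rw [M.W_eq]; linarith [M.Gmax_pos]
  obtain ⟨c, hc, hxc⟩ := hnet (M.W⁻¹ • x) (by
    rw [norm_smul, norm_inv, Real.norm_of_nonneg hW.le, inv_mul_le_iff₀ hW, mul_one]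
    exact hx)
  refine ⟨c, hc, ?_, ?_⟩
  · rw [norm_smul, Real.norm_of_nonneg hW.le]
    exact mul_le_of_le_one_right hW.le (hball c hc)
  · have : x - M.W • c = M.W • (M.W⁻¹ • x - c) := by
      rw [smul_sub, smul_smul, mul_inv_cancel₀ hW.ne', one_smul]
    rw [this, norm_smul, Real.norm_of_nonneg hW.le]
    exact mul_le_mul_of_nonneg_left hxc hW.le

theorem abs_integral_sub_le_of_abs_sub_le {X : Type*} [MeasurableSpace X] {μ : Measure X}
    [IsProbabilityMeasure μ] {f g : X → ℝ} (hf : Integrable f μ) (hg : Integrable g μ) {b : ℝ}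
    (h : ∀ x, |f x - g x| ≤ b) : |∫ x, f x ∂μ - ∫ x, g x ∂μ| ≤ b := by
  rw [← integral_sub hf hg]
  have := norm_integral_le_of_norm_le_const (μ := μ) (f := fun x => f x - g x) (C := b)
    (Filter.Eventually.of_forall fun x => h x)
  simpa using this

/-- The regression error on a dataset of short rollouts without large deviations at the points of a
net: the net points next to the empirical minimizer `a`, the best parameter `u` and the tilt `v`
transfer the deviation bound to `(a, u, v)`, where the empirical excess loss is not positive. -/
theorem integral_predGap_le (hη : 0 ≤ P.η)
    (hwin : P.η * m * (2 * (M.B + M.W)) * H ≤ Real.log 2) (ρ : Measure (S × A))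
    [IsProbabilityMeasure ρ] {n : ℕ} {ε : ℝ} (hε0 : 0 ≤ ε) (hε : ε ≤ 1) (hnε : n * ε ≤ 1)
    (hnγ : n * M.γ ^ (H + 1) ≤ 1) {Net : Finset (EuclideanSpace ℝ (Fin d))}
    (hball : ∀ c ∈ Net, ‖c‖ ≤ 1)
    (hnet : ∀ x : EuclideanSpace ℝ (Fin d), ‖x‖ ≤ 1 → ∃ c ∈ Net, ‖x - c‖ ≤ ε) {p : ℝ}
    {D : Fin n → Rollout S A} (hD : ∀ i, (D i).1 ≤ H)
    (hdev : ∀ a ∈ Net, ∀ u ∈ Net, ∀ v ∈ Net,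
      D ∉ deviationSet M P Sg ρ n H w j m (M.W • a) (M.W • u) (M.W • v) p)
    {a u v : EuclideanSpace ℝ (Fin d)} (hv : ‖v‖ ≤ M.W)
    (ha : IsBallArgmin (empLoss M P (bonus M P Sg) (innerPolicy M P Sg w j)
      (tiltPolicy M P Sg w j m v) D) M.W a)
    (hu : IsBallArgmin (popLoss M ρ fun x => qValue M (tiltPolicy M P Sg w j m v)
      (bonusReward M P Sg) x - bonus M P Sg x) M.W u) :
    n * ∫ x, predGap M a u x ∂ρ ≤ 400 * M.Gmax ^ 2 * (Real.log (1 / p) + 1) := by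
  have hG := M.Gmax_pos
  obtain ⟨a₀, ha₀, ha₀W, haa⟩ := exists_net_ball_W (M := M) hball hnet ha.1
  obtain ⟨u₀, hu₀, hu₀W, huu⟩ := exists_net_ball_W (M := M) hball hnet hu.1
  obtain ⟨v₀, hv₀, hv₀W, hvv⟩ := exists_net_ball_W (M := M) hball hnet hv
  have hz0 : Measurable fun z : Rollout S A => z.2 0 :=
    (measurable_pi_apply 0).comp measurable_snd
  set π₀ := innerPolicy M P Sg w j
  have hE := abs_excessLoss_sub_le (Sg := Sg) (w := w) (j := j) hη hwin hε0 hε ha.1 hu.1 hv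
    ha₀W hu₀W hv₀W haa huu hvv
  have hGp := abs_predGap_sub_le ha.1 hu.1 ha₀W hu₀W haa huu
  have iE : ∀ {a u v : EuclideanSpace ℝ (Fin d)}, ‖a‖ ≤ M.W → ‖u‖ ≤ M.W → ‖v‖ ≤ M.W →
      Integrable (excessLoss M P Sg H w j m a u v) (rolloutLaw M ρ π₀) := fun ha hu hv =>
    integrable_of_abs_le (measurable_excessLoss _ _ _) (abs_excessLoss_le' hη hwin ha hu hv)
  have iG : ∀ {a u : EuclideanSpace ℝ (Fin d)}, ‖a‖ ≤ M.W → ‖u‖ ≤ M.W →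
      Integrable (predGap M a u) ρ := fun ha hu =>
    integrable_of_abs_le (measurable_predGap _ _) (predGap_le ha hu)
  -- the empirical excess loss at the actual parameters and at the net points
  have hemp : ∑ i, excessLoss M P Sg H w j m a u v (D i) ≤ 0 := by
    have h1 := ha.2 u hu.1
    simp only [empLoss] at h1
    simp only [excessLoss, Finset.sum_sub_distrib]
    have h2 := fun i => target_eq_truncTarget M P Sg w j m H v (hD i)
    simp only [π₀] at h1
    simp only [h2] at h1
    linarith
  have hemp₀ : ∑ i, excessLoss M P Sg H w j m (M.W • a₀) (M.W • u₀) (M.W • v₀) (D i) ≤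
      88 * M.Gmax ^ 2 := by
    calc _ ≤ ∑ i, (excessLoss M P Sg H w j m a u v (D i) + 88 * M.Gmax ^ 2 * ε) :=
          Finset.sum_le_sum fun i _ => by linarith [(abs_le.1 (hE (D i))).1]
      _ ≤ n * (88 * M.Gmax ^ 2 * ε) := by
          rw [Finset.sum_add_distrib]
          simp only [Finset.sum_const, Finset.card_univ, Fintype.card_fin, nsmul_eq_mul]
          linarith
      _ = 88 * M.Gmax ^ 2 * (n * ε) := by ring
      _ ≤ 88 * M.Gmax ^ 2 := mul_le_of_le_one_right (by positivity) hnε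
  have hpopE := (abs_le.1 (abs_integral_sub_le_of_abs_sub_le (iE ha.1 hu.1 hv)
    (iE ha₀W hu₀W hv₀W) hE)).2
  have hpopG := (abs_le.1 (abs_integral_sub_le_of_abs_sub_le (iG ha.1 hu.1)
    (iG ha₀W hu₀W) hGp)).1
  have hge := integral_excessLoss_ge (w := w) (j := j) hη hwin ρ ha.1 hv hu
  have hd := hdev a₀ ha₀ u₀ hu₀ v₀ hv₀
  have iG' : Integrable (fun z : Rollout S A => predGap M (M.W • a₀) (M.W • u₀) (z.2 0))
      (rolloutLaw M ρ π₀) :=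
    integrable_of_abs_le ((measurable_predGap _ _).comp hz0) fun z => predGap_le ha₀W hu₀W _
  simp only [deviationSet, Set.mem_ofPred_eq, not_le] at hd
  rw [← Finset.mul_sum, integral_add ((iE ha₀W hu₀W hv₀W).const_mul _) (iG'.const_mul _),
    integral_const_mul, integral_const_mul,
    integral_rolloutLaw_first ρ π₀ (measurable_predGap _ _)] at hd
  set s := 1 / (200 * M.Gmax ^ 2) with hs
  have hs0 : 0 < s := by positivity
  have hsG : s * (200 * M.Gmax ^ 2) = 1 := by rw [hs]; field_simp
  set E₀ := ∫ z, excessLoss M P Sg H w j m (M.W • a₀) (M.W • u₀) (M.W • v₀) z ∂rolloutLaw M ρ π₀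
  set G₀ := ∫ x, predGap M (M.W • a₀) (M.W • u₀) x ∂ρ
  set E₁ := ∫ z, excessLoss M P Sg H w j m a u v z ∂rolloutLaw M ρ π₀
  set G₁ := ∫ x, predGap M a u x ∂ρ
  set T := ∑ i, excessLoss M P Sg H w j m (M.W • a₀) (M.W • u₀) (M.W • v₀) (D i)
  set Λ := Real.log (1 / p)
  have hd' : n * E₀ - n * G₀ / 2 < T + 200 * M.Gmax ^ 2 * Λ := by
    have h1 : 0 < s * (T + 200 * M.Gmax ^ 2 * Λ - (n * E₀ - n * G₀ / 2)) := by
      have : s * (T + 200 * M.Gmax ^ 2 * Λ - (n * E₀ - n * G₀ / 2)) =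
          s * T + (s * (200 * M.Gmax ^ 2)) * Λ - s * (n * E₀ - n * G₀ / 2) := by ring
      rw [this, hsG]
      linarith
    have := pos_of_mul_pos_right h1 hs0.le
    linarith
  have hn0 : (0 : ℝ) ≤ n := Nat.cast_nonneg n
  have e1 : n * E₁ ≤ n * E₀ + 88 * M.Gmax ^ 2 := by
    calc n * E₁ ≤ n * (E₀ + 88 * M.Gmax ^ 2 * ε) := by gcongr; linarith
      _ = n * E₀ + 88 * M.Gmax ^ 2 * (n * ε) := by ring
      _ ≤ _ := add_le_add le_rfl (mul_le_of_le_one_right (by positivity) hnε)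
  have e2 : n * G₀ ≤ n * G₁ + 32 * M.Gmax ^ 2 := by
    calc n * G₀ ≤ n * (G₁ + 32 * M.Gmax ^ 2 * ε) := by gcongr; linarith
      _ = n * G₁ + 32 * M.Gmax ^ 2 * (n * ε) := by ring
      _ ≤ _ := add_le_add le_rfl (mul_le_of_le_one_right (by positivity) hnε)
  have e3 : n * G₁ ≤ n * E₁ + 8 * M.Gmax ^ 2 := by
    calc n * G₁ ≤ n * (E₁ + 8 * M.Gmax ^ 2 * M.γ ^ (H + 1)) := by gcongr; linarith
      _ = n * E₁ + 8 * M.Gmax ^ 2 * (n * M.γ ^ (H + 1)) := by ring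
      _ ≤ _ := add_le_add le_rfl (mul_le_of_le_one_right (by positivity) hnγ)
  linarith

end Regression

section Transcript

variable {S A : Type*} [MeasurableSpace S] [Fintype A] [MeasurableSpace A] {d : ℕ}
  (M : FeatureMDP S A d) (P : Params)

/-! ### Switching times and policy covers as functions of the history -/

theorem lastSwitch_le (X : Transcript S A d) (n : ℕ) : lastSwitch M P X n ≤ n := by
  induction n with
  | zero => simp [lastSwitch]
  | succ n ih => rw [lastSwitch]; split_ifs <;> omega

theorem one_le_lastSwitch (X : Transcript S A d) {n : ℕ} (hn : 1 ≤ n) :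
    1 ≤ lastSwitch M P X n := by
  induction n with
  | zero => omega
  | succ n ih =>
    rw [lastSwitch]
    split_ifs with h
    · omega
    · exact ih (by omega)

theorem lastSwitch_lastSwitch (X : Transcript S A d) (n : ℕ) :
    lastSwitch M P X (lastSwitch M P X n) = lastSwitch M P X n := by
  induction n with
  | zero => simp [lastSwitch]
  | succ n ih =>
    by_cases h : n = 0 ∨ 2 * (covMat M P X (lastSwitch M P X n)).det < (covMat M P X (n + 1)).det
    · have h1 : lastSwitch M P X (n + 1) = n + 1 := by rw [lastSwitch, if_pos h]
      rw [h1, h1]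
    · have h1 : lastSwitch M P X (n + 1) = lastSwitch M P X n := by rw [lastSwitch, if_neg h]
      rw [h1, ih]

theorem lastCollect_le (k : ℕ) : lastCollect M P k ≤ k := by
  induction k with
  | zero => simp [lastCollect]
  | succ k ih => rw [lastCollect]; split_ifs <;> omega

theorem lastCollect_lastCollect (k : ℕ) :
    lastCollect M P (lastCollect M P k) = lastCollect M P k := by
  induction k with
  | zero => simp [lastCollect]
  | succ k ih =>
    by_cases h : kappa M P < ((k + 1 : ℕ) : ℝ) - lastCollect M P k
    · have h1 : lastCollect M P (k + 1) = k + 1 := by rw [lastCollect, if_pos h]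
      rw [h1, h1]
    · have h1 : lastCollect M P (k + 1) = lastCollect M P k := by rw [lastCollect, if_neg h]
      rw [h1, ih]

theorem sub_lastCollect_le (hκ : 0 ≤ kappa M P) (k : ℕ) :
    (k : ℝ) - lastCollect M P k ≤ kappa M P := by
  cases k with
  | zero => simpa [lastCollect] using hκ
  | succ k =>
    rw [lastCollect]
    split_ifs with h
    · simpa using hκ
    · exact not_lt.1 h

section Occ

variable [Nonempty A]

theorem isProbabilityMeasure_average {T : Type*} [MeasurableSpace T] {n : ℕ} (hn : n ≠ 0)
    (ν : ℕ → Measure T) [∀ i, IsProbabilityMeasure (ν i)] :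
    IsProbabilityMeasure ((n : ENNReal)⁻¹ • ∑ i ∈ Finset.range n, ν i) := by
  constructor
  simp only [Measure.smul_apply, Measure.coe_finsetSum, Finset.sum_apply, measure_univ,
    Finset.sum_const, Finset.card_range, nsmul_eq_mul, mul_one, smul_eq_mul]
  exact ENNReal.inv_mul_cancel (by exact_mod_cast hn) (ENNReal.natCast_ne_top n)

theorem isProbabilityMeasure_outerOcc (hK : 1 ≤ P.K) (X : Transcript S A d) (n : ℕ) :
    IsProbabilityMeasure (outerOcc M P X n) := by
  unfold outerOcc
  split_ifs
  · infer_instance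
  · exact isProbabilityMeasure_average (by omega) _

theorem isProbabilityMeasure_coverOcc (hK : 1 ≤ P.K) (X : Transcript S A d) {n : ℕ} (hn : n ≠ 0) :
    IsProbabilityMeasure (coverOcc M P X n) := by
  have := isProbabilityMeasure_outerOcc M P hK X
  exact isProbabilityMeasure_average hn _

end Occ

section Measurability

variable {Z : Type*} [MeasurableSpace Z] {X : Z → Transcript S A d}

theorem measurable_covMat {n : ℕ} (hf : ∀ i < n, Measurable fun z => (X z).feat i) (i j : Fin d) :
    Measurable fun z => covMat M P (X z) n i j := by
  simp only [covMat, Matrix.add_apply, Matrix.sum_apply, Matrix.vecMulVec_apply]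
  refine measurable_const.add (Finset.measurable_sum _ fun m hm => ?_)
  have h : Measurable fun z => M.φ ((X z).feat m) :=
    M.measurable_φ.comp (hf m (Finset.mem_Ico.1 hm).2)
  exact Measurable.mul (by fun_prop) (by fun_prop)

/-- A family of measurable functions, evaluated at a bounded random index. -/
theorem measurable_eval_of_le {β : Type*} [MeasurableSpace β] {n : ℕ} {τ : Z → ℕ}
    (hτ : Measurable τ) (hτn : ∀ z, τ z ≤ n) {F : ℕ → Z → β} (hF : ∀ l ≤ n, Measurable (F l)) :
    Measurable fun z => F (τ z) z := by
  intro s hs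
  have : (fun z => F (τ z) z) ⁻¹' s =
      ⋃ l ∈ Finset.range (n + 1), τ ⁻¹' {l} ∩ F l ⁻¹' s := by
    ext z
    simp only [Set.mem_preimage, Set.mem_iUnion, Finset.mem_range, Set.mem_inter_iff,
      Set.mem_singleton_iff, exists_prop]
    exact ⟨fun h => ⟨τ z, Nat.lt_succ_of_le (hτn z), rfl, h⟩, fun ⟨l, _, h1, h2⟩ => h1 ▸ h2⟩
  rw [this]
  exact Finset.measurableSet_biUnion _ fun l hl =>
    (hτ (measurableSet_singleton l)).inter (hF l (by have := Finset.mem_range.1 hl; omega) hs)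

theorem measurable_lastSwitch {n : ℕ} (hf : ∀ i < n, Measurable fun z => (X z).feat i) :
    Measurable fun z => lastSwitch M P (X z) n := by
  induction n with
  | zero => simp only [lastSwitch]; exact measurable_const
  | succ n ih =>
    have ih' := ih fun i hi => hf i (by omega)
    simp only [lastSwitch]
    have h1 : Measurable fun z => (covMat M P (X z) (lastSwitch M P (X z) n)).det :=
      measurable_eval_of_le ih' (fun z => lastSwitch_le M P (X z) n)
        (F := fun l z => (covMat M P (X z) l).det) fun l hl =>
          measurable_det_param (measurable_covMat M P fun i hi => hf i (by omega))
    have h2 : Measurable fun z => (covMat M P (X z) (n + 1)).det :=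
      measurable_det_param (measurable_covMat M P hf)
    refine Measurable.ite ?_ measurable_const ih'
    by_cases hn : n = 0
    · simp [hn]
    · simp only [hn, false_or]
      exact measurableSet_lt (h1.const_mul 2) h2

variable [Nonempty A] [DiscreteMeasurableSpace A]

theorem measurablePolicy_solverPolicy {m k : ℕ} (hf : ∀ i < m, Measurable fun z => (X z).feat i)
    (hw : ∀ i < k, Measurable fun z => (X z).what m i) :
    MeasurablePolicy fun z => solverPolicy M P (X z) m k :=
  measurablePolicy_innerPolicy M P (measurable_covMat M P hf) (w := fun z => (X z).what m) k hw

theorem measurable_smul_sum_measure {T : Type*} [MeasurableSpace T] (c : ENNReal) (s : Finset ℕ)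
    {ν : ℕ → Z → Measure T} (hν : ∀ i ∈ s, Measurable (ν i)) :
    Measurable fun z => c • ∑ i ∈ s, ν i z := by
  refine Measure.measurable_of_measurable_coe _ fun E hE => ?_
  simp only [Measure.smul_apply, Measure.coe_finsetSum, Finset.sum_apply, smul_eq_mul]
  exact (Finset.measurable_sum _ fun i hi =>
    (Measure.measurable_coe hE).comp (hν i hi)).const_mul c

theorem measurable_outerOcc {n : ℕ} (hf : ∀ i < n, Measurable fun z => (X z).feat i)
    (hw : ∀ m ≤ n, ∀ i, Measurable fun z => (X z).what m i) :
    Measurable fun z => outerOcc M P (X z) n := by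
  unfold outerOcc
  split_ifs with hn
  · exact measurable_const
  · exact measurable_eval_of_le (measurable_lastSwitch M P hf)
      (fun z => lastSwitch_le M P (X z) n)
      (F := fun l z => (P.K : ENNReal)⁻¹ • ∑ k ∈ Finset.range P.K,
        occ M (solverPolicy M P (X z) l k)) fun l hl =>
        measurable_smul_sum_measure _ _ fun k _ =>
          (measurablePolicy_solverPolicy M P (fun i hi => hf i (by omega))
            fun i _ => hw l hl i).measurable_occ M

theorem measurable_coverOcc {n : ℕ} (hf : ∀ i < n, Measurable fun z => (X z).feat i)
    (hw : ∀ m < n, ∀ i, Measurable fun z => (X z).what m i) :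
    Measurable fun z => coverOcc M P (X z) n :=
  measurable_smul_sum_measure _ _ fun l hl =>
    measurable_outerOcc M P (fun i hi => hf i (by have := Finset.mem_range.1 hl; omega))
      fun m hm i => hw m (by have := Finset.mem_range.1 hl; omega) i

end Measurability

end Transcript

/-! ### Concentration of the empirical covariance -/

section Covariance

variable {S A Ω : Type*} [MeasurableSpace S] [Fintype A] [Nonempty A] [MeasurableSpace A] {d : ℕ}

theorem measurable_feat_history (X : Ω → Transcript S A d) (n : ℕ) (J : ℕ → ℕ → Prop) {i : ℕ}
    (hi : i < n) : Measurable[history X n J] fun ω => (X ω).feat i :=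
  (comap_measurable _).mono ((le_iSup₂ (f := fun m (_ : m < n) =>
    MeasurableSpace.comap (fun ω => (X ω).feat m) inferInstance) i hi).trans le_sup_left) le_rfl

theorem measurable_what_history (X : Ω → Transcript S A d) (n : ℕ) (J : ℕ → ℕ → Prop) {m j : ℕ}
    (h : J m j) : Measurable[history X n J] fun ω => (X ω).what m j :=
  (comap_measurable _).mono ((le_sup_left.trans (le_iSup_of_le m (le_iSup₂ (f := fun j
    (_ : J m j) => MeasurableSpace.comap (fun ω => (X ω).what m j) inferInstance ⊔
      MeasurableSpace.comap (fun ω => (X ω).data m j) inferInstance) j h))).trans le_sup_right)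
    le_rfl

variable [DiscreteMeasurableSpace A] [mΩ : MeasurableSpace Ω] {M : FeatureMDP S A d} {P : Params}
  {μ : Measure Ω} {X : Ω → Transcript S A d}

theorem IsRun.history_le (hX : IsRun M P μ X) (n : ℕ) (J : ℕ → ℕ → Prop) :
    history X n J ≤ mΩ := by
  refine sup_le (iSup₂_le fun m _ => (hX.measurable_feat m).comap_le)
    (iSup_le fun m => iSup₂_le fun j _ => sup_le (hX.measurable_what m j).comap_le
      (hX.measurable_data m j).comap_le)

variable (M P)

/-- The second moment of the features in direction `v`, on average over iteration `i`. -/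
noncomputable def outerMoment (X : Transcript S A d) (v : EuclideanSpace ℝ (Fin d)) (i : ℕ) : ℝ :=
  ∫ x, inner ℝ (M.φ x) v ^ 2 ∂outerOcc M P X i

/-- The excess of the empirical second moment in direction `v` over twice its conditional
mean, summed over the iterations before `n`. -/
noncomputable def momentExcess (X : Transcript S A d) (v : EuclideanSpace ℝ (Fin d)) (n : ℕ) : ℝ :=
  ∑ i ∈ Finset.Ico 1 n, (inner ℝ (M.φ (X.feat i)) v ^ 2 - 2 * outerMoment M P X v i)

variable {M P}

theorem sq_inner_φ_le (M : FeatureMDP S A d) (x : S × A) {v : EuclideanSpace ℝ (Fin d)}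
    (hv : ‖v‖ ≤ 1) : inner ℝ (M.φ x) v ^ 2 ≤ 1 := by
  rw [← sq_abs]
  exact pow_le_one₀ (abs_nonneg _) ((abs_inner_φ_le M x v).trans hv)

theorem measurable_sq_inner (M : FeatureMDP S A d) (v : EuclideanSpace ℝ (Fin d)) :
    Measurable fun x => inner ℝ (M.φ x) v ^ 2 :=
  (M.measurable_φ.inner measurable_const).pow_const 2

theorem lintegral_exp_sq_inner_le (ν : Measure (S × A)) [IsProbabilityMeasure ν]
    {v : EuclideanSpace ℝ (Fin d)} (hv : ‖v‖ ≤ 1) :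
    ∫⁻ x, ENNReal.ofReal (Real.exp (inner ℝ (M.φ x) v ^ 2 -
      2 * ∫ x, inner ℝ (M.φ x) v ^ 2 ∂ν)) ∂ν ≤ 1 := by
  set e := ∫ x, inner ℝ (M.φ x) v ^ 2 ∂ν with he
  have hm := measurable_sq_inner M v
  have hi : Integrable (fun x => inner ℝ (M.φ x) v ^ 2) ν := integrable_of_abs_le hm (b := 1)
    fun x => by rw [abs_of_nonneg (sq_nonneg _)]; exact sq_inner_φ_le M x hv
  have hexp : Integrable (fun x => Real.exp (inner ℝ (M.φ x) v ^ 2)) ν :=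
    integrable_of_abs_le hm.exp (b := Real.exp 1) fun x => by
      rw [abs_of_pos (Real.exp_pos _)]; exact Real.exp_le_exp.2 (sq_inner_φ_le M x hv)
  have h1 : ∫ x, Real.exp (inner ℝ (M.φ x) v ^ 2) ∂ν ≤ Real.exp (2 * e) := by
    calc _ ≤ ∫ x, (1 + 2 * inner ℝ (M.φ x) v ^ 2) ∂ν := by
          refine integral_mono hexp ((integrable_const 1).add (hi.const_mul 2)) fun x => ?_
          have h2 := sq_inner_φ_le M x hv
          have h3 := exp_le_one_add_add_sq h2
          have h4 : 0 ≤ inner ℝ (M.φ x) v ^ 2 := sq_nonneg _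
          dsimp only
          nlinarith
      _ = 1 + 2 * e := by
          rw [integral_add (integrable_const 1) (hi.const_mul 2), integral_const_mul]; simp [he]
      _ ≤ _ := by linarith [Real.add_one_le_exp (2 * e)]
  rw [← ofReal_integral_eq_lintegral_ofReal]
  · simp only [Real.exp_sub, integral_div]
    rw [ENNReal.ofReal_le_one]
    exact (div_le_one (Real.exp_pos _)).2 h1
  · simp only [Real.exp_sub]
    exact hexp.div_const _
  · exact Filter.Eventually.of_forall fun x => (Real.exp_pos _).le

theorem measurable_outerMoment {Z : Type*} [MeasurableSpace Z] {X : Z → Transcript S A d} {n : ℕ}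
    (hK : 1 ≤ P.K) (hf : ∀ i < n, Measurable fun z => (X z).feat i)
    (hw : ∀ m ≤ n, ∀ i, Measurable fun z => (X z).what m i) (v : EuclideanSpace ℝ (Fin d)) :
    Measurable fun z => outerMoment M P (X z) v n := by
  let κ : Kernel Z (S × A) := ⟨_, measurable_outerOcc M P hf hw⟩
  have : IsMarkovKernel κ := ⟨fun z => isProbabilityMeasure_outerOcc M P hK (X z) n⟩
  exact ((measurable_sq_inner M v).stronglyMeasurable.integral_kernel (κ := κ)).measurable

theorem measurable_momentExcess {Z : Type*} [MeasurableSpace Z] {X : Z → Transcript S A d} {n : ℕ}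
    (hK : 1 ≤ P.K) (hf : ∀ i < n, Measurable fun z => (X z).feat i)
    (hw : ∀ m < n, ∀ i, Measurable fun z => (X z).what m i) (v : EuclideanSpace ℝ (Fin d)) :
    Measurable fun z => momentExcess M P (X z) v n := by
  refine Finset.measurable_sum _ fun i hi => ?_
  have hin := (Finset.mem_Ico.1 hi).2
  exact ((measurable_sq_inner M v).comp (hf i hin)).sub
    ((measurable_outerMoment hK (fun j hj => hf j (by omega))
      (fun m hm j => hw m (by omega) j) v).const_mul 2)

/-- The exponential of the moment excess is a supermartingale started at `1`. -/
theorem IsRun.lintegral_exp_momentExcess_le [IsProbabilityMeasure μ] (hX : IsRun M P μ X)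
    (hK : 1 ≤ P.K) {v : EuclideanSpace ℝ (Fin d)} (hv : ‖v‖ ≤ 1) {n : ℕ} (hn : 1 ≤ n)
    (hnN : n ≤ P.N + 1) :
    ∫⁻ ω, ENNReal.ofReal (Real.exp (momentExcess M P (X ω) v n)) ∂μ ≤ 1 := by
  induction n, hn using Nat.le_induction with
  | base => simp [momentExcess]
  | succ n hn ih =>
    have ih' := ih (by omega)
    let J : ℕ → ℕ → Prop := fun m _ => m ≤ n
    have hprob : ∀ ω, IsProbabilityMeasure (outerOcc M P (X ω) n) := fun ω =>
      isProbabilityMeasure_outerOcc M P hK (X ω) n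
    have hf : ∀ i < n, Measurable[history X n J] fun ω => (X ω).feat i := fun i hi =>
      measurable_feat_history X n _ hi
    have hw : ∀ m ≤ n, ∀ i, Measurable[history X n J] fun ω => (X ω).what m i := fun m hm i =>
      measurable_what_history X n _ hm
    have h1 := (hX.feat_law n hn (by omega)).lintegral_eq (hX.history_le n _)
      (@MeasurableSet.univ Ω (history X n J)) (hX.measurable_feat n)
      (@measurable_outerOcc _ _ _ _ _ _ M P Ω (history X n J) X _ _ n hf hw)
      (f := fun ω y => ENNReal.ofReal (Real.exp (momentExcess M P (X ω) v n) *
        Real.exp (inner ℝ (M.φ y) v ^ 2 - 2 * outerMoment M P (X ω) v n))) (by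
          have m1 := @measurable_momentExcess _ _ _ _ _ _ _ _ M P Ω (history X n J) X n hK hf
            (fun m hm i => hw m hm.le i) v
          have m2 := @measurable_outerMoment _ _ _ _ _ _ _ _ M P Ω (history X n J) X n hK hf hw v
          have gen : ∀ (Z : Type _) [MeasurableSpace Z] (g₁ g₂ : Z → ℝ), Measurable g₁ →
              Measurable g₂ → Measurable fun q : Z × (S × A) => ENNReal.ofReal (Real.exp (g₁ q.1) *
                Real.exp (inner ℝ (M.φ q.2) v ^ 2 - 2 * g₂ q.1)) := fun Z _ g₁ g₂ h₁ h₂ =>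
            ((h₁.comp measurable_fst).exp.mul ((((measurable_sq_inner M v).comp
              measurable_snd).sub ((h₂.comp measurable_fst).const_mul 2)).exp)).ennreal_ofReal
          exact @gen Ω (history X n J) _ _ m1 m2)
    simp only [Measure.restrict_univ] at h1
    calc ∫⁻ ω, ENNReal.ofReal (Real.exp (momentExcess M P (X ω) v (n + 1))) ∂μ
        = ∫⁻ ω, ENNReal.ofReal (Real.exp (momentExcess M P (X ω) v n) *
            Real.exp (inner ℝ (M.φ ((X ω).feat n)) v ^ 2 - 2 * outerMoment M P (X ω) v n)) ∂μ := by
          refine lintegral_congr fun ω => ?_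
          rw [momentExcess, Finset.sum_Ico_succ_top hn, Real.exp_add]
          rfl
      _ = _ := h1
      _ ≤ ∫⁻ ω, ENNReal.ofReal (Real.exp (momentExcess M P (X ω) v n)) ∂μ := by
          refine lintegral_mono fun ω => ?_
          simp only [ENNReal.ofReal_mul (Real.exp_pos _).le]
          rw [lintegral_const_mul _ (by
            exact ((measurable_sq_inner M v).sub_const _).exp.ennreal_ofReal)]
          exact mul_le_of_le_one_right' (lintegral_exp_sq_inner_le _ hv)
      _ ≤ 1 := ih'

theorem IsRun.measure_momentExcess_ge_le [IsProbabilityMeasure μ] (hX : IsRun M P μ X)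
    (hK : 1 ≤ P.K) {v : EuclideanSpace ℝ (Fin d)} (hv : ‖v‖ ≤ 1) {n : ℕ} (hn : 1 ≤ n)
    (hnN : n ≤ P.N + 1) {p : ℝ} (hp : 0 < p) :
    μ {ω | Real.log (1 / p) ≤ momentExcess M P (X ω) v n} ≤ ENNReal.ofReal p := by
  have hm : Measurable fun ω => momentExcess M P (X ω) v n :=
    measurable_momentExcess hK (fun i _ => hX.measurable_feat i)
      (fun m _ i => hX.measurable_what m i) v
  have h1 := mul_meas_ge_le_lintegral (μ := μ) (hm.exp.ennreal_ofReal) (ENNReal.ofReal (1 / p))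
  have h2 := h1.trans (hX.lintegral_exp_momentExcess_le hK hv hn hnN)
  have hset : {ω | Real.log (1 / p) ≤ momentExcess M P (X ω) v n} =
      {ω | ENNReal.ofReal (1 / p) ≤ ENNReal.ofReal (Real.exp (momentExcess M P (X ω) v n))} := by
    ext ω
    simp only [Set.mem_ofPred_eq]
    rw [ENNReal.ofReal_le_ofReal_iff (Real.exp_pos _).le, Real.log_le_iff_le_exp (by positivity)]
  rw [hset]
  rw [one_div, ENNReal.ofReal_inv_of_pos hp] at h2 ⊢
  rwa [← ENNReal.div_eq_inv_mul, ENNReal.div_le_iff (by simpa using hp) ENNReal.ofReal_ne_top,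
    one_mul] at h2

/-- From the points of a net to all directions. -/
theorem sum_sq_inner_feat_le (hK : 1 ≤ P.K) (X : Transcript S A d) {n : ℕ} {ε : ℝ} (hε0 : 0 ≤ ε)
    (hnε : n * ε ≤ 1) {Net : Finset (EuclideanSpace ℝ (Fin d))} (hball : ∀ c ∈ Net, ‖c‖ ≤ 1)
    (hnet : ∀ x : EuclideanSpace ℝ (Fin d), ‖x‖ ≤ 1 → ∃ c ∈ Net, ‖x - c‖ ≤ ε) {L : ℝ}
    (hL : ∀ c ∈ Net, momentExcess M P X c n < L) (v : EuclideanSpace ℝ (Fin d)) :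
    ∑ i ∈ Finset.Ico 1 n, inner ℝ (M.φ (X.feat i)) v ^ 2 ≤
      2 * ∑ i ∈ Finset.Ico 1 n, outerMoment M P X v i + (L + 6) * ‖v‖ ^ 2 := by
  have hunit : ∀ v : EuclideanSpace ℝ (Fin d), ‖v‖ ≤ 1 → momentExcess M P X v n ≤ L + 6 := by
    intro v hv
    obtain ⟨c, hc, hvc⟩ := hnet v hv
    have hpt : ∀ x, |inner ℝ (M.φ x) v ^ 2 - inner ℝ (M.φ x) c ^ 2| ≤ 2 * ε := fun x => by
      have e : inner ℝ (M.φ x) v ^ 2 - inner ℝ (M.φ x) c ^ 2 =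
          inner ℝ (M.φ x) (v - c) * inner ℝ (M.φ x) (v + c) := by
        rw [inner_sub_right, inner_add_right]; ring
      rw [e, abs_mul, mul_comm 2 ε]
      refine mul_le_mul ((abs_inner_φ_le M x _).trans hvc) ((abs_inner_φ_le M x _).trans ?_)
        (abs_nonneg _) hε0
      linarith [norm_add_le v c, hball c hc]
    have hi : ∀ v : EuclideanSpace ℝ (Fin d), ‖v‖ ≤ 1 → ∀ i,
        Integrable (fun x => inner ℝ (M.φ x) v ^ 2) (outerOcc M P X i) := fun v hv i => by
      have := isProbabilityMeasure_outerOcc M P hK X i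
      exact integrable_of_abs_le (measurable_sq_inner M v) (b := 1) fun x => by
        rw [abs_of_nonneg (sq_nonneg _)]; exact sq_inner_φ_le M x hv
    have hmom : ∀ i, |outerMoment M P X v i - outerMoment M P X c i| ≤ 2 * ε := fun i => by
      have := isProbabilityMeasure_outerOcc M P hK X i
      exact abs_integral_sub_le_of_abs_sub_le (hi v hv i) (hi c (hball c hc) i) hpt
    have hdiff : momentExcess M P X v n ≤ momentExcess M P X c n +
        ∑ i ∈ Finset.Ico 1 n, 6 * ε := by
      rw [momentExcess, momentExcess, ← Finset.sum_add_distrib]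
      refine Finset.sum_le_sum fun i _ => ?_
      linarith [(abs_le.1 (hpt (X.feat i))).2, (abs_le.1 (hmom i)).1]
    have hsum : ∑ i ∈ Finset.Ico 1 n, 6 * ε ≤ 6 := by
      simp only [Finset.sum_const, Nat.card_Ico, nsmul_eq_mul]
      have : ((n - 1 : ℕ) : ℝ) ≤ n := by exact_mod_cast Nat.sub_le n 1
      calc ((n - 1 : ℕ) : ℝ) * (6 * ε) ≤ n * (6 * ε) := by gcongr
        _ = 6 * (n * ε) := by ring
        _ ≤ 6 := by linarith
    linarith [hL c hc]
  rcases eq_or_ne v 0 with rfl | hv0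
  · simp [outerMoment]
  · have hnv : 0 < ‖v‖ := norm_pos_iff.2 hv0
    have h1 := hunit (‖v‖⁻¹ • v) (by
      rw [norm_smul, norm_inv, norm_norm, inv_mul_cancel₀ hnv.ne'])
    have h2 : momentExcess M P X (‖v‖⁻¹ • v) n = (‖v‖ ^ 2)⁻¹ * momentExcess M P X v n := by
      simp only [momentExcess, outerMoment, inner_smul_right, mul_pow, inv_pow, Finset.mul_sum,
        integral_const_mul]
      exact Finset.sum_congr rfl fun i _ => by ring
    rw [h2, inv_mul_le_iff₀ (by positivity), momentExcess, Finset.sum_sub_distrib,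
      ← Finset.mul_sum] at h1
    linarith

end Covariance

section Data

variable {S A Ω : Type*} [MeasurableSpace S] [Fintype A] [Nonempty A] [MeasurableSpace A] {d : ℕ}
  (M : FeatureMDP S A d) (P : Params)

/-! ### Large deviations of the collected data -/

theorem measure_biUnion_finset_le_card {T ι : Type*} [MeasurableSpace T] (μ : Measure T)
    (s : Finset ι) (E : ι → Set T) {p : ℝ} (h : ∀ i ∈ s, μ (E i) ≤ ENNReal.ofReal p) :
    μ (⋃ i ∈ s, E i) ≤ ENNReal.ofReal (s.card * p) := by
  refine (measure_biUnion_finset_le s E).trans ((Finset.sum_le_card_nsmul s _ _ h).trans_eq ?_)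
  rw [nsmul_eq_mul, ENNReal.ofReal_mul (Nat.cast_nonneg _), ENNReal.ofReal_natCast]

/-- The inner iterations that reuse data collected at most `κ` iterations earlier, as offsets. -/
noncomputable def window : Finset ℕ :=
  (Finset.range P.K).filter fun m => (m : ℝ) ≤ kappa M P

/-- The datasets of outer iteration `n`, collected in inner iteration `j`, that hold a rollout of
more than `H + 1` state-actions or show a large deviation at some points of the net. -/
def badData (X : Transcript S A d) (n j H : ℕ) (Net : Finset (EuclideanSpace ℝ (Fin d))) (p : ℝ) :
    Set (Fin n → Rollout S A) :=
  (⋃ i ∈ (Finset.univ : Finset (Fin n)), {D | H < (D i).1}) ∪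
    ⋃ m ∈ window M P, ⋃ a ∈ Net, ⋃ u ∈ Net, ⋃ v ∈ Net,
      deviationSet M P (covMat M P X n) (coverOcc M P X n) n H (X.what n) j m
        (M.W • a) (M.W • u) (M.W • v) p

variable {M P}

theorem norm_W_smul_le {c : EuclideanSpace ℝ (Fin d)} (hc : ‖c‖ ≤ 1) : ‖M.W • c‖ ≤ M.W := by
  have hW : 0 ≤ M.W := by rw [M.W_eq]; linarith [M.Gmax_pos]
  rw [norm_smul, Real.norm_of_nonneg hW]
  exact mul_le_of_le_one_right hW hc

variable [DiscreteMeasurableSpace A]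

theorem measure_badData_le (hK : 1 ≤ P.K) (hη : 0 ≤ P.η) (X : Transcript S A d) {n : ℕ}
    (hn : n ≠ 0) (j : ℕ) {H : ℕ}
    (hwin : ∀ m ∈ window M P, P.η * m * (2 * (M.B + M.W)) * H ≤ Real.log 2)
    {Net : Finset (EuclideanSpace ℝ (Fin d))} (hball : ∀ c ∈ Net, ‖c‖ ≤ 1) {p : ℝ} (hp : 0 < p) :
    Measure.pi (fun _ : Fin n => rolloutLaw M (coverOcc M P X n) (solverPolicy M P X n j))
      (badData M P X n j H Net p) ≤
      ENNReal.ofReal (n * M.γ ^ (H + 1) + P.K * ((Net.card : ℝ) ^ 3 * p)) := by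
  have := isProbabilityMeasure_coverOcc M P hK X hn
  rw [ENNReal.ofReal_add (mul_nonneg (Nat.cast_nonneg _) (pow_nonneg M.γ_nonneg _)) (by positivity)]
  refine (measure_union_le _ _).trans (add_le_add ?_ ?_)
  · refine (measure_biUnion_finset_le_card _ _ _ (p := M.γ ^ (H + 1)) fun i _ => ?_).trans_eq
      (by simp)
    have hset : {D : Fin n → Rollout S A | H < (D i).1} =
        Function.eval i ⁻¹' {z : Rollout S A | H < z.1} := rfl
    have hmeas : MeasurableSet {z : Rollout S A | H < z.1} :=
      measurable_fst (measurableSet_Ioi (a := H))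
    rw [hset, (measurePreserving_eval _ i).measure_preimage hmeas.nullMeasurableSet,
      rolloutLaw_long]
  · refine (measure_biUnion_finset_le_card _ _ _ (p := (Net.card : ℝ) ^ 3 * p)
      fun m hm => ?_).trans (ENNReal.ofReal_le_ofReal ?_)
    · refine (measure_biUnion_finset_le_card _ _ _ (p := Net.card * (Net.card * p))
        fun a ha => measure_biUnion_finset_le_card _ _ _ fun u hu =>
          measure_biUnion_finset_le_card _ _ _ fun v hv => ?_).trans_eq (by congr 1; ring)
      exact measure_deviationSet_le hη (hwin m hm) _ (norm_W_smul_le (hball a ha))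
        (norm_W_smul_le (hball u hu)) (norm_W_smul_le (hball v hv)) hp
    · gcongr
      exact (Finset.card_filter_le _ _).trans_eq (Finset.card_range _)

theorem measurableSet_deviationSet_param {Z : Type*} [MeasurableSpace Z]
    {Sg : Z → Matrix (Fin d) (Fin d) ℝ} (hSg : ∀ i j, Measurable fun z => Sg z i j)
    {w : Z → ℕ → EuclideanSpace ℝ (Fin d)} {j : ℕ} (hw : ∀ i < j, Measurable fun z => w z i)
    {ρ : Z → Measure (S × A)} (hρ : Measurable ρ) [∀ z, IsProbabilityMeasure (ρ z)]
    (n H m : ℕ) (a u v : EuclideanSpace ℝ (Fin d)) (p : ℝ) :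
    MeasurableSet {q : Z × (Fin n → Rollout S A) |
      q.2 ∈ deviationSet M P (Sg q.1) (ρ q.1) n H (w q.1) j m a u v p} := by
  let κ : Kernel Z (Rollout S A) :=
    ⟨_, (measurablePolicy_innerPolicy M P hSg j hw).measurable_rolloutLaw M hρ⟩
  have : IsMarkovKernel κ := ⟨fun z => inferInstanceAs
    (IsProbabilityMeasure (rolloutLaw M (ρ z) (innerPolicy M P (Sg z) (w z) j)))⟩
  have hloss : Measurable fun q : Z × Rollout S A =>
      excessLoss M P (Sg q.1) H (w q.1) j m a u v q.2 :=
    measurable_excessLoss_param (Sg := fun q : Z × Rollout S A => Sg q.1)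
      (fun i j => (hSg i j).comp measurable_fst) (w := fun q => w q.1)
      (fun i hi => (hw i hi).comp measurable_fst) a u v measurable_snd
  have hgap : Measurable fun q : Z × Rollout S A => predGap M a u (q.2.2 0) :=
    (measurable_predGap a u).comp ((measurable_pi_apply 0).comp measurable_snd.snd)
  have hint : Measurable fun z => ∫ y, (-(1 / (200 * M.Gmax ^ 2)) *
      excessLoss M P (Sg z) H (w z) j m a u v y +
        1 / (200 * M.Gmax ^ 2) / 2 * predGap M a u (y.2 0)) ∂κ z :=
    (((hloss.const_mul _).add (hgap.const_mul _)).stronglyMeasurable.integral_kernel_prod_right'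
      (κ := κ)).measurable
  refine measurableSet_le (((hint.comp measurable_fst).const_mul _).add_const _)
    (Finset.measurable_sum _ fun i _ => Measurable.const_mul ?_ _)
  exact hloss.comp (f := fun q : Z × (Fin n → Rollout S A) => (q.1, q.2 i))
    (measurable_fst.prodMk ((measurable_pi_apply i).comp measurable_snd))

theorem measurableSet_badData {Z : Type*} [MeasurableSpace Z] {X : Z → Transcript S A d}
    (hK : 1 ≤ P.K) {n j : ℕ} (hn : n ≠ 0) (hf : ∀ i < n, Measurable fun z => (X z).feat i)
    (hw : ∀ m < n, ∀ i, Measurable fun z => (X z).what m i)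
    (hw' : ∀ i < j, Measurable fun z => (X z).what n i) (H : ℕ)
    (Net : Finset (EuclideanSpace ℝ (Fin d))) (p : ℝ) :
    MeasurableSet {q : Z × (Fin n → Rollout S A) | q.2 ∈ badData M P (X q.1) n j H Net p} := by
  have := fun z => isProbabilityMeasure_coverOcc M P hK (X z) hn
  have hset : {q : Z × (Fin n → Rollout S A) | q.2 ∈ badData M P (X q.1) n j H Net p} =
      (⋃ i ∈ (Finset.univ : Finset (Fin n)),
        {q : Z × (Fin n → Rollout S A) | H < (q.2 i).1}) ∪
      ⋃ m ∈ window M P, ⋃ a ∈ Net, ⋃ u ∈ Net, ⋃ v ∈ Net, {q : Z × (Fin n → Rollout S A) | q.2 ∈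
        deviationSet M P (covMat M P (X q.1) n) (coverOcc M P (X q.1) n) n H ((X q.1).what n) j m
          (M.W • a) (M.W • u) (M.W • v) p} := by
    ext q
    simp only [badData, Set.mem_ofPred_eq, Set.mem_union, Set.mem_iUnion]
  rw [hset]
  refine (Finset.measurableSet_biUnion _ fun i _ => ?_).union
    (Finset.measurableSet_biUnion _ fun m _ => Finset.measurableSet_biUnion _ fun a _ =>
      Finset.measurableSet_biUnion _ fun u _ => Finset.measurableSet_biUnion _ fun v _ => ?_)
  · exact ((measurable_pi_apply i).comp measurable_snd).fst (measurableSet_Ioi (a := H))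
  · exact measurableSet_deviationSet_param (measurable_covMat M P hf) (w := fun z => (X z).what n)
      hw' (measurable_coverOcc M P hf hw) n H m _ _ _ p

theorem IsRun.measure_badData_le [mΩ : MeasurableSpace Ω] {μ : Measure Ω} [IsProbabilityMeasure μ]
    {X : Ω → Transcript S A d} (hX : IsRun M P μ X) (hK : 1 ≤ P.K) (hη : 0 ≤ P.η) {n : ℕ}
    (hn : 1 ≤ n) (hnN : n ≤ P.N) {j : ℕ} (hj : j < P.K) (hjj : lastCollect M P j = j) {H : ℕ}
    (hwin : ∀ m ∈ window M P, P.η * m * (2 * (M.B + M.W)) * H ≤ Real.log 2)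
    {Net : Finset (EuclideanSpace ℝ (Fin d))} (hball : ∀ c ∈ Net, ‖c‖ ≤ 1) {p : ℝ} (hp : 0 < p) :
    μ ({ω | lastSwitch M P (X ω) n = n} ∩
        {ω | (X ω).data n j ∈ badData M P (X ω) n j H Net p}) ≤
      ENNReal.ofReal (n * M.γ ^ (H + 1) + P.K * ((Net.card : ℝ) ^ 3 * p)) := by
  have hn0 : n ≠ 0 := by omega
  let J : ℕ → ℕ → Prop := fun m i => m < n ∨ (m = n ∧ i < j)
  have hprob := fun ω => isProbabilityMeasure_coverOcc M P hK (X ω) hn0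
  have hf : ∀ i < n, Measurable[history X n J] fun ω => (X ω).feat i := fun i hi =>
    measurable_feat_history X n _ hi
  have hw : ∀ m < n, ∀ i, Measurable[history X n J] fun ω => (X ω).what m i := fun m hm i =>
    measurable_what_history X n _ (Or.inl hm)
  have hw' : ∀ i < j, Measurable[history X n J] fun ω => (X ω).what n i := fun i hi =>
    measurable_what_history X n _ (Or.inr ⟨rfl, hi⟩)
  have hC : MeasurableSet[history X n J] {ω | lastSwitch M P (X ω) n = n} :=
    (@measurable_lastSwitch _ _ _ _ _ _ M P Ω (history X n J) X n hf) (measurableSet_singleton n)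
  have hroll := @MeasurablePolicy.measurable_rolloutLaw _ _ _ _ _ _ M Ω (history X n J) _ _
    (@measurablePolicy_solverPolicy _ _ _ _ _ _ M P Ω (history X n J) X _ _ n j hf hw') _
    (@measurable_coverOcc _ _ _ _ _ _ M P Ω (history X n J) X _ _ n hf hw) hprob
  exact (hX.data_law n hn hnN j hj hjj).measure_le (hX.history_le n _) hC (hX.measurable_data n j)
    (@measurable_pi_const _ _ Ω (history X n J) n _ hroll _)
    (@measurableSet_badData _ _ _ _ _ _ _ M P _ Ω (history X n J) X hK n j hn0 hf hw hw' H Net p)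
    fun ω => Copoe.measure_badData_le hK hη (X ω) hn0 j hwin hball hp

end Data

/-! ### Confidence ellipsoids -/

section Ellipsoid

/-- The Cauchy-Schwarz inequality for the quadratic forms of a positive definite matrix and of its
inverse. -/
theorem abs_inner_le_of_quadForm_le {d : ℕ} {Q : Matrix (Fin d) (Fin d) ℝ} (hQ : Q.PosDef)
    {x y : EuclideanSpace ℝ (Fin d)} {b : ℝ} (hb : x.ofLp ⬝ᵥ Q.mulVec x.ofLp ≤ b) :
    |inner ℝ y x| ≤ √b * wnorm Q⁻¹ y := by
  have hinner : inner ℝ y x = x.ofLp ⬝ᵥ y.ofLp := by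
    rw [EuclideanSpace.inner_eq_star_dotProduct, star_trivial]
  have hunit : IsUnit Q.det := (Matrix.isUnit_iff_isUnit_det Q).1 hQ.isUnit
  set z := Q⁻¹.mulVec y.ofLp with hz
  have hQz : Q.mulVec z = y.ofLp := by
    rw [hz, Matrix.mulVec_mulVec, Matrix.mul_nonsing_inv _ hunit, Matrix.one_mulVec]
  have hsymm : ∀ u v : Fin d → ℝ, u ⬝ᵥ Q.mulVec v = v ⬝ᵥ Q.mulVec u := fun u v => by
    have hT : Q.transpose = Q := by
      have := hQ.isHermitian.eq
      rwa [Matrix.conjTranspose_eq_transpose_of_trivial] at this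
    rw [Matrix.dotProduct_mulVec, ← Matrix.mulVec_transpose, hT, dotProduct_comm]
  have hnn : ∀ v : Fin d → ℝ, 0 ≤ v ⬝ᵥ Q.mulVec v := fun v => by
    simpa using hQ.posSemidef.dotProduct_mulVec_nonneg v
  set q := y.ofLp ⬝ᵥ z with hq
  have hdisc := discrim_le_zero (a := q) (b := -2 * (x.ofLp ⬝ᵥ y.ofLp))
    (c := x.ofLp ⬝ᵥ Q.mulVec x.ofLp) fun t => by
      have h1 := hnn (x.ofLp - t • z)
      have h2 : (x.ofLp - t • z) ⬝ᵥ Q.mulVec (x.ofLp - t • z) =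
          q * (t * t) + -2 * (x.ofLp ⬝ᵥ y.ofLp) * t + x.ofLp ⬝ᵥ Q.mulVec x.ofLp := by
        rw [Matrix.mulVec_sub, Matrix.mulVec_smul, hQz, sub_dotProduct, dotProduct_sub,
          dotProduct_sub, smul_dotProduct, smul_dotProduct, dotProduct_smul, dotProduct_smul,
          hsymm z x.ofLp, hQz, dotProduct_comm z, hq]
        simp only [smul_eq_mul]
        ring
      rw [← h2]
      exact h1
  have hq0 : 0 ≤ q := by
    have := hnn z
    rwa [hQz, dotProduct_comm] at this
  rw [hinner, wnorm, ← Real.sqrt_mul' _ hq0]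
  refine Real.abs_le_sqrt ?_
  rw [discrim] at hdisc
  nlinarith

variable {S A : Type*} [MeasurableSpace S] [Fintype A] [MeasurableSpace A] {d : ℕ}
  (M : FeatureMDP S A d) (P : Params)

theorem posDef_covMat (hlam : 0 < P.lam) (X : Transcript S A d) (n : ℕ) :
    (covMat M P X n).PosDef := by
  refine (Matrix.PosDef.one.smul hlam).add_posSemidef ?_
  refine Matrix.posSemidef_sum _ fun i _ => ?_
  simpa using Matrix.posSemidef_vecMulVec_self_star (M.φ (X.feat i)).ofLp

theorem quadForm_covMat (X : Transcript S A d) (n : ℕ) (x : EuclideanSpace ℝ (Fin d)) :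
    x.ofLp ⬝ᵥ (covMat M P X n).mulVec x.ofLp =
      P.lam * ‖x‖ ^ 2 + ∑ i ∈ Finset.Ico 1 n, inner ℝ (M.φ (X.feat i)) x ^ 2 := by
  have h1 : x.ofLp ⬝ᵥ x.ofLp = ‖x‖ ^ 2 := by
    rw [← real_inner_self_eq_norm_sq, EuclideanSpace.inner_eq_star_dotProduct, star_trivial]
  rw [covMat, Matrix.add_mulVec, dotProduct_add, Matrix.smul_mulVec, Matrix.one_mulVec,
    dotProduct_smul, h1, smul_eq_mul, Matrix.sum_mulVec, dotProduct_sum]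
  congr 1
  refine Finset.sum_congr rfl fun i _ => ?_
  rw [Matrix.vecMulVec_mulVec, EuclideanSpace.inner_eq_star_dotProduct, star_trivial]
  simp [sq, dotProduct_comm]

end Ellipsoid

/-! ### Choice of the net, the horizon and the failure probabilities -/

section Numbers

variable {S A : Type*} [MeasurableSpace S] [Fintype A] [Nonempty A] [MeasurableSpace A] {d : ℕ}
  {M : FeatureMDP S A d} {P : Params}

theorem exists_net_card_le (d : ℕ) {N : ℕ} (hN : 1 ≤ N) :
    ∃ Net : Finset (EuclideanSpace ℝ (Fin d)), (∀ c ∈ Net, ‖c‖ ≤ 1) ∧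
      1 ≤ (Net.card : ℝ) ∧ (Net.card : ℝ) ≤ (3 * N) ^ d ∧
      ∀ x : EuclideanSpace ℝ (Fin d), ‖x‖ ≤ 1 → ∃ c ∈ Net, ‖x - c‖ ≤ 1 / N := by
  have hN' : (1 : ℝ) ≤ N := by exact_mod_cast hN
  obtain ⟨Net, h1, h2, h3⟩ := exists_net_unitBall (E := EuclideanSpace ℝ (Fin d))
    (ε := 1 / (N : ℝ)) (by positivity)
  refine ⟨Net, h1, ?_, h2.trans ?_, h3⟩
  · obtain ⟨c, hc, -⟩ := h3 0 (by simp)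
    exact_mod_cast Finset.card_pos.2 ⟨c, hc⟩
  · rw [finrank_euclideanSpace_fin]
    refine pow_le_pow_left₀ (by positivity) ?_ d
    rw [div_div_eq_mul_div, div_one]
    linarith

/-- A rollout has more than `horizonCap + 1` state-actions with probability at most
`δ / (8 N² K)`. -/
noncomputable def horizonCap (M : FeatureMDP S A d) (P : Params) : ℕ :=
  ⌊Real.log (8 * P.N ^ 2 * P.K / P.δ) / (1 - M.γ)⌋₊

theorem one_lt_eight_mul_div (hN : 1 ≤ P.N) (hK : 1 ≤ P.K) (hδ : 0 < P.δ) (hδ1 : P.δ < 1) :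
    (1 : ℝ) < 8 * P.N ^ 2 * P.K / P.δ := by
  have hN' : (1 : ℝ) ≤ P.N := by exact_mod_cast hN
  have hK' : (1 : ℝ) ≤ P.K := by exact_mod_cast hK
  rw [one_lt_div hδ]
  have : (1 : ℝ) ≤ (P.N : ℝ) ^ 2 * P.K := one_le_mul_of_one_le_of_one_le (one_le_pow₀ hN') hK'
  linarith

theorem pow_horizonCap_le (hN : 1 ≤ P.N) (hK : 1 ≤ P.K) (hδ : 0 < P.δ) (hδ1 : P.δ < 1) :
    M.γ ^ (horizonCap M P + 1) ≤ P.δ / (8 * P.N ^ 2 * P.K) := by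
  have hγ := M.one_sub_γ_pos
  have h1 := one_lt_eight_mul_div hN hK hδ hδ1
  set L := Real.log (8 * P.N ^ 2 * P.K / P.δ) with hL
  have h2 : L < (1 - M.γ) * ((horizonCap M P : ℝ) + 1) := by
    have := Nat.lt_floor_add_one (L / (1 - M.γ))
    rw [div_lt_iff₀ hγ] at this
    rw [mul_comm]
    exact this
  calc M.γ ^ (horizonCap M P + 1) ≤ Real.exp (M.γ - 1) ^ (horizonCap M P + 1) :=
        pow_le_pow_left₀ M.γ_nonneg (by linarith [Real.add_one_le_exp (M.γ - 1)]) _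
    _ = Real.exp (-((1 - M.γ) * ((horizonCap M P : ℝ) + 1))) := by
        rw [← Real.exp_nat_mul]; push_cast; ring_nf
    _ ≤ Real.exp (-L) := Real.exp_le_exp.2 (by linarith)
    _ = P.δ / (8 * P.N ^ 2 * P.K) := by
        rw [Real.exp_neg, hL, Real.exp_log (by linarith), inv_div]

theorem B_add_W_pos (M : FeatureMDP S A d) : 0 < M.B + M.W := by
  rw [M.W_eq]; linarith [M.three_le_B, M.Gmax_pos]

theorem kappa_nonneg (hN : 1 ≤ P.N) (hK : 1 ≤ P.K) (hη : 0 < P.η) (hδ : 0 < P.δ)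
    (hδ1 : P.δ < 1) : 0 ≤ kappa M P := by
  have h1 := Real.log_pos (one_lt_eight_mul_div hN hK hδ hδ1)
  have h2 := M.one_sub_γ_pos
  have h3 := B_add_W_pos M
  have h4 := Real.log_pos one_lt_two
  rw [kappa]
  positivity

/-- The data reuse window is so short that importance weights of rollouts up to the horizon cap are
at most `2`. -/
theorem window_mul_horizonCap_le (hN : 1 ≤ P.N) (hK : 1 ≤ P.K) (hη : 0 < P.η) (hδ : 0 < P.δ)
    (hδ1 : P.δ < 1) {m : ℕ} (hm : m ∈ window M P) :
    P.η * m * (2 * (M.B + M.W)) * horizonCap M P ≤ Real.log 2 := by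
  have h1 := Real.log_pos (one_lt_eight_mul_div hN hK hδ hδ1)
  have h2 := M.one_sub_γ_pos
  have h3 := B_add_W_pos M
  have hm' : (m : ℝ) ≤ kappa M P := (Finset.mem_filter.1 hm).2
  have hκ := kappa_nonneg (M := M) hN hK hη hδ hδ1
  set L := Real.log (8 * P.N ^ 2 * P.K / P.δ) with hL
  have hH : (horizonCap M P : ℝ) ≤ L / (1 - M.γ) := Nat.floor_le (by positivity)
  calc P.η * m * (2 * (M.B + M.W)) * horizonCap M P
      ≤ P.η * kappa M P * (2 * (M.B + M.W)) * (L / (1 - M.γ)) := by gcongr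
    _ = Real.log 2 := by rw [kappa, ← hL]; field_simp

theorem log_card_le {x : ℝ} {N : ℕ} (hN : 1 ≤ N) (hx : 2 * N ≤ x) {c : ℝ} (hc : 1 ≤ c)
    (hcd : c ≤ (3 * N) ^ d) : Real.log c ≤ 2 * d * Real.log x := by
  have hN' : (1 : ℝ) ≤ N := by exact_mod_cast hN
  have h1 : c ≤ x ^ (2 * d) := by
    rw [pow_mul]
    refine hcd.trans (pow_le_pow_left₀ (by positivity) ?_ d)
    nlinarith
  have := Real.log_le_log (by linarith) h1
  rw [Real.log_pow] at this
  push_cast at this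
  exact this

theorem two_thirds_lt_log {x : ℝ} (hx : 2 ≤ x) : 2 / 3 < Real.log x := by
  have := Real.log_le_log two_pos hx
  linarith [Real.log_two_gt_d9]

theorem le_div_of_lt_one {a b : ℝ} (ha : 0 ≤ a) (hb : 0 < b) (hb1 : b ≤ 1) : a ≤ a / b := by
  rw [le_div_iff₀ hb]
  exact mul_le_of_le_one_right ha hb1

/-- The constant in the bound on the empirical covariance is absorbed by the regularization. -/
theorem log_covariance_le (hd : 1 ≤ d) (hN : 1 ≤ P.N) (hδ : 0 < P.δ) (hδ1 : P.δ < 1) {c : ℝ}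
    (hc : 1 ≤ c) (hcd : c ≤ (3 * P.N) ^ d) :
    Real.log (1 / (P.δ / (8 * P.N * c))) + 6 ≤ 14 * (d * Real.log (2 * P.N / P.δ)) := by
  have hN' : (1 : ℝ) ≤ P.N := by exact_mod_cast hN
  have hd' : (1 : ℝ) ≤ d := by exact_mod_cast hd
  set x := 2 * P.N / P.δ with hx
  have hxN : 2 * P.N ≤ x := le_div_of_lt_one (by positivity) hδ hδ1.le
  have hx2 : 2 ≤ x := by linarith
  have h1 := two_thirds_lt_log hx2
  have h2 := log_card_le hN hxN hc hcd
  have h3 : 1 / (P.δ / (8 * P.N * c)) ≤ x ^ 3 * c := by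
    have : 1 / (P.δ / (8 * P.N * c)) = 4 * x * c := by rw [hx]; field_simp; norm_num
    rw [this]
    refine mul_le_mul_of_nonneg_right ?_ (by linarith)
    nlinarith [mul_nonneg (sub_nonneg.2 hx2) (by positivity : 0 ≤ x * (x + 2))]
  have h4 : Real.log (1 / (P.δ / (8 * P.N * c))) ≤ 3 * Real.log x + Real.log c := by
    refine (Real.log_le_log (by positivity) h3).trans_eq ?_
    rw [Real.log_mul (by positivity) (by positivity), Real.log_pow]
    norm_num
  nlinarith

/-- The constant in the bound on the regression error is absorbed by the confidence width. -/
theorem log_regression_le (hd : 1 ≤ d) (hN : 1 ≤ P.N) (hK : 1 ≤ P.K) (hδ : 0 < P.δ)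
    (hδ1 : P.δ < 1) {c : ℝ} (hc : 1 ≤ c) (hcd : c ≤ (3 * P.N) ^ d) :
    Real.log (1 / (P.δ / (8 * P.N * P.K ^ 2 * c ^ 3))) + 1 ≤
      11 * (d * Real.log (2 * P.N * P.K / ((1 - M.γ) * P.δ))) := by
  have hN' : (1 : ℝ) ≤ P.N := by exact_mod_cast hN
  have hK' : (1 : ℝ) ≤ P.K := by exact_mod_cast hK
  have hd' : (1 : ℝ) ≤ d := by exact_mod_cast hd
  have hγ := M.one_sub_γ_pos
  set x := 2 * P.N * P.K / ((1 - M.γ) * P.δ) with hx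
  set y := 2 * P.N * P.K / P.δ with hy
  have hyN : 2 * (P.N : ℝ) ≤ y :=
    (le_mul_of_one_le_right (by positivity) hK').trans
      (le_div_of_lt_one (by positivity) hδ hδ1.le)
  have hyx : y ≤ x := by
    have : x = y / (1 - M.γ) := by rw [hx, hy]; field_simp
    rw [this]
    exact le_div_of_lt_one (by positivity) hγ (by linarith [M.γ_nonneg])
  have hx2 : 2 ≤ x := by linarith
  have h1 := two_thirds_lt_log hx2
  have h2 := log_card_le hN (hyN.trans hyx) hc hcd
  have h3 : 1 / (P.δ / (8 * P.N * P.K ^ 2 * c ^ 3)) ≤ x ^ 3 * c ^ 3 := by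
    have e1 : 1 / (P.δ / (8 * P.N * P.K ^ 2 * c ^ 3)) = 8 * P.N * P.K ^ 2 / P.δ * c ^ 3 := by
      field_simp
    rw [e1]
    refine mul_le_mul_of_nonneg_right ?_ (by positivity)
    refine le_trans ?_ (pow_le_pow_left₀ (by positivity) hyx 3)
    have e2 : y ^ 3 = 8 * P.N * P.K ^ 2 / P.δ * (P.N ^ 2 * P.K / P.δ ^ 2) := by
      rw [hy]; field_simp; norm_num
    rw [e2]
    refine le_mul_of_one_le_right (by positivity) ?_
    exact (one_le_mul_of_one_le_of_one_le (one_le_pow₀ hN') hK').trans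
      (le_div_of_lt_one (by positivity) (by positivity) (pow_le_one₀ hδ.le hδ1.le))
  have h4 : Real.log (1 / (P.δ / (8 * P.N * P.K ^ 2 * c ^ 3))) ≤
      3 * Real.log x + 3 * Real.log c := by
    refine (Real.log_le_log (by positivity) h3).trans_eq ?_
    rw [Real.log_mul (by positivity) (by positivity), Real.log_pow, Real.log_pow]
    norm_num
  nlinarith

end Numbers

/-! ### Executions without large deviations -/

section Good

variable {S A Ω : Type*} [MeasurableSpace S] [Fintype A] [Nonempty A] [MeasurableSpace A] {d : ℕ}
  {M : FeatureMDP S A d} {P : Params} [DiscreteMeasurableSpace A]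

theorem sum_outerMoment_le (hK : 1 ≤ P.K) (X : Transcript S A d) {n : ℕ} (hn : 1 ≤ n)
    (v : EuclideanSpace ℝ (Fin d)) :
    ∑ i ∈ Finset.Ico 1 n, outerMoment M P X v i ≤
      n * ∫ x, inner ℝ (M.φ x) v ^ 2 ∂coverOcc M P X n := by
  have hn' : (n : ℝ) ≠ 0 := by positivity
  have hprob := isProbabilityMeasure_outerOcc M P hK X
  have hi : ∀ i ∈ Finset.range n,
      Integrable (fun x => inner ℝ (M.φ x) v ^ 2) (outerOcc M P X i) := fun i _ =>
    integrable_of_abs_le (measurable_sq_inner M v) (b := ‖v‖ ^ 2) fun x => by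
      rw [abs_pow]; exact pow_le_pow_left₀ (abs_nonneg _) (abs_inner_φ_le M x v) 2
  rw [coverOcc, integral_smul_measure, integral_finsetSum_measure hi, ENNReal.toReal_inv,
    ENNReal.toReal_natCast, smul_eq_mul, ← mul_assoc, mul_inv_cancel₀ hn', one_mul]
  refine Finset.sum_le_sum_of_subset_of_nonneg (fun i hi => ?_) fun i _ _ =>
    integral_nonneg fun x => sq_nonneg _
  exact Finset.mem_range.2 (Finset.mem_Ico.1 hi).2

/-- Reused data: the policy `π_{j + t}` is the tilt of `π_j` by the average of the parameters
in between. -/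
theorem exists_tiltPolicy_eq {Sg : Matrix (Fin d) (Fin d) ℝ} {w : ℕ → EuclideanSpace ℝ (Fin d)}
    {R : ℝ} (hR : 0 ≤ R) (j t : ℕ) (hw : ∀ i < j + t, ‖w i‖ ≤ R) :
    ∃ v, ‖v‖ ≤ R ∧ tiltPolicy M P Sg w j t v = innerPolicy M P Sg w (j + t) := by
  have hsum : ‖∑ i ∈ Finset.range t, w (j + i)‖ ≤ t * R :=
    (norm_sum_le_of_le _ fun i hi => hw (j + i) (by have := Finset.mem_range.1 hi; omega)).trans_eq
      (by simp)
  refine ⟨(t : ℝ)⁻¹ • ∑ i ∈ Finset.range t, w (j + i), ?_, ?_⟩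
  · rcases Nat.eq_zero_or_pos t with rfl | ht
    · simpa using hR
    · rw [norm_smul, norm_inv, Real.norm_natCast, inv_mul_le_iff₀ (by exact_mod_cast ht)]
      exact hsum
  · have h := innerProb_splice_average M P Sg w j t
      (v := (t : ℝ)⁻¹ • ∑ i ∈ Finset.range t, w (j + i)) (by
        rcases Nat.eq_zero_or_pos t with rfl | ht
        · simp
        · rw [smul_smul, mul_inv_cancel₀ (by positivity), one_smul])
    simp only [tiltPolicy, innerPolicy, h]

/-- The confidence ellipsoid: the regression parameters of the critic are close to the best ones
in the norm of the empirical covariance. -/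
theorem abs_inner_param_sub_le (hK : 1 ≤ P.K) (hη : 0 ≤ P.η) (hκ : 0 ≤ kappa M P)
    (hlam : 0 < P.lam) (X : Transcript S A d) {n : ℕ} (hn : 1 ≤ n) (hnN : n ≤ P.N)
    {Net : Finset (EuclideanSpace ℝ (Fin d))} (hball : ∀ c ∈ Net, ‖c‖ ≤ 1)
    (hnet : ∀ x : EuclideanSpace ℝ (Fin d), ‖x‖ ≤ 1 → ∃ c ∈ Net, ‖x - c‖ ≤ 1 / P.N)
    {H : ℕ} (hwin : ∀ m ∈ window M P, P.η * m * (2 * (M.B + M.W)) * H ≤ Real.log 2)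
    (hnγ : n * M.γ ^ (H + 1) ≤ 1) {L p : ℝ} (hL : L + 6 ≤ P.lam)
    (hβ : 800 * M.Gmax ^ 2 * (Real.log (1 / p) + 1) + 8 * P.lam * M.W ^ 2 ≤ P.β)
    (hcrit : ∀ k < P.K, IsCriticParam M P X n k (X.what n k))
    (hcov : ∀ c ∈ Net, momentExcess M P X c n < L)
    {k : ℕ} (hk : k < P.K)
    (hdata : X.data n (lastCollect M P k) ∉ badData M P X n (lastCollect M P k) H Net p)
    {w : EuclideanSpace ℝ (Fin d)} (hw : IsBestParam M P X n k w) (x : S × A) :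
    |inner ℝ (M.φ x) (w - X.what n k)| ≤ √P.β * wnorm (covMat M P X n)⁻¹ (M.φ x) := by
  have hN' : (1 : ℝ) ≤ P.N := by exact_mod_cast hn.trans hnN
  have hn' : (1 : ℝ) ≤ n := by exact_mod_cast hn
  have hnN' : (n : ℝ) ≤ P.N := by exact_mod_cast hnN
  have hnε : (n : ℝ) * (1 / P.N) ≤ 1 := by
    rw [mul_one_div]; exact div_le_one_of_le₀ hnN' (by positivity)
  have hW : 0 < M.W := by rw [M.W_eq]; linarith [M.Gmax_pos]
  have hprob := isProbabilityMeasure_coverOcc M P hK X (n := n) (by omega)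
  obtain ⟨t, ht⟩ := Nat.exists_eq_add_of_le (lastCollect_le M P k)
  set j := lastCollect M P k with hj
  have htwin : t ∈ window M P := by
    refine Finset.mem_filter.2 ⟨Finset.mem_range.2 (by omega), ?_⟩
    have h := sub_lastCollect_le M P hκ k
    rw [← hj] at h
    have e : (k : ℝ) = j + t := by exact_mod_cast ht
    linarith
  obtain ⟨v, hv, hvt⟩ := exists_tiltPolicy_eq (M := M) (P := P) (Sg := covMat M P X n)
    (w := X.what n) hW.le j t fun i hi => (hcrit i (by omega)).1
  have hpol : solverPolicy M P X n k =
      tiltPolicy M P (covMat M P X n) (X.what n) j t v := by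
    rw [hvt, ← ht]; rfl
  simp only [badData, Set.mem_union, Set.mem_iUnion, Set.mem_ofPred_eq, not_or, not_exists,
    not_lt] at hdata
  have ha : IsBallArgmin (empLoss M P (bonus M P (covMat M P X n))
      (innerPolicy M P (covMat M P X n) (X.what n) j)
      (tiltPolicy M P (covMat M P X n) (X.what n) j t v) (X.data n j)) M.W (X.what n k) := by
    have := hcrit k hk
    rw [IsCriticParam, hpol] at this
    exact this
  have hu : IsBallArgmin (popLoss M (coverOcc M P X n) fun x => qValue M
      (tiltPolicy M P (covMat M P X n) (X.what n) j t v) (bonusReward M P (covMat M P X n)) x -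
        bonus M P (covMat M P X n) x) M.W w := by
    rw [IsBestParam, hpol] at hw
    exact hw
  have hgap := integral_predGap_le hη (hwin t htwin) (coverOcc M P X n) (ε := 1 / P.N)
    (by positivity) (div_le_one_of_le₀ hN' (by positivity)) hnε hnγ hball hnet
    (fun i => hdata.1 i (Finset.mem_univ i))
    (fun a ha u hu v hv => hdata.2 t htwin a ha u hu v hv) hv ha hu
  -- in the norm of the empirical covariance, `w - ŵ` is bounded through its second moments under the
  -- policy cover, up to a multiple of `λ ‖w - ŵ‖²`
  set y := w - X.what n k with hy
  have hgap' : (n : ℝ) * ∫ x, inner ℝ (M.φ x) y ^ 2 ∂coverOcc M P X n ≤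
      400 * M.Gmax ^ 2 * (Real.log (1 / p) + 1) := by
    refine le_trans (le_of_eq ?_) hgap
    congr 1
    refine integral_congr_ae (Filter.Eventually.of_forall fun x => ?_)
    simp only [predGap, hy, inner_sub_right]
    ring
  have hcovy := sum_sq_inner_feat_le hK X (by positivity) hnε hball hnet hcov y
  have hmom := sum_outerMoment_le (M := M) hK X hn y
  have hynorm : ‖y‖ ^ 2 ≤ 4 * M.W ^ 2 := by
    have h1 : ‖y‖ ≤ 2 * M.W := (norm_sub_le _ _).trans (by linarith [hw.1, ha.1])
    calc ‖y‖ ^ 2 ≤ (2 * M.W) ^ 2 := pow_le_pow_left₀ (norm_nonneg _) h1 2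
      _ = _ := by ring
  refine abs_inner_le_of_quadForm_le (posDef_covMat M P hlam X n) ?_
  rw [quadForm_covMat]
  have h1 : (L + 6) * ‖y‖ ^ 2 ≤ P.lam * ‖y‖ ^ 2 := by gcongr
  have h2 : P.lam * ‖y‖ ^ 2 ≤ P.lam * (4 * M.W ^ 2) := by gcongr
  linarith

/-- The bonus terms of the two predictors differ by `bonusPhi` on known states, so that only the
linear parts have to be compared; on the other states the predictors agree. -/
theorem bestQ_sub_criticQ_bounds {Sg : Matrix (Fin d) (Fin d) ℝ}
    {w w' : EuclideanSpace ℝ (Fin d)} (x : S × A)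
    (h : |inner ℝ (M.φ x) (w - w')| ≤ √P.β * wnorm Sg⁻¹ (M.φ x)) :
    |bestQ M P Sg w x - criticQ M P Sg w' x - bonusPhi M P Sg x| ≤ bonusPhi M P Sg x := by
  by_cases hs : KnownState M P Sg x.1
  · have hb : bonusPhi M P Sg x = √P.β * wnorm Sg⁻¹ (M.φ x) := if_pos hs
    have e : bestQ M P Sg w x - criticQ M P Sg w' x - bonusPhi M P Sg x =
        inner ℝ (M.φ x) (w - w') := by
      simp only [bestQ, criticQ, if_pos hs, bonus_eq_of_knownState M P Sg hs, inner_sub_right]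
      ring
    rw [e, hb]
    exact h
  · simp [bestQ, criticQ, bonusPhi, hs]

end Good

/-! ### The failure probability -/

section Bad

variable {S A Ω : Type*} [MeasurableSpace S] [Fintype A] [Nonempty A] [MeasurableSpace A] {d : ℕ}
  (M : FeatureMDP S A d) (P : Params)

/-- Some empirical covariance exceeds its bound at a point of the net, or some dataset collected by
the solver is bad. -/
def badEvent (X : Ω → Transcript S A d) (H : ℕ) (Net : Finset (EuclideanSpace ℝ (Fin d)))
    (p q : ℝ) : Set Ω :=
  (⋃ n ∈ Finset.Icc 1 P.N, ⋃ c ∈ Net, {ω | Real.log (1 / p) ≤ momentExcess M P (X ω) c n}) ∪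
    ⋃ n ∈ Finset.Icc 1 P.N, ⋃ j ∈ (Finset.range P.K).filter (fun j => lastCollect M P j = j),
      {ω | lastSwitch M P (X ω) n = n} ∩ {ω | (X ω).data n j ∈ badData M P (X ω) n j H Net q}

variable {M P} [DiscreteMeasurableSpace A]

theorem IsRun.measure_badEvent_le [mΩ : MeasurableSpace Ω] {μ : Measure Ω}
    [IsProbabilityMeasure μ] {X : Ω → Transcript S A d} (hX : IsRun M P μ X) (hN : 1 ≤ P.N)
    (hK : 1 ≤ P.K) (hη : 0 < P.η) (hδ : 0 < P.δ) (hδ1 : P.δ < 1)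
    {Net : Finset (EuclideanSpace ℝ (Fin d))} (hball : ∀ c ∈ Net, ‖c‖ ≤ 1)
    (hcard : 1 ≤ (Net.card : ℝ)) :
    μ (badEvent M P X (horizonCap M P) Net (P.δ / (8 * P.N * Net.card))
      (P.δ / (8 * P.N * P.K ^ 2 * (Net.card : ℝ) ^ 3))) ≤ ENNReal.ofReal (P.δ / 2) := by
  have hN' : (1 : ℝ) ≤ P.N := by exact_mod_cast hN
  have hK' : (1 : ℝ) ≤ P.K := by exact_mod_cast hK
  have hp : 0 < P.δ / (8 * P.N * Net.card) := by positivity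
  have hq : 0 < P.δ / (8 * P.N * P.K ^ 2 * (Net.card : ℝ) ^ 3) := by positivity
  have h1 : μ (⋃ n ∈ Finset.Icc 1 P.N, ⋃ c ∈ Net, {ω | Real.log (1 / (P.δ / (8 * P.N * Net.card))) ≤
      momentExcess M P (X ω) c n}) ≤ ENNReal.ofReal (P.δ / 8) := by
    refine (measure_biUnion_finset_le_card μ _ _ fun n hn =>
      measure_biUnion_finset_le_card μ _ _ fun c hc =>
        hX.measure_momentExcess_ge_le hK (hball c hc) (Finset.mem_Icc.1 hn).1
          ((Finset.mem_Icc.1 hn).2.trans (Nat.le_succ _)) hp).trans_eq ?_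
    rw [Nat.card_Icc, Nat.add_sub_cancel]
    congr 1
    field_simp
  have h2 : μ (⋃ n ∈ Finset.Icc 1 P.N,
      ⋃ j ∈ (Finset.range P.K).filter (fun j => lastCollect M P j = j),
      {ω | lastSwitch M P (X ω) n = n} ∩ {ω | (X ω).data n j ∈
        badData M P (X ω) n j (horizonCap M P) Net
          (P.δ / (8 * P.N * P.K ^ 2 * (Net.card : ℝ) ^ 3))}) ≤ ENNReal.ofReal (P.δ / 4) := by
    refine (measure_biUnion_finset_le_card μ _ _ (p := P.K * (P.δ / (4 * P.N * P.K)))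
      fun n hn => ?_).trans_eq ?_
    · obtain ⟨hn1, hn2⟩ := Finset.mem_Icc.1 hn
      have hn2' : (n : ℝ) ≤ P.N := by exact_mod_cast hn2
      refine (measure_biUnion_finset_le_card μ _ _ (p := P.δ / (4 * P.N * P.K))
        fun j hj => ?_).trans (ENNReal.ofReal_le_ofReal ?_)
      · obtain ⟨hj1, hj2⟩ := Finset.mem_filter.1 hj
        refine (hX.measure_badData_le hK hη.le hn1 hn2 (Finset.mem_range.1 hj1) hj2
          (fun m hm => window_mul_horizonCap_le hN hK hη hδ hδ1 hm) hball hq).trans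
          (ENNReal.ofReal_le_ofReal ?_)
        calc _ ≤ P.N * (P.δ / (8 * P.N ^ 2 * P.K)) + P.K * ((Net.card : ℝ) ^ 3 *
              (P.δ / (8 * P.N * P.K ^ 2 * (Net.card : ℝ) ^ 3))) := by
              gcongr
              · exact pow_nonneg M.γ_nonneg _
              · exact pow_horizonCap_le hN hK hδ hδ1
          _ = P.δ / (4 * P.N * P.K) := by field_simp; norm_num
      · gcongr
        exact (Finset.card_filter_le _ _).trans_eq (Finset.card_range _)
    · rw [Nat.card_Icc, Nat.add_sub_cancel]
      congr 1
      field_simp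
  refine (measure_union_le _ _).trans ((add_le_add h1 h2).trans ?_)
  rw [← ENNReal.ofReal_add (by positivity) (by positivity)]
  exact ENNReal.ofReal_le_ofReal (by linarith)

end Bad

end Copoe

open Copoe in
theorem mainTheorem4 :
    ∃ c : ℝ, 0 < c ∧
      ∀ (d : ℕ) (S : Type*) [MeasurableSpace S]
        (A : Type*) [Fintype A] [Nonempty A] [MeasurableSpace A] [DiscreteMeasurableSpace A]
        (M : Copoe.FeatureMDP S A d) (P : Copoe.Params),
        1 ≤ P.N → 1 ≤ P.K → 0 < P.η → 0 < P.δ → P.δ < 1 →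
        c * d * Real.log (2 * P.N / P.δ) ≤ P.lam →
        c * (d * (M.W ^ 2 + M.Gmax ^ 2) *
            Real.log (2 * P.N * P.K / ((1 - M.γ) * P.δ)) + P.lam * M.W ^ 2) ≤ P.β →
        ∀ (Ω : Type*) [MeasurableSpace Ω] (μ : Measure Ω) [IsProbabilityMeasure μ]
          (X : Ω → Copoe.Transcript S A d), Copoe.IsRun M P μ X →
          μ {ω | ¬ ∀ n, 1 ≤ n → n ≤ P.N → ∀ k < P.K,
              -- the last outer iteration up to `n` in which the solver was called
              ∀ m, m = Copoe.lastSwitch M P (X ω) n →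
              ∀ w, Copoe.IsBestParam M P (X ω) m k w →
              ∀ x : S × A, Copoe.KnownPair M P (Copoe.covMat M P (X ω) m) x →
                let Qstar := Copoe.bestQ M P (Copoe.covMat M P (X ω) m) w x
                let Qhat := Copoe.criticQ M P (Copoe.covMat M P (X ω) m) ((X ω).what m k) x
                let b := Copoe.bonusPhi M P (Copoe.covMat M P (X ω) m) x
                |Qstar - Qhat - b| ≤ b ∧ 0 ≤ Qstar - Qhat ∧ Qstar - Qhat ≤ 2 * b}
            ≤ ENNReal.ofReal (P.δ / 2) := by
  refine ⟨10000, by norm_num, ?_⟩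
  intro d S _ A _ _ _ _ M P hN hK hη hδ hδ1 hlam hβ Ω _ μ _ X hX
  obtain ⟨Net, hball, hcard, hcardd, hnet⟩ := exists_net_card_le d hN
  refine (measure_mono ?_).trans (hX.measure_badEvent_le hN hK hη hδ hδ1 hball hcard)
  intro ω hω
  by_contra hgood
  refine hω fun n hn hnN k hk m hm w hw x _ => ?_
  suffices h : |bestQ M P (covMat M P (X ω) m) w x -
      criticQ M P (covMat M P (X ω) m) ((X ω).what m k) x - bonusPhi M P (covMat M P (X ω) m) x| ≤
      bonusPhi M P (covMat M P (X ω) m) x by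
    have := abs_le.1 h
    exact ⟨h, by linarith [this.1], by linarith [this.2]⟩
  refine bestQ_sub_criticQ_bounds x ?_
  rcases Nat.eq_zero_or_pos d with rfl | hd
  · -- in dimension zero all predictions vanish
    rw [Subsingleton.elim (w - (X ω).what m k) 0, inner_zero_right, abs_zero]
    exact mul_nonneg (Real.sqrt_nonneg _) (Real.sqrt_nonneg _)
  have hm1 : 1 ≤ m := hm ▸ one_le_lastSwitch M P (X ω) hn
  have hmN : m ≤ P.N := hm ▸ (lastSwitch_le M P (X ω) n).trans hnN
  -- the objects of iteration `n` are those of `m`, at which the solver was called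
  have hmm : lastSwitch M P (X ω) m = m := by rw [hm]; exact lastSwitch_lastSwitch M P (X ω) n
  simp only [badEvent, Set.mem_union, Set.mem_iUnion, Set.mem_inter_iff, Set.mem_ofPred_eq,
    not_or, not_exists, not_and, not_le] at hgood
  have hN' : (1 : ℝ) ≤ P.N := by exact_mod_cast hN
  have hK' : (1 : ℝ) ≤ P.K := by exact_mod_cast hK
  have hd' : (1 : ℝ) ≤ d := by exact_mod_cast hd
  have hlog0 : 0 < Real.log (2 * P.N / P.δ) := by
    refine Real.log_pos ((one_lt_div hδ).2 ?_); linarith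
  -- `λ` has to be at least `14 d log (2 N / δ)`, and `β` at least
  -- `8800 G_max² d log (2 N K / ((1 - γ) δ)) + 8 λ W²`
  have hcov := log_covariance_le hd hN hδ hδ1 hcard hcardd
  have hreg := log_regression_le (M := M) hd hN hK hδ hδ1 hcard hcardd
  have hdl : 0 < d * Real.log (2 * P.N / P.δ) := by positivity
  have hlam' : 0 < P.lam := by linarith
  have hreg0 : 0 ≤ d * Real.log (2 * P.N * P.K / ((1 - M.γ) * P.δ)) := by
    refine mul_nonneg (by positivity) (Real.log_nonneg ?_)
    rw [one_le_div (mul_pos M.one_sub_γ_pos hδ)]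
    have h1 : (1 : ℝ) ≤ P.N * P.K := one_le_mul_of_one_le_of_one_le hN' hK'
    have h2 : (1 - M.γ) * P.δ ≤ 1 :=
      mul_le_one₀ (by linarith [M.γ_nonneg]) hδ.le hδ1.le
    linarith
  refine abs_inner_param_sub_le hK hη.le (kappa_nonneg hN hK hη hδ hδ1) hlam' (X ω) hm1 hmN hball
    hnet (fun t ht => window_mul_horizonCap_le hN hK hη hδ hδ1 ht) ?_ (by linarith) ?_
    (fun i hi => hX.critic m hm1 hmN i hi ω hmm)
    (fun c hc => hgood.1 m (Finset.mem_Icc.2 ⟨hm1, hmN⟩) c hc) hk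
    (hgood.2 m (Finset.mem_Icc.2 ⟨hm1, hmN⟩) _ (Finset.mem_filter.2
      ⟨Finset.mem_range.2 ((lastCollect_le M P k).trans_lt hk), lastCollect_lastCollect M P k⟩) hmm)
    hw x
  · have hm' : (m : ℝ) ≤ P.N := by exact_mod_cast hmN
    calc (m : ℝ) * M.γ ^ (horizonCap M P + 1) ≤ P.N * (P.δ / (8 * P.N ^ 2 * P.K)) := by
          gcongr
          · exact pow_nonneg M.γ_nonneg _
          · exact pow_horizonCap_le hN hK hδ hδ1
      _ = P.δ / (8 * P.N * P.K) := by field_simp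
      _ ≤ 1 := by
          refine div_le_one_of_le₀ ?_ (by positivity)
          have h1 : (1 : ℝ) ≤ P.N * P.K := one_le_mul_of_one_le_of_one_le hN' hK'
          linarith
  · refine le_trans ?_ hβ
    have hG := sq_nonneg M.Gmax
    have h1 : M.Gmax ^ 2 * (Real.log (1 / (P.δ / (8 * P.N * P.K ^ 2 * (Net.card : ℝ) ^ 3))) + 1) ≤
        M.Gmax ^ 2 * (11 * (d * Real.log (2 * P.N * P.K / ((1 - M.γ) * P.δ)))) := by gcongr
    have h2 := mul_nonneg hG hreg0
    have h3 := mul_nonneg (sq_nonneg M.W) hreg0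
    have h4 := mul_nonneg hlam'.le (sq_nonneg M.W)
    linarith
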